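/- Let $q,d\in\mathbb{C}^\times$ satisfy $q^nd^m\neq 1$ for all $(n,m)\in\mathbb{Z}^2\setminus\{(0,0)\}$, put $q_1=q^{-1}d$, $q_2=q^2$, $q_3=q^{-1}d^{-1}$, and let $u_1,u_2\in\mathbb{C}$. *Fock space.* For $u\in\mathbb{C}$ let $\mathcal{F}_u=\bigoplus_{n\in\mathbb{Z}}\mathbb{C}[\alpha_{i,-r}\,;\,i=1,2,\ r\ge 1]\,|n,u\rangle$, where $\alpha_{i,r}|n,u\rangle=0$ for $r>0$, $\alpha_{1,0}=-\alpha_{2,0}$ acts as $n$ on the summand of $|n,u\rangle$, and for $r,s\neq 0$ $$[\alpha_{i,r},\alpha_{i,s}]=r(1+q_2^{-|r|})\delta_{r+s,0},\qquad [\alpha_{i,r},\alpha_{j,s}]=-r(q_1^{|r|}+q_3^{|r|})\delta_{r+s,0}\quad(i\ne j).$$ Let $V\subset\mathcal{F}_{u_1}\otimes\mathcal{F}_{u_2}$ be the sum of the charge-$(n_1,n_2)$ components with $n_1-n_2$ even. On $V$ put, for $n\ne0$, $$\bar h_{i,n}=-\tfrac{1-q_2^n}{n(q-q^{-1})}\bigl(\alpha_{i,n}\otimes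 1+q^{|n|}\,1\otimes\alpha_{i,n}\bigr),\qquad b_{i,n}=\alpha_{i,n}\otimes 1-\frac{[\alpha_{i,n}\otimes 1,\bar h_{i,-n}]}{[\bar h_{i,n},\bar h_{i,-n}]}\,\bar h_{i,n},$$ let $b_{1,0}=-b_{2,0}=\frac12(\alpha_{1,0}\otimes1-1\otimes\alpha_{1,0})$ (with integer eigenvalues $(n_1-n_2)/2$ on $V$), let $e^{\pm Q_1}=e^{\mp Q_2}$ be the operator that commutes with all $\alpha_{i,n}\otimes 1$ and $1\otimes\alpha_{i,n}$ ($n\neq0$) and sends $|n_1,u_1\rangle\otimes|n_2,u_2\rangle$ to $|n_1\pm1,u_1\rangle\otimes|n_2\mp1,u_2\rangle$, and let $\zeta=\frac12(u_1-u_2-1)$, $q_1^{\zeta}$ being the principal power. *Generators.* With $:\ :$ the normal ordering (the $b_{i,n}$ with $n<0$ to the left of those with $n>0$, and $e^{\pm Q_i}$ to the left of $b_{i,0}$), set $W_i(z)=\Lambda_i^+(z)+\Lambda_i^-(z)$ for $i=1,2$, where $$\Lambda_i^{\pm}(z)=\,:\exp\Bigl(\mp\sum_{n\neq0}\frac{q^{\pm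 n}}{n}b_{i,n}z^{-n}\Bigr):e^{\pm Q_i}(q^{\mp1}z)^{\pm b_{i,0}}q_1^{\pm\zeta},$$ and, for $\xi\in\mathbb{C}^\times$, $$\begin{aligned}\mathcal{T}(\xi;z)=\;&q:\!\Lambda_1^+(\xi z)\Lambda_2^+(z)\!:+\,q^{-1}:\!\Lambda_1^-(\xi z)\Lambda_2^-(z)\!:\\&+z^2q(1-q_1\xi)(1-q_3\xi):\!\Lambda_1^+(\xi z)\Lambda_2^-(z)\!:\\&+z^2q^{-1}(1-q_1^{-1}\xi)(1-q_3^{-1}\xi):\!\Lambda_1^-(\xi z)\Lambda_2^+(z)\!:.\end{aligned}$$ Further let $$f(\xi;z)=\exp\Bigl\{\sum_{n\ge1}\Bigl(\xi^n-\frac{q_1^n+q_3^n}{1+q_2^{-n}}\Bigr)\frac{z^n}{n}\Bigr\}\in\mathbb{C}[[z]],\qquad \delta(z)=\sum_{n\in\mathbb{Z}}z^n.$$ **Theorem.** For $k=1,3$ and for either choice of sign (upper signs throughout or lower signs throughout), the following identities of formal distributions in $z,w$ with values in operators on $V$ hold. For every vector of $V$ and every monomial $z^aw^b$, the sums that define the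 coefficients of the products on the left-hand sides are finite, and $$q_k^{\pm1} f\Bigl(q_k^{\pm1};\frac wz\Bigr)W_1(z)\mathcal{T}(q_k^{\pm1};w)-f\Bigl(q_k^{\mp1};\frac zw\Bigr)\mathcal{T}(q_k^{\pm1};w)W_1(z)=\pm q^{\pm1}(q_k-q_k^{-1})\,\delta\Bigl(\frac{q_k^{\pm1}w}{q_2^{\pm1}z}\Bigr)W_2(w),$$ $$q_k^{\mp1} f\Bigl(q_k^{\mp1};\frac{q_k^{\pm1}w}{z}\Bigr)W_2(z)\mathcal{T}(q_k^{\pm1};w)-f\Bigl(q_k^{\pm1};\frac{z}{q_k^{\pm1}w}\Bigr)\mathcal{T}(q_k^{\pm1};w)W_2(z)=\mp q^{\mp1}(q_k-q_k^{-1})\,\delta\Bigl(\frac{q_2^{\pm1}w}{z}\Bigr)W_1(q_k^{\pm1}w).$$ -/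

import Mathlib

open scoped PowerSeries

noncomputable section

namespace QSVir

/-! ### Parameters -/

/-- `q₁ = q⁻¹ d`. -/
def q1 (q d : ℂ) : ℂ := q⁻¹ * d
/-- `q₂ = q²`. -/
def q2 (q : ℂ) : ℂ := q ^ 2
/-- `q₃ = q⁻¹ d⁻¹`. -/
def q3 (q d : ℂ) : ℂ := q⁻¹ * d⁻¹

/-! ### Formal exponentials and the structure function -/

/-- `exp A` for a power series `A` without constant term over a `ℂ`-algebra:
the coefficient of `X ^ m` of `A ^ k` vanishes for `k > m`. -/
def psExp {R : Type*} [Ring R] [Algebra ℂ R] (A : R⟦X⟧) : R⟦X⟧ :=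
  PowerSeries.mk fun m =>
    ∑ k ∈ Finset.range (m + 1), ((k.factorial : ℂ)⁻¹) • PowerSeries.coeff m (A ^ k)

/-- `f(ξ; z) = exp (∑_{n ≥ 1} (ξⁿ - (q₁ⁿ + q₃ⁿ) / (1 + q₂⁻ⁿ)) zⁿ / n)`. -/
def fSer (q d ξ : ℂ) : ℂ⟦X⟧ :=
  psExp (PowerSeries.mk fun n : ℕ =>
    if n = 0 then 0
    else (ξ ^ n - (q1 q d ^ n + q3 q d ^ n) / (1 + (q2 q ^ n)⁻¹)) / n)

/-! ### Heisenberg modes on the oscillator part of `𝓕_{u₁} ⊗ 𝓕_{u₂}` -/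

/-- `ℂ[α_{i,-n} ⊗ 1, 1 ⊗ α_{i,-n}]`. The variable `(s, i, n)` is the creation mode `α_{i,-n}` in the
tensor factor `s`; the indices `i = 1, 2` are written `0, 1 : Fin 2`, and so are the factors. -/
abbrev Osc : Type := MvPolynomial (Fin 2 × Fin 2 × ℕ+) ℂ

/-- The scalar `[α_{i,n}, α_{j,-n}]`. -/
def alphaComm (q d : ℂ) (i j : Fin 2) (n : ℤ) : ℂ :=
  if i = j then n * (1 + (q2 q ^ n.natAbs)⁻¹)
  else -(n * (q1 q d ^ n.natAbs + q3 q d ^ n.natAbs))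

/-- `α_{i,n}` (`n ≠ 0`) acting in the tensor factor `s`: negative modes multiply by a variable,
positive modes annihilate the vacuum and act by the derivation that the commutation relations
prescribe. (The zero mode acts on the charge and is treated separately.) -/
def alpha (q d : ℂ) (s i : Fin 2) : ℤ → Module.End ℂ Osc
  | Int.ofNat 0 => 0
  | Int.ofNat (n + 1) => ∑ j : Fin 2,
      alphaComm q d i j (n + 1) • (MvPolynomial.pderiv (s, j, n.succPNat)).toLinearMap
  | Int.negSucc n => LinearMap.mulLeft ℂ (MvPolynomial.X (s, i, n.succPNat))

/-- The coefficient of `H_{i,n}` in terms of `α_{i,n}` on the tensor product. -/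
def hCoeff (q : ℂ) (n : ℤ) : ℂ := -((1 - q2 q ^ n) / (n * (q - q⁻¹)))

/-- The Cartan mode
`h̄_{i,n} = -(1 - q₂ⁿ) / (n (q - q⁻¹)) (α_{i,n} ⊗ 1 + q^{|n|} 1 ⊗ α_{i,n})`, `n ≠ 0`. -/
def hbar (q d : ℂ) (i : Fin 2) (n : ℤ) : Module.End ℂ Osc :=
  hCoeff q n • (alpha q d 0 i n + q ^ n.natAbs • alpha q d 1 i n)

/-- The scalar `[α_{i,n} ⊗ 1, h̄_{i,-n}]`. -/
def commAlphaH (q d : ℂ) (i : Fin 2) (n : ℤ) : ℂ := hCoeff q (-n) * alphaComm q d i i n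

/-- The scalar `[h̄_{i,n}, h̄_{i,-n}]`. -/
def commHH (q d : ℂ) (i : Fin 2) (n : ℤ) : ℂ :=
  hCoeff q n * hCoeff q (-n) * (1 + q ^ n.natAbs * q ^ n.natAbs) * alphaComm q d i i n

/-- `b_{i,n} = α_{i,n} ⊗ 1 - ([α_{i,n} ⊗ 1, h̄_{i,-n}] / [h̄_{i,n}, h̄_{i,-n}]) h̄_{i,n}`, `n ≠ 0`:
the component of `α_{i,n} ⊗ 1` that commutes with the Cartan modes. -/
def boson (q d : ℂ) (i : Fin 2) (n : ℤ) : Module.End ℂ Osc :=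
  alpha q d 0 i n - (commAlphaH q d i n / commHH q d i n) • hbar q d i n

/-! ### Positive modes are locally nilpotent -/

/-- The degree of a monomial, `α_{i,-n}` having degree `n`. -/
def wt (m : (Fin 2 × Fin 2 × ℕ+) →₀ ℕ) : ℕ := m.sum fun x e => e * (x.2.2 : ℕ)

/-- Polynomials all of whose monomials have degree `< N`. -/
def low (N : ℕ) : Submodule ℂ Osc := MvPolynomial.restrictSupport ℂ {m | wt m < N}

lemma low_zero {x : Osc} (h : x ∈ low 0) : x = 0 := by
  have h' : (x.support : Set _) ⊆ {m | wt m < 0} := (MvPolynomial.mem_restrictSupport_iff ℂ).1 h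
  rw [← MvPolynomial.support_eq_empty, ← Finset.coe_eq_empty]
  exact Set.eq_empty_of_subset_empty fun m hm => by simpa using h' hm

lemma exists_low (x : Osc) : ∃ N, x ∈ low N := by
  refine ⟨x.support.sup wt + 1, (MvPolynomial.mem_restrictSupport_iff ℂ).2 fun m hm => ?_⟩
  exact Nat.lt_succ_of_le (Finset.le_sup (f := wt) hm)

lemma pderiv_low (t : Fin 2 × Fin 2 × ℕ+) {N : ℕ} {x : Osc} (h : x ∈ low N) :
    MvPolynomial.pderiv t x ∈ low (N - t.2.2) := by
  rw [x.as_sum, map_sum]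
  refine Submodule.sum_mem _ fun m hm => ?_
  rw [MvPolynomial.pderiv_monomial]
  by_cases h0 : m t = 0
  · simp [h0]
  have hw : wt m < N := (MvPolynomial.mem_restrictSupport_iff ℂ).1 h hm
  have hs : m = (m - Finsupp.single t 1) + Finsupp.single t 1 := by
    ext y
    by_cases hy : t = y
    · subst hy; simp; omega
    · simp [Finsupp.single_eq_of_ne' hy]
  have hadd : wt m = wt (m - Finsupp.single t 1) + t.2.2 := by
    conv_lhs => rw [hs]
    unfold wt
    rw [Finsupp.sum_add_index' (by simp) (by intros; ring)]
    simp
  refine (MvPolynomial.mem_restrictSupport_iff ℂ).2 fun m' hm' => ?_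
  have : m' = m - Finsupp.single t 1 := by
    have := MvPolynomial.support_monomial_subset hm'
    simpa using this
  subst this
  show wt _ < _
  omega

lemma alpha_low (q d : ℂ) (s i : Fin 2) (n : ℕ) {N : ℕ} {x : Osc} (h : x ∈ low N) :
    alpha q d s i (n : ℤ) x ∈ low (N - n) := by
  cases n with
  | zero => exact Submodule.zero_mem _
  | succ n =>
    show (∑ j : Fin 2, alphaComm q d i j (n + 1) •
      (MvPolynomial.pderiv (s, j, n.succPNat)).toLinearMap) x ∈ _
    rw [LinearMap.sum_apply]
    exact Submodule.sum_mem _ fun j _ => Submodule.smul_mem _ _ (pderiv_low (s, j, n.succPNat) h)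

lemma boson_low (q d : ℂ) (i : Fin 2) (n : ℕ) {N : ℕ} {x : Osc} (h : x ∈ low N) :
    boson q d i (n : ℤ) x ∈ low (N - n) := by
  unfold boson hbar
  exact Submodule.sub_mem _ (alpha_low q d 0 i n h) (Submodule.smul_mem _ _
    (Submodule.smul_mem _ _ (Submodule.add_mem _ (alpha_low q d 0 i n h)
      (Submodule.smul_mem _ _ (alpha_low q d 1 i n h)))))

/-! ### Vertex operators -/

/-- The exponent of a normal-ordered vertex operator
`:exp (∑_{n ≠ 0} ∑_i osc i n · b_{i,n} z⁻ⁿ): e^{shift · Q₁} base^{b_{1,0}} z^{pow · b_{1,0}} q₁^{zeta · ζ}`,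
where `Q₂ = -Q₁` and `b_{2,0} = -b_{1,0}`. -/
structure VertexExponent where
  /-- coefficients of `b_{i,n} z⁻ⁿ`, `n ≠ 0` -/
  osc : Fin 2 → ℤ → ℂ
  shift : ℤ
  base : ℂ
  pow : ℤ
  zeta : ℤ

namespace VertexExponent

/-- The normal-ordered product `:A(z) B(z):`. -/
def normalProd (A B : VertexExponent) : VertexExponent where
  osc i n := A.osc i n + B.osc i n
  shift := A.shift + B.shift
  base := A.base * B.base
  pow := A.pow + B.pow
  zeta := A.zeta + B.zeta

/-- The substitution `A(ξ z)`. -/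
def rescale (ξ : ℂ) (A : VertexExponent) : VertexExponent where
  osc i n := A.osc i n * ξ ^ (-n)
  shift := A.shift
  base := A.base * ξ ^ A.pow
  pow := A.pow
  zeta := A.zeta

/-- `exp (∑_{n > 0} ∑_i osc i (-n) b_{i,-n} zⁿ)`, a power series in `z`. -/
def creation (q d : ℂ) (A : VertexExponent) : (Module.End ℂ Osc)⟦X⟧ :=
  psExp (PowerSeries.mk fun n : ℕ =>
    if n = 0 then 0 else ∑ i : Fin 2, A.osc i (-(n : ℤ)) • boson q d i (-(n : ℤ)))

/-- `exp (∑_{n > 0} ∑_i osc i n b_{i,n} z⁻ⁿ)`, a power series in `z⁻¹`. -/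
def annihilation (q d : ℂ) (A : VertexExponent) : (Module.End ℂ Osc)⟦X⟧ :=
  psExp (PowerSeries.mk fun n : ℕ =>
    if n = 0 then 0 else ∑ i : Fin 2, A.osc i (n : ℤ) • boson q d i (n : ℤ))

lemma annihilation_low (q d : ℂ) (A : VertexExponent) (k : ℕ) {N : ℕ} {x : Osc}
    (h : x ∈ low N) : PowerSeries.coeff k (A.annihilation q d) x ∈ low (N - k) := by
  unfold annihilation psExp
  rw [PowerSeries.coeff_mk, LinearMap.sum_apply]
  refine Submodule.sum_mem _ fun r _ => Submodule.smul_mem _ _ ?_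
  clear * - h
  induction r generalizing k N x with
  | zero =>
    rw [pow_zero, PowerSeries.coeff_one]
    split_ifs with hk
    · subst hk; simpa using h
    · exact Submodule.zero_mem _
  | succ r ih =>
    rw [pow_succ, PowerSeries.coeff_mul, LinearMap.sum_apply]
    refine Submodule.sum_mem _ fun p hp => ?_
    have hp := Finset.HasAntidiagonal.mem_antidiagonal.1 hp
    rw [Module.End.mul_apply, PowerSeries.coeff_mk]
    have h2 : N - k = N - p.2 - p.1 := by omega
    rw [h2]
    refine ih p.1 ?_
    split_ifs with h0
    · exact Submodule.zero_mem _
    · rw [LinearMap.sum_apply]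
      exact Submodule.sum_mem _ fun i _ => Submodule.smul_mem _ _ (boson_low q d i p.2 h)

lemma annihilation_finite (q d : ℂ) (A : VertexExponent) (g : ℕ → Module.End ℂ Osc) (x : Osc) :
    (Function.support fun k => g k (PowerSeries.coeff k (A.annihilation q d) x)).Finite := by
  obtain ⟨N, hN⟩ := exists_low x
  refine (Set.finite_lt_nat N).subset fun k hk => ?_
  by_contra hlt
  have hNk : N - k = 0 := by
    have : ¬ k < N := hlt
    omega
  have h0 := low_zero (hNk ▸ annihilation_low q d A k hN)
  exact hk (by simp only [h0, map_zero])

/-- The coefficient of `z ^ j` (`j ∈ ℤ`) of the oscillator part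
`exp (creation) · exp (annihilation)`; the sum is finite on each vector. -/
def oscCoeff (q d : ℂ) (A : VertexExponent) (j : ℤ) : Module.End ℂ Osc where
  toFun x := ∑ᶠ k : ℕ,
    (if 0 ≤ j + k then PowerSeries.coeff (j + k).toNat (A.creation q d) else 0)
      (PowerSeries.coeff k (A.annihilation q d) x)
  map_add' x y := by
    rw [← finsum_add_distrib (annihilation_finite q d A _ x) (annihilation_finite q d A _ y)]
    simp only [map_add]
  map_smul' c x := by
    rw [RingHom.id_apply, smul_finsum' c (annihilation_finite q d A _ x)]
    simp only [map_smul]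

end VertexExponent

/-! ### The Fock space -/

/-- The charges `(n₁, n₂)` with `n₁ - n₂` even, that is, with `b_{1,0} = (n₁ - n₂) / 2` integral. -/
abbrev Charge : Type := {p : ℤ × ℤ // Even (p.1 - p.2)}

/-- The eigenvalue of `b_{1,0} = (α_{1,0} ⊗ 1 - 1 ⊗ α_{1,0}) / 2`. -/
def Charge.b0 (p : Charge) : ℤ := (p.1.1 - p.1.2) / 2

/-- The action of `e^{t Q₁}`, `Q₁ = (χ₁ ⊗ 1 - 1 ⊗ χ₁) / 2`, on the charges: `e^{χ₁ / 2}` sends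
`|n, u⟩` to `|n + 1, u⟩`. -/
def Charge.shift (t : ℤ) (p : Charge) : Charge :=
  ⟨(p.1.1 + t, p.1.2 - t), by
    have h : p.1.1 + t - (p.1.2 - t) = (p.1.1 - p.1.2) + (t + t) := by ring
    rw [h]
    exact p.2.add (Even.add_self t)⟩

/-- The sum of the `𝓕(n₁, u₁) ⊗ 𝓕(n₂, u₂)` with `n₁ - n₂` even. The parameters `u₁`, `u₂` enter only
through the operator `q₁^ζ`. -/
abbrev Fock : Type := Charge →₀ Osc

/-- `A(z) = ∑_{m ∈ ℤ} A m z ^ m`. -/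
abbrev FormalField : Type := ℤ → Module.End ℂ Fock

/-- The scalar `q₁^ζ`, where `ζ = (𝖺₀ ⊗ 1 - 1 ⊗ 𝖺₀ - 1 ⊗ 1) / 2` acts on `𝓕_{u₁} ⊗ 𝓕_{u₂}` as
`(u₁ - u₂ - 1) / 2`. -/
def q1Zeta (q d u₁ u₂ : ℂ) : ℂ := q1 q d ^ ((u₁ - u₂ - 1) / 2)

/-- The vertex operator with a given exponent. -/
def vertexOp (q d u₁ u₂ : ℂ) (A : VertexExponent) : FormalField := fun m =>
  Finsupp.lsum ℂ fun p : Charge =>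
    (q1Zeta q d u₁ u₂ ^ A.zeta * A.base ^ p.b0) •
      (Finsupp.lsingle (p.shift A.shift) ∘ₗ A.oscCoeff q d (m - A.pow * p.b0))

/-- `b_{i,0} = chargeSign i · b_{1,0}` and `Q_i = chargeSign i · Q₁`. -/
def chargeSign (i : Fin 2) : ℤ := if i = 0 then 1 else -1

/-- The exponent of `Λ_i^ε(z)`, `ε = ±1`:
`:exp (-ε ∑_{n ≠ 0} q^{εn} / n · b_{i,n} z⁻ⁿ): e^{ε Q_i} (q^{-ε} z)^{ε b_{i,0}} q₁^{ε ζ}`. -/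
def lambdaExp (q : ℂ) (ε : ℤ) (i : Fin 2) : VertexExponent where
  osc j n := if j = i then -(ε * q ^ (ε * n) / n) else 0
  shift := ε * chargeSign i
  base := (q ^ (-ε)) ^ (ε * chargeSign i)
  pow := ε * chargeSign i
  zeta := ε

/-- `W_i(z) = Λ_i⁺(z) + Λ_i⁻(z)`. -/
def W (q d u₁ u₂ : ℂ) (i : Fin 2) : FormalField :=
  vertexOp q d u₁ u₂ (lambdaExp q 1 i) + vertexOp q d u₁ u₂ (lambdaExp q (-1) i)

/-- `:Λ_i^ε(ξ z) Λ_j^ε'(z):`. -/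
def lambdaPair (q d u₁ u₂ ξ : ℂ) (ε : ℤ) (i : Fin 2) (ε' : ℤ) (j : Fin 2) : FormalField :=
  vertexOp q d u₁ u₂
    (VertexExponent.normalProd ((lambdaExp q ε i).rescale ξ) (lambdaExp q ε' j))

/-- `𝒯_{ij}(ξ; z) = M⁽¹⁾ + M⁽²⁾ + z² M⁽³⁾ + z² M⁽⁴⁾`. -/
def Tij (q d u₁ u₂ : ℂ) (i j : Fin 2) (ξ : ℂ) : FormalField := fun m =>
  q • lambdaPair q d u₁ u₂ ξ 1 i 1 j m
  + q⁻¹ • lambdaPair q d u₁ u₂ ξ (-1) i (-1) j m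
  + (q * (1 - q1 q d * ξ) * (1 - q3 q d * ξ)) • lambdaPair q d u₁ u₂ ξ 1 i (-1) j (m - 2)
  + (q⁻¹ * (1 - (q1 q d)⁻¹ * ξ) * (1 - (q3 q d)⁻¹ * ξ)) •
      lambdaPair q d u₁ u₂ ξ (-1) i 1 j (m - 2)

/-- `𝒯(ξ; z) = 𝒯₁₂(ξ; z)`. -/
def T (q d u₁ u₂ ξ : ℂ) : FormalField := Tij q d u₁ u₂ 0 1 ξ

/-! ### Relations between formal fields -/

/-- The field `A(c w)`. -/
def FormalField.rescale (c : ℂ) (A : FormalField) : FormalField := fun m => c ^ m • A m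

/-- The coefficient of `z ^ a w ^ b` in `δ(c w / z) A(w)`, `δ(x) = ∑_{n ∈ ℤ} xⁿ`. -/
def deltaMul (c : ℂ) (A : FormalField) (a b : ℤ) : Module.End ℂ Fock := c ^ (-a) • A (a + b)

/-- The identity of formal distributions
`c · φ(w / z) A(z) B(w) - ψ(z / w) B(w) A(z) = R(z, w)`: for all `a`, `b` the coefficients of
`z ^ a w ^ b` agree on every vector, the sums that define the left-hand side being finite there. -/
def ExchangeRelation (c : ℂ) (φ ψ : ℂ⟦X⟧) (A B : FormalField)
    (R : ℤ → ℤ → Module.End ℂ Fock) : Prop :=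
  ∀ (a b : ℤ) (v : Fock),
    (Function.support fun l : ℕ => PowerSeries.coeff l φ • A (a + l) (B (b - l) v)).Finite ∧
    (Function.support fun l : ℕ => PowerSeries.coeff l ψ • B (b + l) (A (a - l) v)).Finite ∧
    c • (∑ᶠ l : ℕ, PowerSeries.coeff l φ • A (a + l) (B (b - l) v))
      - ∑ᶠ l : ℕ, PowerSeries.coeff l ψ • B (b + l) (A (a - l) v) = R a b v

end QSVir

end

/-! The theorem is Wick's rule followed by a residue computation. For vertex operators `A`, `B` the
product `A(z)B(w)` equals a scalar series in `w/z` times `:A(z)B(w):`, and `B(w)A(z)` equals a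
series in `z/w` times the same normal-ordered product. If, after multiplication by the structure
functions, the two series are the expansions of one rational function of `x = w/z` at `x = 0` and `x
= ∞`, their difference is a sum of delta functions at its poles, and each delta function sets `z = s
w` inside the normal-ordered product. This is `exchangeRelation_vertexOp`; it rests on
`coeff_psExp_mul_coeff_psExp` (Wick's rule for formal exponentials), `oscCoeff_oscCoeff` and
`finsum_normalOp`.

Rationality comes from `f`. The contractions involve `c_n = (q₁ⁿ + q₃ⁿ)/(1 + q₂⁻ⁿ)`, and together
with the exponent of `f` they either cancel or occur as `c_n(1 + q₂^{±n})`, which is a sum of two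
`n`-th powers. Only four shapes arise: `1`, `(1 - r x)/(1 - p x)`, `x²/((1 - s₁x)(1 - s₂x))` and
`x⁻²(1 - r₁x)(1 - r₂x)`, up to constants.

At `ξ = q_k^{±1}` one of the four terms of `𝒯` has coefficient zero, so each `W_i` gives six
products. Three of them have no pole. For `W₁` the other three have poles at `z = ξw` and `z =
Q⁻²ξw`, where `Q = q^{±1}`. At `z = ξw` two residues carry the same operator with opposite
coefficients. At `z = Q⁻²ξw` the two factors of type `Λ₁` annihilate each other
(`normalProd_lambda_cancel`), and what remains is `Λ₂⁺(w)` and `Λ₂⁻(w)` with equal coefficients,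
that is, `W₂(w)`. For `W₂` the same happens with cancellation at `z = w` and the surviving pole at
`z = Q²w`. The structure `Specialization` treats `k = 1, 3` and both signs at once. -/

noncomputable section

namespace QSVir

/-! ### Power series over noncommutative rings -/

section Noncommutative

variable {R : Type*} [Ring R]

lemma commute_of_coeff {F G : R⟦X⟧}
    (h : ∀ m n, Commute (PowerSeries.coeff m F) (PowerSeries.coeff n G)) : Commute F G := by
  ext n
  rw [PowerSeries.coeff_mul, PowerSeries.coeff_mul, ← Finset.Nat.sum_antidiagonal_swap]
  exact Finset.sum_congr rfl fun p _ => h p.2 p.1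

/-- Passing to constant series makes commutation with all coefficients stable under powers of `F`.
-/
lemma commute_C_iff {x : R} {F : R⟦X⟧} :
    Commute (PowerSeries.C x) F ↔ ∀ n, Commute x (PowerSeries.coeff n F) := by
  constructor
  · intro h n
    have := congrArg (PowerSeries.coeff n) h.eq
    rwa [PowerSeries.coeff_C_mul, PowerSeries.coeff_mul_C] at this
  · intro h
    ext n
    rw [PowerSeries.coeff_C_mul, PowerSeries.coeff_mul_C, (h n).eq]

lemma coeff_pow_eq_zero {A : R⟦X⟧} (hA : PowerSeries.coeff 0 A = 0) {m k : ℕ} (h : m < k) :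
    PowerSeries.coeff m (A ^ k) = 0 := by
  induction k generalizing m with
  | zero => omega
  | succ k ih =>
    rw [pow_succ', PowerSeries.coeff_mul]
    refine Finset.sum_eq_zero fun p hp => ?_
    have hp := Finset.HasAntidiagonal.mem_antidiagonal.1 hp
    rcases Nat.eq_zero_or_pos p.1 with h1 | h1
    · rw [h1, hA, zero_mul]
    · rw [ih (by omega), mul_zero]

end Noncommutative

/-! ### The Euler operator and formal exponentials -/

section Euler

variable {R : Type*} [Ring R] [Algebra ℂ R]

/-- The Euler operator `X d/dX` on power series over a possibly noncommutative algebra. -/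
def euler : R⟦X⟧ →ₗ[ℂ] R⟦X⟧ where
  toFun F := PowerSeries.mk fun n => (n : ℂ) • PowerSeries.coeff n F
  map_add' F G := by ext n; simp
  map_smul' c F := by ext n; simp [smul_comm c]

@[simp] lemma coeff_euler (n : ℕ) (F : R⟦X⟧) :
    PowerSeries.coeff n (euler F) = (n : ℂ) • PowerSeries.coeff n F := by
  simp [euler]

lemma euler_mul (F G : R⟦X⟧) : euler (F * G) = euler F * G + F * euler G := by
  ext n
  rw [coeff_euler, map_add, PowerSeries.coeff_mul, PowerSeries.coeff_mul, PowerSeries.coeff_mul,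
    Finset.smul_sum, ← Finset.sum_add_distrib]
  refine Finset.sum_congr rfl fun p hp => ?_
  rw [← Finset.HasAntidiagonal.mem_antidiagonal.1 hp, coeff_euler, coeff_euler, smul_mul_assoc,
    mul_smul_comm, ← add_smul, Nat.cast_add]

lemma euler_C (x : R) : euler (PowerSeries.C x) = 0 := by
  ext n
  rw [coeff_euler, PowerSeries.coeff_C]
  split_ifs with h <;> simp [h]

lemma constantCoeff_euler (F : R⟦X⟧) : PowerSeries.coeff 0 (euler F) = 0 := by simp

/-- A first order linear equation `X F' = L F` has at most one solution with given constant
term. -/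
lemma euler_unique {L F G : R⟦X⟧} (hL : PowerSeries.coeff 0 L = 0) (hF : euler F = L * F)
    (hG : euler G = L * G) (h0 : PowerSeries.coeff 0 F = PowerSeries.coeff 0 G) : F = G := by
  ext n
  induction n using Nat.strong_induction_on with
  | _ n ih =>
    rcases Nat.eq_zero_or_pos n with rfl | hn
    · exact h0
    have hF' := congrArg (PowerSeries.coeff n) hF
    have hG' := congrArg (PowerSeries.coeff n) hG
    rw [coeff_euler, PowerSeries.coeff_mul] at hF' hG'
    have hs : (n : ℂ) • PowerSeries.coeff n F = (n : ℂ) • PowerSeries.coeff n G := by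
      rw [hF', hG']
      refine Finset.sum_congr rfl fun p hp => ?_
      have hp := Finset.HasAntidiagonal.mem_antidiagonal.1 hp
      rcases Nat.eq_zero_or_pos p.1 with h1 | h1
      · rw [h1, hL, zero_mul, zero_mul]
      · rw [ih p.2 (by omega)]
    have hn' : (n : ℂ) ≠ 0 := by exact_mod_cast hn.ne'
    have := congrArg (fun x => (n : ℂ)⁻¹ • x) hs
    simpa [smul_smul, hn'] using this

lemma coeff_psExp (A : R⟦X⟧) (m : ℕ) : PowerSeries.coeff m (psExp A) =
    ∑ k ∈ Finset.range (m + 1), ((k.factorial : ℂ)⁻¹) • PowerSeries.coeff m (A ^ k) := by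
  rw [psExp, PowerSeries.coeff_mk]

lemma coeff_zero_psExp (A : R⟦X⟧) : PowerSeries.coeff 0 (psExp A) = 1 := by
  simp [coeff_psExp]

lemma commute_coeff_psExp {x : R} {A : R⟦X⟧} (h : ∀ n, Commute x (PowerSeries.coeff n A)) (n : ℕ) :
    Commute x (PowerSeries.coeff n (psExp A)) := by
  rw [coeff_psExp]
  refine Commute.sum_right _ _ _ fun k _ => Commute.smul_right ?_ _
  exact commute_C_iff.1 ((commute_C_iff.2 h).pow_right k) n

lemma euler_pow_succ {A : R⟦X⟧} (h : Commute (euler A) A) (k : ℕ) :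
    euler (A ^ (k + 1)) = (k + 1 : ℂ) • (euler A * A ^ k) := by
  induction k with
  | zero => simp
  | succ k ih =>
    rw [pow_succ A (k + 1), euler_mul, ih, smul_mul_assoc, mul_assoc, ← pow_succ,
      ← (h.pow_right (k + 1)).eq]
    push_cast
    module

/-- `psExp A` solves `X E' = X A' E` when the coefficients of `A` commute. -/
lemma euler_psExp {A : R⟦X⟧} (hA : PowerSeries.coeff 0 A = 0)
    (h : ∀ m n, Commute (PowerSeries.coeff m A) (PowerSeries.coeff n A)) :
    euler (psExp A) = euler A * psExp A := by
  have hc : Commute (euler A) A := commute_of_coeff fun m n => by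
    rw [coeff_euler]; exact (h m n).smul_left _
  ext m
  rw [coeff_euler, coeff_psExp, Finset.sum_range_succ', PowerSeries.coeff_mul]
  have h0 : (m : ℂ) • PowerSeries.coeff m (A ^ 0) = 0 := by
    rw [pow_zero, PowerSeries.coeff_one]
    split_ifs with h <;> simp [h]
  rw [smul_add, smul_comm (m : ℂ), h0, smul_zero, add_zero, Finset.smul_sum]
  have h1 : ∀ k, (m : ℂ) • (((k + 1).factorial : ℂ)⁻¹ • PowerSeries.coeff m (A ^ (k + 1))) =
      ∑ p ∈ Finset.HasAntidiagonal.antidiagonal m, (k.factorial : ℂ)⁻¹ •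
        (PowerSeries.coeff p.1 (euler A) * PowerSeries.coeff p.2 (A ^ k)) := by
    intro k
    rw [smul_comm, ← coeff_euler, euler_pow_succ hc, PowerSeries.coeff_smul, smul_smul,
      PowerSeries.coeff_mul, ← Finset.smul_sum]
    congr 1
    have : (k.factorial : ℂ) ≠ 0 := by exact_mod_cast k.factorial_ne_zero
    have h2 : (k + 1 : ℂ) ≠ 0 := by exact_mod_cast k.succ_ne_zero
    rw [Nat.factorial_succ]
    push_cast
    field_simp
  rw [Finset.sum_congr rfl fun k _ => h1 k, Finset.sum_comm]
  refine Finset.sum_congr rfl fun p hp => ?_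
  have hp := Finset.HasAntidiagonal.mem_antidiagonal.1 hp
  -- The truncations differ: `k < m` on the left, `k ≤ p.2` on the right. For `p.1 > 0` one has `p.2
  -- < m` and the surplus terms vanish by `coeff_pow_eq_zero`; for `p.1 = 0` the factor from `euler
  -- A` vanishes.
  rcases Nat.eq_zero_or_pos p.1 with h1 | h1
  · simp [h1]
  rw [coeff_psExp, Finset.mul_sum]
  simp only [mul_smul_comm]
  symm
  refine Finset.sum_subset (fun k hk => ?_) fun k _ hk => ?_
  · simp only [Finset.mem_range] at hk ⊢; omega
  · rw [coeff_pow_eq_zero hA (by simpa using hk), mul_zero, smul_zero]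

/-- A formal exponential is determined by its differential equation and constant term. The later
identities between exponentials are checked this way, without touching the truncated sums. -/
lemma psExp_unique {A E : R⟦X⟧} (hA : PowerSeries.coeff 0 A = 0)
    (h : ∀ m n, Commute (PowerSeries.coeff m A) (PowerSeries.coeff n A))
    (h0 : PowerSeries.coeff 0 E = 1) (hE : euler E = euler A * E) : psExp A = E :=
  euler_unique (constantCoeff_euler A) (euler_psExp hA h) hE (by rw [coeff_zero_psExp, h0])

lemma psExp_add {A B : R⟦X⟧} (hA : PowerSeries.coeff 0 A = 0) (hB : PowerSeries.coeff 0 B = 0)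
    (hAA : ∀ m n, Commute (PowerSeries.coeff m A) (PowerSeries.coeff n A))
    (hBB : ∀ m n, Commute (PowerSeries.coeff m B) (PowerSeries.coeff n B))
    (hAB : ∀ m n, Commute (PowerSeries.coeff m A) (PowerSeries.coeff n B)) :
    psExp (A + B) = psExp A * psExp B := by
  refine psExp_unique (by rw [map_add, hA, hB, add_zero]) (fun m n => ?_) ?_ ?_
  · simp only [map_add]
    exact ((hAA m n).add_right (hAB m n)).add_left ((hAB n m).symm.add_right (hBB m n))
  · rw [PowerSeries.coeff_mul]
    simp [coeff_zero_psExp]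
  · rw [euler_mul, euler_psExp hA hAA, euler_psExp hB hBB, map_add, add_mul, mul_assoc,
      ← mul_assoc (psExp A)]
    have : Commute (psExp A) (euler B) := commute_of_coeff fun m n => by
      rw [coeff_euler]
      exact ((commute_coeff_psExp (fun k => (hAB k n).symm) m).symm).smul_right _
    rw [this.eq, mul_assoc]

lemma coeff_psExp_scale {A B : R⟦X⟧} (c : ℂ) (hA : PowerSeries.coeff 0 A = 0)
    (hAA : ∀ m n, Commute (PowerSeries.coeff m A) (PowerSeries.coeff n A))
    (h : ∀ n, PowerSeries.coeff n B = c ^ n • PowerSeries.coeff n A) (n : ℕ) :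
    PowerSeries.coeff n (psExp B) = c ^ n • PowerSeries.coeff n (psExp A) := by
  suffices psExp B = PowerSeries.mk fun n => c ^ n • PowerSeries.coeff n (psExp A) by
    rw [this, PowerSeries.coeff_mk]
  refine psExp_unique (by rw [h, hA, smul_zero]) (fun m n => ?_) ?_ ?_
  · rw [h, h]
    exact ((hAA m n).smul_left _).smul_right _
  · simp [coeff_zero_psExp]
  · ext m
    rw [coeff_euler, PowerSeries.coeff_mk, smul_comm, ← coeff_euler, euler_psExp hA hAA,
      PowerSeries.coeff_mul, PowerSeries.coeff_mul, Finset.smul_sum]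
    refine Finset.sum_congr rfl fun p hp => ?_
    rw [← Finset.HasAntidiagonal.mem_antidiagonal.1 hp]
    simp only [coeff_euler, PowerSeries.coeff_mk, h, smul_mul_assoc, mul_smul_comm, smul_smul]
    congr 1
    ring

end Euler

/-! ### Exchange of formal exponentials whose exponents commute up to scalars -/

section Weyl

variable {R : Type*} [Ring R] [Algebra ℂ R] {a c : R⟦X⟧} {S : ℂ⟦X⟧}

/-- Since `[a, c_j] = S_j X ^ j` is central, commuting `c_j` past `exp a` costs exactly `S_j X ^ j
exp a`. -/
lemma psExp_mul_C (ha0 : PowerSeries.coeff 0 a = 0)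
    (ha : ∀ m n, Commute (PowerSeries.coeff m a) (PowerSeries.coeff n a))
    (hc0 : PowerSeries.coeff 0 c = 0)
    (h : ∀ m n, PowerSeries.coeff m a * PowerSeries.coeff n c =
      PowerSeries.coeff n c * PowerSeries.coeff m a +
        if m = n then PowerSeries.coeff n S • (1 : R) else 0) (j : ℕ) :
    psExp a * PowerSeries.C (PowerSeries.coeff j c) =
      PowerSeries.C (PowerSeries.coeff j c) * psExp a +
        PowerSeries.coeff j S • (PowerSeries.X ^ j * psExp a) := by
  -- `S` is not assumed here to lack a constant term, but `h 0 0` makes that constant act as zero on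
  -- `R`.
  rcases Nat.eq_zero_or_pos j with rfl | hj
  · have := h 0 0
    have h1 : PowerSeries.coeff 0 S • (1 : R) = 0 := by
      rwa [hc0, mul_zero, zero_mul, zero_add, if_pos rfl, eq_comm] at this
    have h2 : PowerSeries.coeff 0 S • psExp a = 0 := by
      ext n
      rw [PowerSeries.coeff_smul, ← one_mul (PowerSeries.coeff n (psExp a)), ← smul_mul_assoc,
        h1, zero_mul, map_zero]
    rw [hc0, pow_zero, one_mul, h2]
    simp
  have hE := euler_psExp ha0 ha
  set E := psExp a with hEdef
  set x := PowerSeries.coeff j c with hx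
  set s := PowerSeries.coeff j S with hs
  have hcomm : euler a * PowerSeries.C x =
      PowerSeries.C x * euler a + (j * s : ℂ) • PowerSeries.X ^ j := by
    ext n
    rw [PowerSeries.coeff_mul_C, map_add, PowerSeries.coeff_C_mul, coeff_euler,
      PowerSeries.coeff_smul, PowerSeries.coeff_X_pow, smul_mul_assoc, h, mul_smul_comm, smul_add]
    by_cases hn : n = j
    · subst hn; simp [hs, hx, smul_smul]
    · simp [hn, hx]
  have hX : ∀ F : R⟦X⟧, PowerSeries.X ^ j * F = F * PowerSeries.X ^ j :=
    fun F => ((PowerSeries.commute_X_pow F j).eq).symm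
  have heX : euler (PowerSeries.X ^ j : R⟦X⟧) = (j : ℂ) • PowerSeries.X ^ j := by
    ext n
    rw [coeff_euler, PowerSeries.coeff_smul, PowerSeries.coeff_X_pow]
    split_ifs with hn <;> simp [hn]
  -- The defect satisfies the same homogeneous equation as `E` and has constant term zero, because
  -- `j > 0`; so it vanishes by uniqueness.
  suffices E * PowerSeries.C x - PowerSeries.C x * E - s • (PowerSeries.X ^ j * E) = 0 by
    rw [← sub_eq_zero, ← this]; abel
  refine euler_unique (constantCoeff_euler a) ?_ (by rw [map_zero, mul_zero]) ?_
  · rw [map_sub, map_sub, map_smul, euler_mul, euler_mul, euler_mul, euler_C, hE, heX, mul_sub,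
      mul_sub, mul_zero, zero_mul, add_zero, zero_add, ← mul_assoc (euler a) (PowerSeries.C x),
      hcomm, mul_smul_comm, ← mul_assoc (euler a) (PowerSeries.X ^ j), ← hX (euler a), add_mul]
    simp only [smul_mul_assoc, mul_assoc]
    module
  · rw [map_sub, map_sub, PowerSeries.coeff_smul, PowerSeries.coeff_mul_C,
      PowerSeries.coeff_C_mul, hEdef, coeff_zero_psExp, PowerSeries.coeff_X_pow_mul']
    simp [hj.ne']

/-- Wick's rule `exp a(X) exp c(Y) = exp S(XY) exp c(Y) exp a(X)`, read off at `X ^ k Y ^ m`. As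
series in `Y` both sides satisfy one first order equation, because conjugation by `exp a` adds a
central term to the derivative of `c`. -/
lemma coeff_psExp_mul_coeff_psExp (ha0 : PowerSeries.coeff 0 a = 0)
    (ha : ∀ m n, Commute (PowerSeries.coeff m a) (PowerSeries.coeff n a))
    (hc0 : PowerSeries.coeff 0 c = 0)
    (hc : ∀ m n, Commute (PowerSeries.coeff m c) (PowerSeries.coeff n c))
    (hS0 : PowerSeries.coeff 0 S = 0)
    (h : ∀ m n, PowerSeries.coeff m a * PowerSeries.coeff n c =
      PowerSeries.coeff n c * PowerSeries.coeff m a +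
        if m = n then PowerSeries.coeff n S • (1 : R) else 0) (k m : ℕ) :
    PowerSeries.coeff k (psExp a) * PowerSeries.coeff m (psExp c) =
      ∑ p ∈ Finset.HasAntidiagonal.antidiagonal m, PowerSeries.coeff p.1 (psExp S) •
        (PowerSeries.coeff p.2 (psExp c) *
          if p.1 ≤ k then PowerSeries.coeff (k - p.1) (psExp a) else 0) := by
  set E := psExp a with hE
  -- The inner variable `X` carries `a`, the outer variable `Y` carries `c`. `G` is `exp S(XY)` and
  -- `L` is the Euler derivative in `Y` of its exponent.
  let cc : R⟦X⟧⟦X⟧ := PowerSeries.map PowerSeries.C (psExp c)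
  let dc : R⟦X⟧⟦X⟧ := PowerSeries.map PowerSeries.C (euler c)
  let G : R⟦X⟧⟦X⟧ := PowerSeries.mk fun l => PowerSeries.coeff l (psExp S) • PowerSeries.X ^ l
  let L : R⟦X⟧⟦X⟧ := PowerSeries.mk fun l => (l * PowerSeries.coeff l S : ℂ) • PowerSeries.X ^ l
  have hcentral : ∀ (g : ℕ → ℂ) (F : R⟦X⟧⟦X⟧),
      Commute (PowerSeries.mk fun l => g l • (PowerSeries.X : R⟦X⟧) ^ l) F := fun g F =>
    commute_of_coeff fun i j => by
      rw [PowerSeries.coeff_mk]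
      exact ((PowerSeries.commute_X_pow _ i).symm).smul_left _
  have hcc : euler cc = dc * cc := by
    ext1 n
    have := congrArg (fun F => PowerSeries.C (PowerSeries.coeff n F)) (euler_psExp hc0 hc)
    simp only [coeff_euler, PowerSeries.coeff_mul, map_sum, map_mul] at this
    simp only [cc, dc, coeff_euler, PowerSeries.coeff_mul, PowerSeries.coeff_map]
    rw [← this]
    ext i
    simp [PowerSeries.coeff_C]
  have hG : euler G = L * G := by
    ext1 n
    have := congrArg (PowerSeries.coeff n) (euler_psExp hS0 fun m n => Commute.all _ _)
    simp only [coeff_euler, PowerSeries.coeff_mul] at this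
    simp only [G, L, coeff_euler, PowerSeries.coeff_mul, PowerSeries.coeff_mk, smul_smul]
    rw [← smul_eq_mul, this, Finset.sum_smul]
    refine Finset.sum_congr rfl fun p hp => ?_
    rw [← Finset.HasAntidiagonal.mem_antidiagonal.1 hp, smul_mul_smul_comm, pow_add, smul_eq_mul]
  have hdc : PowerSeries.C E * dc = (dc + L) * PowerSeries.C E := by
    ext1 n
    rw [PowerSeries.coeff_C_mul, PowerSeries.coeff_mul_C, map_add, PowerSeries.coeff_map,
      PowerSeries.coeff_mk, coeff_euler]
    have := psExp_mul_C ha0 ha hc0 h n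
    have hsm : PowerSeries.C ((n : ℂ) • PowerSeries.coeff n c) =
        (n : ℂ) • PowerSeries.C (PowerSeries.coeff n c) := by
      ext i; simp [PowerSeries.coeff_C]
    rw [hsm, mul_smul_comm, this, add_mul, smul_add, smul_smul, smul_mul_assoc, smul_mul_assoc]
  have key : PowerSeries.C E * cc = G * cc * PowerSeries.C E := by
    refine euler_unique (L := dc + L) ?_ ?_ ?_ ?_
    · rw [map_add, PowerSeries.coeff_map, constantCoeff_euler, PowerSeries.coeff_mk]
      simp
    · rw [euler_mul, euler_C, zero_mul, zero_add, hcc, ← mul_assoc, hdc, mul_assoc]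
    · rw [euler_mul, euler_C, mul_zero, add_zero, euler_mul, hG, hcc, add_mul, add_mul,
        ← mul_assoc G, (hcentral _ dc).eq, ← mul_assoc dc, ← mul_assoc dc, ← mul_assoc L,
        ← mul_assoc L, add_comm]
    · rw [PowerSeries.coeff_C_mul, PowerSeries.coeff_mul_C, PowerSeries.coeff_mul]
      simp [cc, G, coeff_zero_psExp, PowerSeries.coeff_map]
  have := congrArg (fun F => PowerSeries.coeff k (PowerSeries.coeff m F)) key
  simp only [PowerSeries.coeff_C_mul, PowerSeries.coeff_mul_C, cc, PowerSeries.coeff_map] at this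
  rw [this, PowerSeries.coeff_mul m, Finset.sum_mul, map_sum]
  refine Finset.sum_congr rfl fun p _ => ?_
  rw [PowerSeries.coeff_map, PowerSeries.coeff_mk, smul_mul_assoc, smul_mul_assoc,
    PowerSeries.coeff_smul, mul_assoc, PowerSeries.coeff_X_pow_mul']
  congr 1
  split_ifs
  · rw [PowerSeries.coeff_C_mul]
  · rw [mul_zero]

end Weyl

/-! ### Commutators of the Heisenberg modes -/

/-- The genericity assumption on the parameters. -/
def Generic (q d : ℂ) : Prop := ∀ n m : ℤ, (n ≠ 0 ∨ m ≠ 0) → q ^ n * d ^ m ≠ 1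

lemma Generic.pow_ne_one {q d : ℂ} (h : Generic q d) {n : ℕ} (hn : n ≠ 0) : q ^ n ≠ 1 := by
  have := h n 0 (Or.inl (by exact_mod_cast hn))
  simpa using this

lemma Generic.one_add_pow_ne_zero {q d : ℂ} (h : Generic q d) {n : ℕ} (hn : n ≠ 0) :
    1 + q ^ n ≠ 0 := fun h0 => by
  have h1 : q ^ (n * 2) = 1 := by
    rw [pow_mul, eq_neg_of_add_eq_zero_right h0]
    norm_num
  exact h.pow_ne_one (by omega) h1

lemma alpha_pos (q d : ℂ) (s i : Fin 2) (n : ℕ+) : alpha q d s i ((n : ℕ) : ℤ) =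
    ∑ j : Fin 2, alphaComm q d i j ((n : ℕ) : ℤ) •
      (MvPolynomial.pderiv (R := ℂ) (s, j, n)).toLinearMap := by
  obtain ⟨k, rfl⟩ : ∃ k : ℕ, n = k.succPNat := ⟨n.natPred, by simp⟩
  rfl

lemma alpha_neg (q d : ℂ) (s i : Fin 2) (n : ℕ+) : alpha q d s i (-((n : ℕ) : ℤ)) =
    LinearMap.mulLeft ℂ (MvPolynomial.X (s, i, n)) := by
  obtain ⟨k, rfl⟩ : ∃ k : ℕ, n = k.succPNat := ⟨n.natPred, by simp⟩
  rfl

/-- The commutator of two derivations is a derivation, and this one kills every variable. -/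
lemma pderiv_comm {σ : Type*} (s t : σ) (x : MvPolynomial σ ℂ) :
    MvPolynomial.pderiv s (MvPolynomial.pderiv t x) =
      MvPolynomial.pderiv t (MvPolynomial.pderiv s x) := by
  classical
  have : ⁅MvPolynomial.pderiv (R := ℂ) s, MvPolynomial.pderiv (R := ℂ) t⁆ = 0 := by
    refine MvPolynomial.derivation_ext fun i => ?_
    rw [Derivation.commutator_apply, MvPolynomial.pderiv_X, MvPolynomial.pderiv_X]
    simp only [Pi.single_apply]
    split_ifs <;> simp
  have h := congrArg (fun D => D x) this
  rw [Derivation.commutator_apply] at h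
  exact sub_eq_zero.1 h

lemma alpha_pos_commute (q d : ℂ) (s i t j : Fin 2) (m n : ℕ+) :
    Commute (alpha q d s i ((m : ℕ) : ℤ)) (alpha q d t j ((n : ℕ) : ℤ)) := by
  rw [alpha_pos, alpha_pos]
  refine Commute.sum_left _ _ _ fun k _ => Commute.sum_right _ _ _ fun l _ =>
    Commute.smul_left (Commute.smul_right ?_ _) _
  refine LinearMap.ext fun x => ?_
  exact pderiv_comm _ _ x

lemma alpha_neg_commute (q d : ℂ) (s i t j : Fin 2) (m n : ℕ+) :
    Commute (alpha q d s i (-((m : ℕ) : ℤ))) (alpha q d t j (-((n : ℕ) : ℤ))) := by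
  rw [alpha_neg, alpha_neg]
  refine LinearMap.ext fun x => ?_
  simp only [Module.End.mul_apply, LinearMap.mulLeft_apply]
  ring

lemma alpha_pos_mul_alpha_neg (q d : ℂ) (s i t j : Fin 2) (m n : ℕ+) :
    alpha q d s i ((m : ℕ) : ℤ) * alpha q d t j (-((n : ℕ) : ℤ)) =
      alpha q d t j (-((n : ℕ) : ℤ)) * alpha q d s i ((m : ℕ) : ℤ) +
        (if s = t ∧ m = n then alphaComm q d i j ((m : ℕ) : ℤ) else 0) • 1 := by
  rw [alpha_pos, alpha_neg]
  refine LinearMap.ext fun x => ?_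
  simp only [Fin.sum_univ_two, LinearMap.add_apply, Module.End.mul_apply, LinearMap.smul_apply,
    LinearMap.mulLeft_apply, Derivation.coeFn_coe, Derivation.leibniz, MvPolynomial.pderiv_X,
    Module.End.one_apply, smul_eq_mul]
  by_cases h : s = t ∧ m = n
  · obtain ⟨rfl, rfl⟩ := h
    fin_cases j <;> simp [mul_add] <;> ring
  · have h' : ∀ k, ¬ (s, k, m) = (t, j, n) := fun k hk => h (by simp_all)
    have h'' : ∀ k, ¬ (t, j, n) = (s, k, m) := fun k hk => h' k hk.symm
    simp [h, h'', mul_add]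

/-- The scalar `[b_{i,n}, b_{j,-n}]`, `n > 0`. -/
def bosonComm (q d : ℂ) (i j : Fin 2) (n : ℕ) : ℂ :=
  if i = j then n else -(n * ((q1 q d ^ n + q3 q d ^ n) / (1 + (q2 q ^ n)⁻¹)))

/-- The quotient of commutators is `(hCoeff q n (1 + q^{2|n|}))⁻¹`: genericity makes the common
factors `hCoeff q (-n)` and `alphaComm` nonzero, so they cancel. -/
lemma boson_eq {q d : ℂ} (hq : q ≠ 0) (h : Generic q d) (i : Fin 2) {n : ℤ} (hn : n ≠ 0) :
    boson q d i n = (1 + q ^ (2 * n.natAbs))⁻¹ •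
      (q ^ (2 * n.natAbs) • alpha q d 0 i n - q ^ n.natAbs • alpha q d 1 i n) := by
  have hN : n.natAbs ≠ 0 := by simpa using hn
  have hn' : (n : ℂ) ≠ 0 := by exact_mod_cast hn
  have hP : 1 + q ^ (2 * n.natAbs) ≠ 0 := h.one_add_pow_ne_zero (by omega)
  have hqq : q - q⁻¹ ≠ 0 := fun h0 => by
    have : q ^ 2 = 1 := by
      field_simp at h0
      linear_combination h0
    exact h.pow_ne_one two_ne_zero this
  have hz : ∀ m : ℤ, m ≠ 0 → hCoeff q m ≠ 0 := fun m hm => by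
    have hm' : (m : ℂ) ≠ 0 := by exact_mod_cast hm
    have h2 : 1 - q2 q ^ m ≠ 0 := fun h0 => by
      have := h (2 * m) 0 (Or.inl (by omega))
      rw [zpow_mul, zpow_zero, mul_one] at this
      exact this (sub_eq_zero.1 h0).symm
    rw [hCoeff, neg_ne_zero]
    exact div_ne_zero h2 (mul_ne_zero hm' hqq)
  have hal : alphaComm q d i i n ≠ 0 := by
    rw [alphaComm, if_pos rfl]
    refine mul_ne_zero hn' ?_
    have hq0 : q2 q ^ n.natAbs ≠ 0 := pow_ne_zero _ (pow_ne_zero _ hq)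
    have : q2 q ^ n.natAbs = q ^ (2 * n.natAbs) := (pow_mul q 2 _).symm
    rw [this] at hq0 ⊢
    intro h0
    apply hP
    field_simp at h0
    linear_combination h0
  have hr : commAlphaH q d i n / commHH q d i n = (hCoeff q n * (1 + q ^ (2 * n.natAbs)))⁻¹ := by
    have h1 := hz n hn
    have h2 := hz (-n) (by omega)
    have h3 : q ^ n.natAbs * q ^ n.natAbs = q ^ (2 * n.natAbs) := by rw [← pow_add]; ring_nf
    rw [commAlphaH, commHH, h3]
    field_simp
  have h1 := hz n hn
  rw [boson, hr, hbar, smul_smul, mul_inv, mul_right_comm, inv_mul_cancel₀ h1, one_mul]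
  have h4 : alpha q d 0 i n = ((1 + q ^ (2 * n.natAbs))⁻¹ * (1 + q ^ (2 * n.natAbs))) •
      alpha q d 0 i n := by
    rw [inv_mul_cancel₀ hP, one_smul]
  nth_rw 1 [h4]
  module

lemma boson_pos_commute {q d : ℂ} (hq : q ≠ 0) (h : Generic q d) (i j : Fin 2) {m n : ℕ}
    (hm : m ≠ 0) (hn : n ≠ 0) : Commute (boson q d i (m : ℤ)) (boson q d j (n : ℤ)) := by
  rw [boson_eq hq h i (by exact_mod_cast hm), boson_eq hq h j (by exact_mod_cast hn)]
  lift m to ℕ+ using Nat.pos_of_ne_zero hm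
  lift n to ℕ+ using Nat.pos_of_ne_zero hn
  refine Commute.smul_left (Commute.smul_right ?_ _) _
  refine Commute.sub_left (Commute.sub_right ?_ ?_) (Commute.sub_right ?_ ?_) <;>
    exact Commute.smul_left (Commute.smul_right (alpha_pos_commute _ _ _ _ _ _ _ _) _) _

lemma boson_neg_commute {q d : ℂ} (hq : q ≠ 0) (h : Generic q d) (i j : Fin 2) {m n : ℕ}
    (hm : m ≠ 0) (hn : n ≠ 0) : Commute (boson q d i (-(m : ℤ))) (boson q d j (-(n : ℤ))) := by
  rw [boson_eq hq h i (by omega), boson_eq hq h j (by omega)]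
  lift m to ℕ+ using Nat.pos_of_ne_zero hm
  lift n to ℕ+ using Nat.pos_of_ne_zero hn
  refine Commute.smul_left (Commute.smul_right ?_ _) _
  refine Commute.sub_left (Commute.sub_right ?_ ?_) (Commute.sub_right ?_ ?_) <;>
    exact Commute.smul_left (Commute.smul_right (alpha_neg_commute _ _ _ _ _ _ _ _) _) _

lemma boson_pos_mul_boson_neg {q d : ℂ} (hq : q ≠ 0) (h : Generic q d) (i j : Fin 2) {m n : ℕ}
    (hm : m ≠ 0) (hn : n ≠ 0) :
    boson q d i (m : ℤ) * boson q d j (-(n : ℤ)) =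
      boson q d j (-(n : ℤ)) * boson q d i (m : ℤ) +
        if m = n then bosonComm q d i j n • 1 else 0 := by
  rw [boson_eq hq h i (by exact_mod_cast hm), boson_eq hq h j (by omega)]
  have hP : 1 + q ^ (2 * n) ≠ 0 := h.one_add_pow_ne_zero (by omega)
  lift m to ℕ+ using Nat.pos_of_ne_zero hm
  lift n to ℕ+ using Nat.pos_of_ne_zero hn
  simp only [smul_mul_smul_comm, sub_mul, mul_sub, alpha_pos_mul_alpha_neg]
  simp only [Int.natAbs_natCast, Int.natAbs_neg, true_and, Fin.isValue, zero_ne_one, one_ne_zero,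
    false_and, if_false, PNat.coe_inj]
  split_ifs with hmn
  · subst hmn
    -- The two tensor factors contribute `q^{4m} + q^{2m} = q^{2m}(1 + q^{2m})`. One factor of the
    -- squared denominator cancels, and the commutator of the `α` is divided by `1 + q₂⁻ᵐ`; this is
    -- the origin of the denominator in `f`.
    have key : ((1 + q ^ (2 * (m : ℕ)))⁻¹ * (1 + q ^ (2 * (m : ℕ)))⁻¹) *
        ((q ^ (2 * (m : ℕ)) * q ^ (2 * (m : ℕ)) + q ^ (m : ℕ) * q ^ (m : ℕ)) *
          alphaComm q d i j ((m : ℕ) : ℤ)) = bosonComm q d i j m := by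
      have h2 : q2 q ^ (m : ℕ) = q ^ (2 * (m : ℕ)) := (pow_mul q 2 _).symm
      have h3 : q ^ (m : ℕ) * q ^ (m : ℕ) = q ^ (2 * (m : ℕ)) := by rw [← pow_add]; ring_nf
      have hx0 : q ^ (2 * (m : ℕ)) ≠ 0 := pow_ne_zero _ hq
      rw [alphaComm, bosonComm, Int.natAbs_natCast, h2, h3]
      generalize q ^ (2 * (m : ℕ)) = x at *
      have hx1 : x + 1 ≠ 0 := by rwa [add_comm]
      split_ifs
      · push_cast
        field_simp
        ring
      · push_cast
        field_simp
        ring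
    rw [← key]
    module
  · module

/-! ### Creation and annihilation parts of vertex operators -/

namespace VertexExponent

/-- The exponent of the creation part. -/
def creExp (q d : ℂ) (A : VertexExponent) : (Module.End ℂ Osc)⟦X⟧ :=
  PowerSeries.mk fun n : ℕ =>
    if n = 0 then 0 else ∑ i : Fin 2, A.osc i (-(n : ℤ)) • boson q d i (-(n : ℤ))

/-- The exponent of the annihilation part. -/
def annExp (q d : ℂ) (A : VertexExponent) : (Module.End ℂ Osc)⟦X⟧ :=
  PowerSeries.mk fun n : ℕ =>
    if n = 0 then 0 else ∑ i : Fin 2, A.osc i (n : ℤ) • boson q d i (n : ℤ)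

/-- The logarithm of the contraction of `A(z) B(w)`, as a power series in `w / z`. -/
def contractionLog (q d : ℂ) (A B : VertexExponent) : ℂ⟦X⟧ :=
  PowerSeries.mk fun n : ℕ =>
    if n = 0 then 0
    else ∑ i : Fin 2, ∑ j : Fin 2, A.osc i (n : ℤ) * B.osc j (-(n : ℤ)) * bosonComm q d i j n

/-- The contraction of `A(z) B(w)`, as a power series in `w / z`. -/
def contraction (q d : ℂ) (A B : VertexExponent) : ℂ⟦X⟧ := psExp (contractionLog q d A B)

lemma creation_eq (q d : ℂ) (A : VertexExponent) : A.creation q d = psExp (A.creExp q d) := rfl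

lemma annihilation_eq (q d : ℂ) (A : VertexExponent) :
    A.annihilation q d = psExp (A.annExp q d) := rfl

lemma coeff_zero_creExp (q d : ℂ) (A : VertexExponent) :
    PowerSeries.coeff 0 (A.creExp q d) = 0 := by
  rw [creExp, PowerSeries.coeff_mk, if_pos rfl]

lemma coeff_zero_annExp (q d : ℂ) (A : VertexExponent) :
    PowerSeries.coeff 0 (A.annExp q d) = 0 := by
  rw [annExp, PowerSeries.coeff_mk, if_pos rfl]

lemma coeff_zero_contractionLog (q d : ℂ) (A B : VertexExponent) :
    PowerSeries.coeff 0 (contractionLog q d A B) = 0 := by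
  rw [contractionLog, PowerSeries.coeff_mk, if_pos rfl]

variable {q d : ℂ}

lemma creExp_commute (hq : q ≠ 0) (h : Generic q d) (A B : VertexExponent) (m n : ℕ) :
    Commute (PowerSeries.coeff m (A.creExp q d)) (PowerSeries.coeff n (B.creExp q d)) := by
  rw [creExp, creExp, PowerSeries.coeff_mk, PowerSeries.coeff_mk]
  split_ifs with hm hn hn
  · exact Commute.zero_left _
  · exact Commute.zero_left _
  · exact Commute.zero_right _
  · exact Commute.sum_left _ _ _ fun i _ => Commute.sum_right _ _ _ fun j _ =>
      Commute.smul_left (Commute.smul_right (boson_neg_commute hq h i j hm hn) _) _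

lemma annExp_commute (hq : q ≠ 0) (h : Generic q d) (A B : VertexExponent) (m n : ℕ) :
    Commute (PowerSeries.coeff m (A.annExp q d)) (PowerSeries.coeff n (B.annExp q d)) := by
  rw [annExp, annExp, PowerSeries.coeff_mk, PowerSeries.coeff_mk]
  split_ifs with hm hn hn
  · exact Commute.zero_left _
  · exact Commute.zero_left _
  · exact Commute.zero_right _
  · exact Commute.sum_left _ _ _ fun i _ => Commute.sum_right _ _ _ fun j _ =>
      Commute.smul_left (Commute.smul_right (boson_pos_commute hq h i j hm hn) _) _

lemma annExp_mul_creExp (hq : q ≠ 0) (h : Generic q d) (A B : VertexExponent) (m n : ℕ) :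
    PowerSeries.coeff m (A.annExp q d) * PowerSeries.coeff n (B.creExp q d) =
      PowerSeries.coeff n (B.creExp q d) * PowerSeries.coeff m (A.annExp q d) +
        if m = n then PowerSeries.coeff n (contractionLog q d A B) • 1 else 0 := by
  rw [creExp, annExp, contractionLog, PowerSeries.coeff_mk, PowerSeries.coeff_mk,
    PowerSeries.coeff_mk]
  by_cases hm : m = 0
  · subst hm
    by_cases hn : n = 0
    · simp [hn]
    · simp [hn, Ne.symm hn]
  by_cases hn : n = 0
  · subst hn
    simp [hm]
  simp only [hm, hn, if_false, Fin.sum_univ_two, add_mul, mul_add, smul_mul_smul_comm,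
    boson_pos_mul_boson_neg hq h _ _ hm hn]
  split_ifs with hmn
  · subst hmn
    module
  · module

lemma creation_commute (hq : q ≠ 0) (h : Generic q d) (A B : VertexExponent) (m n : ℕ) :
    Commute (PowerSeries.coeff m (A.creation q d)) (PowerSeries.coeff n (B.creation q d)) :=
  commute_coeff_psExp (fun k => (commute_coeff_psExp
    (fun l => creExp_commute hq h B A k l) m).symm) n

lemma annihilation_commute (hq : q ≠ 0) (h : Generic q d) (A B : VertexExponent) (m n : ℕ) :
    Commute (PowerSeries.coeff m (A.annihilation q d))
      (PowerSeries.coeff n (B.annihilation q d)) :=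
  commute_coeff_psExp (fun k => (commute_coeff_psExp
    (fun l => annExp_commute hq h B A k l) m).symm) n

lemma annihilation_mul_creation (hq : q ≠ 0) (h : Generic q d) (A B : VertexExponent) (k m : ℕ) :
    PowerSeries.coeff k (A.annihilation q d) * PowerSeries.coeff m (B.creation q d) =
      ∑ p ∈ Finset.HasAntidiagonal.antidiagonal m,
        PowerSeries.coeff p.1 (contraction q d A B) •
          (PowerSeries.coeff p.2 (B.creation q d) *
            if p.1 ≤ k then PowerSeries.coeff (k - p.1) (A.annihilation q d) else 0) :=
  coeff_psExp_mul_coeff_psExp (coeff_zero_annExp q d A) (annExp_commute hq h A A)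
    (coeff_zero_creExp q d B) (creExp_commute hq h B B) (coeff_zero_contractionLog q d A B)
    (annExp_mul_creExp hq h A B) k m

lemma creation_normalProd (hq : q ≠ 0) (h : Generic q d) (A B : VertexExponent) :
    (normalProd A B).creation q d = A.creation q d * B.creation q d := by
  rw [creation_eq, creation_eq, creation_eq, ← psExp_add (coeff_zero_creExp q d A)
    (coeff_zero_creExp q d B) (creExp_commute hq h A A) (creExp_commute hq h B B)
    (creExp_commute hq h A B)]
  congr 1
  ext1 n
  rw [map_add, creExp, creExp, creExp, PowerSeries.coeff_mk, PowerSeries.coeff_mk,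
    PowerSeries.coeff_mk]
  split_ifs
  · simp
  · simp only [normalProd, add_smul, Finset.sum_add_distrib]

lemma annihilation_normalProd (hq : q ≠ 0) (h : Generic q d) (A B : VertexExponent) :
    (normalProd A B).annihilation q d = A.annihilation q d * B.annihilation q d := by
  rw [annihilation_eq, annihilation_eq, annihilation_eq, ← psExp_add (coeff_zero_annExp q d A)
    (coeff_zero_annExp q d B) (annExp_commute hq h A A) (annExp_commute hq h B B)
    (annExp_commute hq h A B)]
  congr 1
  ext1 n
  rw [map_add, annExp, annExp, annExp, PowerSeries.coeff_mk, PowerSeries.coeff_mk,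
    PowerSeries.coeff_mk]
  split_ifs
  · simp
  · simp only [normalProd, add_smul, Finset.sum_add_distrib]

lemma coeff_creation_rescale (hq : q ≠ 0) (h : Generic q d) (ξ : ℂ) (A : VertexExponent) (n : ℕ) :
    PowerSeries.coeff n ((A.rescale ξ).creation q d) =
      ξ ^ n • PowerSeries.coeff n (A.creation q d) := by
  refine coeff_psExp_scale ξ (coeff_zero_creExp q d A) (creExp_commute hq h A A) (fun n => ?_) n
  rw [creExp, PowerSeries.coeff_mk, PowerSeries.coeff_mk]
  split_ifs
  · simp
  · simp only [rescale, Finset.smul_sum, smul_smul, neg_neg, zpow_natCast, mul_comm]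

lemma coeff_annihilation_rescale (hq : q ≠ 0) (h : Generic q d) (ξ : ℂ) (A : VertexExponent)
    (n : ℕ) : PowerSeries.coeff n ((A.rescale ξ).annihilation q d) =
      (ξ⁻¹) ^ n • PowerSeries.coeff n (A.annihilation q d) := by
  refine coeff_psExp_scale ξ⁻¹ (coeff_zero_annExp q d A) (annExp_commute hq h A A)
    (fun n => ?_) n
  rw [annExp, PowerSeries.coeff_mk, PowerSeries.coeff_mk]
  split_ifs
  · simp
  · simp only [rescale, Finset.smul_sum, smul_smul, zpow_neg, zpow_natCast, inv_pow, mul_comm]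

end VertexExponent

/-! ### Coefficients indexed by the integers -/

/-- The coefficient of `X ^ j`, `j ∈ ℤ`, of a power series. -/
def intCoeff {R : Type*} [Semiring R] (F : R⟦X⟧) (j : ℤ) : R :=
  if 0 ≤ j then PowerSeries.coeff j.toNat F else 0

lemma intCoeff_natCast {R : Type*} [Semiring R] (F : R⟦X⟧) (n : ℕ) :
    intCoeff F (n : ℤ) = PowerSeries.coeff n F := by
  rw [intCoeff, if_pos (Int.natCast_nonneg n), Int.toNat_natCast]

lemma intCoeff_of_neg {R : Type*} [Semiring R] (F : R⟦X⟧) {j : ℤ} (hj : j < 0) :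
    intCoeff F j = 0 := if_neg (by omega)

/-- With coefficients extended by zero to negative indices, convolutions become sums over `ℤ`, which
can be reindexed by bijections without case distinctions. -/
lemma sum_antidiagonal_eq_finsum {M : Type*} [AddCommMonoid M] (f : ℤ → ℤ → M)
    (h1 : ∀ i j, i < 0 → f i j = 0) (h2 : ∀ i j, j < 0 → f i j = 0) (n : ℕ) :
    ∑ p ∈ Finset.HasAntidiagonal.antidiagonal n, f p.1 p.2 = ∑ᶠ i : ℤ, f i (n - i) := by
  rw [Finset.Nat.sum_antidiagonal_eq_sum_range_succ (fun i j : ℕ => f i j),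
    finsum_eq_sum_of_support_subset (s := (Finset.range (n + 1)).map Nat.castEmbedding)]
  · rw [Finset.sum_map]
    refine Finset.sum_congr rfl fun k hk => ?_
    have : k ≤ n := by simpa [Nat.lt_succ_iff] using hk
    simp [Nat.cast_sub this]
  · intro i hi
    have hi0 : 0 ≤ i := by
      by_contra h; exact hi (h1 _ _ (by omega))
    have hin : 0 ≤ n - i := by
      by_contra h; exact hi (h2 _ _ (by omega))
    simp only [Finset.coe_map, Set.mem_image, Finset.coe_range, Set.mem_Iio]
    exact ⟨i.toNat, by omega, by simp [hi0]⟩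

lemma finsum_natCast {M : Type*} [AddCommMonoid M] (f : ℤ → M) (h : ∀ i, i < 0 → f i = 0) :
    ∑ᶠ k : ℕ, f k = ∑ᶠ i : ℤ, f i := by
  rw [← finsum_mem_range (f := f) (g := fun k : ℕ => (k : ℤ)) Nat.cast_injective,
    ← finsum_mem_univ f]
  refine finsum_mem_inter_support_eq f _ _ ?_
  ext i
  simp only [Set.mem_inter_iff, Set.mem_range, Set.mem_univ, true_and, and_iff_right_iff_imp]
  intro hi
  have : 0 ≤ i := by
    by_contra h'; exact hi (h i (by omega))
  exact ⟨i.toNat, by omega⟩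

lemma finsum_curry₃ {α β γ M : Type*} [AddCommMonoid M] (f : α × β × γ → M)
    (hf : (Function.support f).Finite) :
    ∑ᶠ x, f x = ∑ᶠ a, ∑ᶠ b, ∑ᶠ c, f (a, b, c) := by
  rw [finsum_curry f hf]
  refine finsum_congr fun a => finsum_curry (fun y => f (a, y)) ?_
  exact hf.preimage (f := fun y => (a, y)) (fun x _ y _ hxy => (Prod.mk.inj hxy).2)

namespace VertexExponent

/-- The coefficient of `z ^ j` of the creation part. -/
def cre (q d : ℂ) (A : VertexExponent) (j : ℤ) : Module.End ℂ Osc := intCoeff (A.creation q d) j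

/-- The coefficient of `z ^ (-j)` of the annihilation part. -/
def ann (q d : ℂ) (A : VertexExponent) (j : ℤ) : Module.End ℂ Osc :=
  intCoeff (A.annihilation q d) j

variable {q d : ℂ}

lemma cre_of_neg (A : VertexExponent) {j : ℤ} (hj : j < 0) : A.cre q d j = 0 :=
  intCoeff_of_neg _ hj

lemma ann_of_neg (A : VertexExponent) {j : ℤ} (hj : j < 0) : A.ann q d j = 0 :=
  intCoeff_of_neg _ hj

lemma low_mono {M N : ℕ} (h : M ≤ N) : low M ≤ low N := fun _ hx =>
  (MvPolynomial.mem_restrictSupport_iff ℂ).2 fun _ hm =>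
    lt_of_lt_of_le ((MvPolynomial.mem_restrictSupport_iff ℂ).1 hx hm) h

lemma ann_mem_low (A : VertexExponent) (k : ℤ) {N : ℕ} {x : Osc} (hx : x ∈ low N) :
    A.ann q d k x ∈ low N := by
  rw [ann, intCoeff]
  split_ifs
  · exact low_mono (Nat.sub_le _ _) (annihilation_low q d A _ hx)
  · exact Submodule.zero_mem _

lemma ann_eq_zero (A : VertexExponent) {k : ℤ} {N : ℕ} {x : Osc} (hx : x ∈ low N)
    (hk : (N : ℤ) ≤ k) : A.ann q d k x = 0 := by
  rw [ann, intCoeff, if_pos (by omega)]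
  have := annihilation_low q d A k.toNat hx
  rw [show N - k.toNat = 0 by omega] at this
  exact low_zero this

lemma ann_ann_eq_zero (A B : VertexExponent) {k l : ℤ} {N : ℕ} {x : Osc} (hx : x ∈ low N)
    (h : k < 0 ∨ (N : ℤ) ≤ k ∨ l < 0 ∨ (N : ℤ) ≤ l) : A.ann q d k (B.ann q d l x) = 0 := by
  rcases h with h | h | h | h
  · rw [ann_of_neg A h, LinearMap.zero_apply]
  · exact ann_eq_zero A (ann_mem_low B l hx) h
  · rw [ann_of_neg B h, LinearMap.zero_apply, map_zero]
  · rw [ann_eq_zero B hx h, map_zero]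

lemma oscCoeff_apply (A : VertexExponent) (j : ℤ) (x : Osc) :
    A.oscCoeff q d j x = ∑ᶠ k : ℤ, A.cre q d (j + k) (A.ann q d k x) := by
  rw [← finsum_natCast]
  · refine finsum_congr fun k => ?_
    rw [ann, intCoeff_natCast]
    rfl
  · intro i hi
    rw [ann_of_neg A hi, LinearMap.zero_apply, map_zero]

lemma cre_ann_finite (A : VertexExponent) (g : ℤ → Osc →ₗ[ℂ] Osc) (x : Osc) :
    (Function.support fun k : ℤ => g k (A.ann q d k x)).Finite := by
  obtain ⟨N, hN⟩ := exists_low x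
  refine (Set.finite_Icc (0 : ℤ) N).subset fun k hk => ?_
  by_contra hk'
  refine hk ?_
  show g k (A.ann q d k x) = 0
  rw [Set.mem_Icc, not_and_or, not_le, not_le] at hk'
  rcases hk' with h | h
  · rw [ann_of_neg A h, LinearMap.zero_apply, map_zero]
  · rw [ann_eq_zero A hN h.le, map_zero]

lemma oscCoeff_eq_zero (A : VertexExponent) {j : ℤ} {N : ℕ} {x : Osc} (hx : x ∈ low N)
    (hj : j + N ≤ 0) : A.oscCoeff q d j x = 0 := by
  rw [oscCoeff_apply]
  refine finsum_eq_zero_of_forall_eq_zero fun k => ?_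
  rcases lt_or_ge k N with h | h
  · rw [cre_of_neg A (by omega), LinearMap.zero_apply]
  · rw [ann_eq_zero A hx h, map_zero]

/-- Wick's rule with integer indices. When `k` or `m` is negative both sides vanish, since `r ≥ 0`
keeps `k - r` or `m - r` negative. -/
lemma ann_cre (hq : q ≠ 0) (h : Generic q d) (A B : VertexExponent) (k m : ℤ) (x : Osc) :
    A.ann q d k (B.cre q d m x) = ∑ᶠ r : ℤ, intCoeff (contraction q d A B) r •
      B.cre q d (m - r) (A.ann q d (k - r) x) := by
  rcases lt_or_ge m 0 with hm | hm
  · rw [cre_of_neg B hm, LinearMap.zero_apply, map_zero]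
    refine (finsum_eq_zero_of_forall_eq_zero fun r => ?_).symm
    rcases lt_or_ge r 0 with hr | hr
    · rw [intCoeff_of_neg _ hr, zero_smul]
    · rw [cre_of_neg B (by omega), LinearMap.zero_apply, smul_zero]
  lift m to ℕ using hm
  rcases lt_or_ge k 0 with hk | hk
  · rw [ann_of_neg A hk, LinearMap.zero_apply]
    refine (finsum_eq_zero_of_forall_eq_zero fun r => ?_).symm
    rcases lt_or_ge r 0 with hr | hr
    · rw [intCoeff_of_neg _ hr, zero_smul]
    · rw [ann_of_neg A (by omega), LinearMap.zero_apply, map_zero, smul_zero]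
  lift k to ℕ using hk
  rw [← sum_antidiagonal_eq_finsum
    (fun r s : ℤ => intCoeff (contraction q d A B) r • B.cre q d s (A.ann q d (k - r) x))]
  · have := LinearMap.congr_fun (annihilation_mul_creation hq h A B k m) x
    rw [Module.End.mul_apply, LinearMap.sum_apply] at this
    rw [ann, cre, intCoeff_natCast, intCoeff_natCast, this]
    refine Finset.sum_congr rfl fun p _ => ?_
    rw [intCoeff_natCast, cre, intCoeff_natCast, LinearMap.smul_apply, Module.End.mul_apply]
    split_ifs with hpk
    · rw [← Nat.cast_sub hpk, ann, intCoeff_natCast]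
    · rw [ann_of_neg A (by omega)]
  · intro r s hr
    rw [intCoeff_of_neg _ hr, zero_smul]
  · intro r s hs
    rw [cre_of_neg B hs, LinearMap.zero_apply, smul_zero]

lemma cre_comm (hq : q ≠ 0) (h : Generic q d) (A B : VertexExponent) (m n : ℤ) (x : Osc) :
    A.cre q d m (B.cre q d n x) = B.cre q d n (A.cre q d m x) := by
  rw [cre, cre, intCoeff, intCoeff]
  split_ifs
  · exact LinearMap.congr_fun (creation_commute hq h A B _ _).eq x
  all_goals simp

lemma ann_comm (hq : q ≠ 0) (h : Generic q d) (A B : VertexExponent) (m n : ℤ) (x : Osc) :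
    A.ann q d m (B.ann q d n x) = B.ann q d n (A.ann q d m x) := by
  rw [ann, ann, intCoeff, intCoeff]
  split_ifs
  · exact LinearMap.congr_fun (annihilation_commute hq h A B _ _).eq x
  all_goals simp

lemma cre_normalProd_rescale (hq : q ≠ 0) (h : Generic q d) (p : ℂ) (A B : VertexExponent)
    (m : ℤ) (x : Osc) : (normalProd (A.rescale p) B).cre q d m x =
      ∑ᶠ u : ℤ, p ^ u • A.cre q d u (B.cre q d (m - u) x) := by
  rcases lt_or_ge m 0 with hm | hm
  · rw [cre_of_neg _ hm, LinearMap.zero_apply]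
    refine (finsum_eq_zero_of_forall_eq_zero fun r => ?_).symm
    rcases lt_or_ge r 0 with hr | hr
    · rw [cre_of_neg A hr, LinearMap.zero_apply, smul_zero]
    · rw [cre_of_neg B (by omega), LinearMap.zero_apply, map_zero, smul_zero]
  lift m to ℕ using hm
  rw [← sum_antidiagonal_eq_finsum (fun r s : ℤ => p ^ r • A.cre q d r (B.cre q d s x))]
  · rw [cre, intCoeff_natCast, creation_normalProd hq h, PowerSeries.coeff_mul,
      LinearMap.sum_apply]
    refine Finset.sum_congr rfl fun r _ => ?_
    rw [coeff_creation_rescale hq h, cre, cre, intCoeff_natCast, intCoeff_natCast,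
      Module.End.mul_apply, LinearMap.smul_apply, zpow_natCast]
  · intro r s hr
    rw [cre_of_neg A hr, LinearMap.zero_apply, smul_zero]
  · intro r s hs
    rw [cre_of_neg B hs, LinearMap.zero_apply, map_zero, smul_zero]

lemma ann_normalProd_rescale (hq : q ≠ 0) (h : Generic q d) (p : ℂ) (A B : VertexExponent)
    (m : ℤ) (x : Osc) : (normalProd (A.rescale p) B).ann q d m x =
      ∑ᶠ u : ℤ, p ^ (-u) • A.ann q d u (B.ann q d (m - u) x) := by
  rcases lt_or_ge m 0 with hm | hm
  · rw [ann_of_neg _ hm, LinearMap.zero_apply]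
    refine (finsum_eq_zero_of_forall_eq_zero fun r => ?_).symm
    rcases lt_or_ge r 0 with hr | hr
    · rw [ann_of_neg A hr, LinearMap.zero_apply, smul_zero]
    · rw [ann_of_neg B (by omega), LinearMap.zero_apply, map_zero, smul_zero]
  lift m to ℕ using hm
  rw [← sum_antidiagonal_eq_finsum (fun r s : ℤ => p ^ (-r) • A.ann q d r (B.ann q d s x))]
  · rw [ann, intCoeff_natCast, annihilation_normalProd hq h, PowerSeries.coeff_mul,
      LinearMap.sum_apply]
    refine Finset.sum_congr rfl fun r _ => ?_
    rw [coeff_annihilation_rescale hq h, ann, ann, intCoeff_natCast, intCoeff_natCast,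
      Module.End.mul_apply, LinearMap.smul_apply, zpow_neg, zpow_natCast, inv_pow]
  · intro r s hr
    rw [ann_of_neg A hr, LinearMap.zero_apply, smul_zero]
  · intro r s hs
    rw [ann_of_neg B hs, LinearMap.zero_apply, map_zero, smul_zero]

/-! ### Two-variable normal-ordered products -/

/-- The coefficient of `z ^ a w ^ b` of the oscillator part of `:A(z) B(w):`. -/
def normalCoeff (q d : ℂ) (A B : VertexExponent) (a b : ℤ) (x : Osc) : Osc :=
  ∑ᶠ p : ℤ × ℤ,
    A.cre q d (a + p.1) (B.cre q d (b + p.2) (A.ann q d p.1 (B.ann q d p.2 x)))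

lemma normalCoeff_comm (hq : q ≠ 0) (h : Generic q d) (A B : VertexExponent) (a b : ℤ) (x : Osc) :
    normalCoeff q d A B a b x = normalCoeff q d B A b a x := by
  rw [normalCoeff, normalCoeff, ← finsum_comp_equiv (Equiv.prodComm ℤ ℤ)]
  refine finsum_congr fun p => ?_
  rw [cre_comm hq h, ann_comm hq h]
  rfl

/-- Annihilation indices that contribute are below `N`, so a very negative `a` or `b` forces a
negative creation index. Truncation in each variable separately makes sums along `a + b = const`
finite, which is what permits multiplication by a delta function. -/
lemma normalCoeff_eq_zero (A B : VertexExponent) {a b : ℤ} {N : ℕ} {x : Osc} (hx : x ∈ low N)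
    (hab : a + N ≤ 0 ∨ b + N ≤ 0) : normalCoeff q d A B a b x = 0 := by
  refine finsum_eq_zero_of_forall_eq_zero fun p => ?_
  by_cases hp : p.1 < 0 ∨ (N : ℤ) ≤ p.1 ∨ p.2 < 0 ∨ (N : ℤ) ≤ p.2
  · rw [ann_ann_eq_zero A B hx hp, map_zero, map_zero]
  rcases hab with hab | hab
  · rw [cre_of_neg A (by omega), LinearMap.zero_apply]
  · rw [cre_of_neg B (by omega), LinearMap.zero_apply, map_zero]

lemma normalCoeff_finite (A B : VertexExponent) (a b : ℤ) (x : Osc) :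
    (Function.support fun p : ℤ × ℤ =>
      A.cre q d (a + p.1) (B.cre q d (b + p.2) (A.ann q d p.1 (B.ann q d p.2 x)))).Finite := by
  obtain ⟨N, hN⟩ := exists_low x
  refine ((Set.finite_Icc (0 : ℤ) N).prod (Set.finite_Icc (0 : ℤ) N)).subset fun p hp => ?_
  have : ¬ (p.1 < 0 ∨ (N : ℤ) ≤ p.1 ∨ p.2 < 0 ∨ (N : ℤ) ≤ p.2) := fun h =>
    hp (by simp only [ann_ann_eq_zero A B hN h, map_zero])
  simp only [Set.mem_prod, Set.mem_Icc]
  omega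

/-- The operator product expansion. -/
lemma oscCoeff_oscCoeff (hq : q ≠ 0) (h : Generic q d) (A B : VertexExponent) (a b : ℤ)
    (x : Osc) : A.oscCoeff q d a (B.oscCoeff q d b x) =
      ∑ᶠ r : ℤ, intCoeff (contraction q d A B) r • normalCoeff q d A B (a + r) (b - r) x := by
  obtain ⟨N, hN⟩ := exists_low x
  -- The triple consists of the annihilation index of `A` before contraction, the annihilation index
  -- of `B`, and the contraction index.
  let f : ℤ × ℤ × ℤ → Osc := fun t => intCoeff (contraction q d A B) t.2.2 •
    A.cre q d (a + t.1) (B.cre q d (b + t.2.1 - t.2.2)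
      (A.ann q d (t.1 - t.2.2) (B.ann q d t.2.1 x)))
  have hf : (Function.support f).Finite := by
    refine ((Set.finite_Icc (0 : ℤ) (b + 2 * N)).prod ((Set.finite_Icc (0 : ℤ) N).prod
      (Set.finite_Icc (0 : ℤ) (b + N)))).subset fun t ht => ?_
    have h1 : ¬ (t.1 - t.2.2 < 0 ∨ (N : ℤ) ≤ t.1 - t.2.2 ∨ t.2.1 < 0 ∨ (N : ℤ) ≤ t.2.1) :=
      fun h => ht (by simp only [f, ann_ann_eq_zero A B hN h, map_zero, smul_zero])
    have h2 : ¬ b + t.2.1 - t.2.2 < 0 := fun h => ht (by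
      simp only [f, cre_of_neg B h, LinearMap.zero_apply, map_zero, smul_zero])
    have h3 : ¬ t.2.2 < 0 := fun h => ht (by
      simp only [f, intCoeff_of_neg _ h, zero_smul])
    simp only [Set.mem_prod, Set.mem_Icc]
    omega
  have hl : A.oscCoeff q d a (B.oscCoeff q d b x) = ∑ᶠ t, f t := by
    rw [finsum_curry₃ f hf, oscCoeff_apply]
    refine finsum_congr fun k => ?_
    rw [oscCoeff_apply, map_finsum _ (cre_ann_finite B _ x), map_finsum]
    · refine finsum_congr fun l => ?_
      rw [ann_cre hq h, map_finsum]
      · refine finsum_congr fun r => ?_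
        rw [map_smul]
      · refine (Set.finite_Icc (0 : ℤ) k).subset fun r hr => ?_
        have h3 : ¬ r < 0 := fun h => hr (by simp only [intCoeff_of_neg _ h, zero_smul])
        have h4 : ¬ k - r < 0 := fun h => hr (by
          simp only [ann_of_neg A h, LinearMap.zero_apply, map_zero, smul_zero])
        simp only [Set.mem_Icc]
        omega
    · exact cre_ann_finite B (fun l => A.ann q d k ∘ₗ B.cre q d (b + l)) x
  -- The new triple starts with the contraction index `r`; the annihilation index of `A` becomes the
  -- one left after `r` has been contracted away.
  let e : ℤ × ℤ × ℤ ≃ ℤ × ℤ × ℤ :=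
    { toFun := fun t => (t.2.1 + t.1, t.2.2, t.1)
      invFun := fun t => (t.2.2, t.1 - t.2.2, t.2.1)
      left_inv := fun t => by simp
      right_inv := fun t => by simp }
  have hfe : (Function.support fun t => f (e t)).Finite := hf.preimage e.injective.injOn
  rw [hl, ← finsum_comp_equiv e, finsum_curry _ hfe]
  refine finsum_congr fun r => ?_
  rw [normalCoeff, smul_finsum' _ (normalCoeff_finite A B _ _ x)]
  refine finsum_congr fun p => ?_
  simp only [f, e, Equiv.coe_fn_mk]
  rw [show p.1 + r - r = p.1 by ring, show a + (p.1 + r) = a + r + p.1 by ring,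
    show b + p.2 - r = b - r + p.2 by ring]

/-- Setting `z = p w` in `:A(z) B(w):`. -/
lemma finsum_normalCoeff (hq : q ≠ 0) (h : Generic q d) {p : ℂ} (hp : p ≠ 0)
    (A B : VertexExponent) (a b : ℤ) (x : Osc) :
    ∑ᶠ j : ℤ, p ^ (a + j) • normalCoeff q d A B (a + j) (b - j) x =
      (normalProd (A.rescale p) B).oscCoeff q d (a + b) x := by
  obtain ⟨N, hN⟩ := exists_low x
  let f : ℤ × ℤ × ℤ → Osc := fun t => p ^ (t.2.2 - t.2.1) •
    A.cre q d t.2.2 (B.cre q d (a + b + t.1 - t.2.2)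
      (A.ann q d t.2.1 (B.ann q d (t.1 - t.2.1) x)))
  have hf : (Function.support f).Finite := by
    refine ((Set.finite_Icc (0 : ℤ) (2 * N)).prod ((Set.finite_Icc (0 : ℤ) N).prod
      (Set.finite_Icc (0 : ℤ) (a + b + 2 * N)))).subset fun t ht => ?_
    have h1 : ¬ (t.2.1 < 0 ∨ (N : ℤ) ≤ t.2.1 ∨ t.1 - t.2.1 < 0 ∨ (N : ℤ) ≤ t.1 - t.2.1) :=
      fun h => ht (by simp only [f, ann_ann_eq_zero A B hN h, map_zero, smul_zero])
    have h2 : ¬ a + b + t.1 - t.2.2 < 0 := fun h => ht (by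
      simp only [f, cre_of_neg B h, LinearMap.zero_apply, map_zero, smul_zero])
    have h3 : ¬ t.2.2 < 0 := fun h => ht (by
      simp only [f, cre_of_neg A h, LinearMap.zero_apply, smul_zero])
    simp only [Set.mem_prod, Set.mem_Icc]
    omega
  have hr : (normalProd (A.rescale p) B).oscCoeff q d (a + b) x = ∑ᶠ t, f t := by
    rw [finsum_curry₃ f hf, oscCoeff_apply]
    refine finsum_congr fun K => ?_
    rw [ann_normalProd_rescale hq h, map_finsum]
    · refine finsum_congr fun k => ?_
      rw [map_smul, cre_normalProd_rescale hq h, smul_finsum']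
      · refine finsum_congr fun u => ?_
        simp only [f]
        rw [smul_smul, ← zpow_add₀ hp, neg_add_eq_sub]
      · refine (Set.finite_Icc (0 : ℤ) (a + b + K)).subset fun r hr => ?_
        have h3 : ¬ r < 0 := fun h => hr (by
          simp only [cre_of_neg A h, LinearMap.zero_apply, smul_zero])
        have h4 : ¬ a + b + K - r < 0 := fun h => hr (by
          simp only [cre_of_neg B h, LinearMap.zero_apply, map_zero, smul_zero])
        simp only [Set.mem_Icc]
        omega
    · refine (Set.finite_Icc (0 : ℤ) N).subset fun k hk => ?_
      have h1 : ¬ (k < 0 ∨ (N : ℤ) ≤ k ∨ K - k < 0 ∨ (N : ℤ) ≤ K - k) :=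
        fun h => hk (by simp only [ann_ann_eq_zero A B hN h, smul_zero])
      simp only [Set.mem_Icc]
      omega
  -- From the position `j` on the antidiagonal and the two annihilation indices, this recovers the
  -- total annihilation index, the share of `A` in it, and the creation index `a + j + t.2.1` of
  -- `A`. The exponent of `p` in `f` then becomes `a + j`.
  let e : ℤ × ℤ × ℤ ≃ ℤ × ℤ × ℤ :=
    { toFun := fun t => (t.2.1 + t.2.2, t.2.1, a + t.1 + t.2.1)
      invFun := fun t => (t.2.2 - t.2.1 - a, t.2.1, t.1 - t.2.1)
      left_inv := fun t => by ext <;> simp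
      right_inv := fun t => by ext <;> simp }
  have hfe : (Function.support fun t => f (e t)).Finite := hf.preimage e.injective.injOn
  rw [hr, ← finsum_comp_equiv e, finsum_curry _ hfe]
  refine finsum_congr fun r => ?_
  rw [normalCoeff, smul_finsum' _ (normalCoeff_finite A B _ _ x)]
  refine finsum_congr fun t => ?_
  simp only [f, e, Equiv.coe_fn_mk]
  rw [show t.1 + t.2 - t.1 = t.2 by ring, show a + r + t.1 - t.1 = a + r by ring,
    show a + b + (t.1 + t.2) - (a + r + t.1) = b - r + t.2 by ring]

end VertexExponent

/-! ### Exchange relations between vertex operators -/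

/-- The difference of the charges moves by `2t`. This is the zero-mode commutation relation, the
source of the scalar `A.base ^ B.shift` and of the power `z ^ (A.pow * B.shift)` in operator
products. -/
lemma Charge.b0_shift (t : ℤ) (p : Charge) : (p.shift t).b0 = p.b0 + t := by
  rw [Charge.b0, Charge.b0, Charge.shift]
  have h : p.1.1 + t - (p.1.2 - t) = (p.1.1 - p.1.2) + t * 2 := by ring
  simp only
  rw [h, Int.add_mul_ediv_right _ _ two_ne_zero]

lemma Charge.shift_shift (s t : ℤ) (p : Charge) : (p.shift t).shift s = p.shift (s + t) := by
  apply Subtype.ext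
  simp only [Charge.shift]
  ext <;> simp only <;> ring

lemma vertexOp_single (q d u₁ u₂ : ℂ) (A : VertexExponent) (m : ℤ) (p : Charge) (x : Osc) :
    vertexOp q d u₁ u₂ A m (Finsupp.single p x) =
      (q1Zeta q d u₁ u₂ ^ A.zeta * A.base ^ p.b0) •
        Finsupp.single (p.shift A.shift) (A.oscCoeff q d (m - A.pow * p.b0) x) := by
  rw [vertexOp, Finsupp.lsum_single]
  rfl

/-- The fields whose coefficients of low degree vanish on each vector. -/
def FormalField.IsTruncated (A : FormalField) : Prop := ∀ v, ∃ N : ℤ, ∀ m ≤ N, A m v = 0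

lemma isTruncated_vertexOp (q d u₁ u₂ : ℂ) (A : VertexExponent) :
    (vertexOp q d u₁ u₂ A).IsTruncated := by
  intro v
  induction v using Finsupp.induction_linear with
  | zero => exact ⟨0, fun m _ => map_zero _⟩
  | add v w hv hw =>
    obtain ⟨N, hN⟩ := hv
    obtain ⟨N', hN'⟩ := hw
    refine ⟨min N N', fun m hm => ?_⟩
    rw [map_add, hN m (hm.trans (min_le_left _ _)), hN' m (hm.trans (min_le_right _ _)), add_zero]
  | single p x =>
    obtain ⟨N, hN⟩ := exists_low x
    refine ⟨A.pow * p.b0 - N, fun m hm => ?_⟩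
    rw [vertexOp_single, VertexExponent.oscCoeff_eq_zero A hN (by omega), Finsupp.single_zero,
      smul_zero]

lemma FormalField.IsTruncated.finite {A : FormalField} (hA : A.IsTruncated) (b : ℤ) (v : Fock)
    (g : ℕ → Fock →ₗ[ℂ] Fock) : (Function.support fun l : ℕ => g l (A (b - l) v)).Finite := by
  obtain ⟨N, hN⟩ := hA v
  refine (Set.finite_le_nat (b - N).toNat).subset fun l hl => ?_
  by_contra h
  refine hl ?_
  show g l (A (b - l) v) = 0
  have : ¬ l ≤ (b - N).toNat := h
  rw [hN _ (by omega), map_zero]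

section Bilinear

variable {c : ℂ} {φ ψ : ℂ⟦X⟧} {A A' B B' : FormalField} {R R' : ℤ → ℤ → Module.End ℂ Fock}

lemma ExchangeRelation.add_left (h : ExchangeRelation c φ ψ A B R)
    (h' : ExchangeRelation c φ ψ A' B R') :
    ExchangeRelation c φ ψ (A + A') B (fun a b => R a b + R' a b) := by
  intro a b v
  obtain ⟨h1, h2, h3⟩ := h a b v
  obtain ⟨h1', h2', h3'⟩ := h' a b v
  have e1 : ∀ l : ℕ, PowerSeries.coeff l φ • (A + A') (a + l) (B (b - l) v) =
      PowerSeries.coeff l φ • A (a + l) (B (b - l) v) +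
        PowerSeries.coeff l φ • A' (a + l) (B (b - l) v) := fun l => by
    rw [Pi.add_apply, LinearMap.add_apply, smul_add]
  have e2 : ∀ l : ℕ, PowerSeries.coeff l ψ • B (b + l) ((A + A') (a - l) v) =
      PowerSeries.coeff l ψ • B (b + l) (A (a - l) v) +
        PowerSeries.coeff l ψ • B (b + l) (A' (a - l) v) := fun l => by
    rw [Pi.add_apply, LinearMap.add_apply, map_add, smul_add]
  simp only [e1, e2]
  refine ⟨(h1.union h1').subset (Function.support_add _ _),
    (h2.union h2').subset (Function.support_add _ _), ?_⟩
  rw [finsum_add_distrib h1 h1', finsum_add_distrib h2 h2', LinearMap.add_apply, ← h3, ← h3']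
  module

lemma ExchangeRelation.add_right (h : ExchangeRelation c φ ψ A B R)
    (h' : ExchangeRelation c φ ψ A B' R') :
    ExchangeRelation c φ ψ A (B + B') (fun a b => R a b + R' a b) := by
  intro a b v
  obtain ⟨h1, h2, h3⟩ := h a b v
  obtain ⟨h1', h2', h3'⟩ := h' a b v
  have e1 : ∀ l : ℕ, PowerSeries.coeff l φ • A (a + l) ((B + B') (b - l) v) =
      PowerSeries.coeff l φ • A (a + l) (B (b - l) v) +
        PowerSeries.coeff l φ • A (a + l) (B' (b - l) v) := fun l => by
    rw [Pi.add_apply, LinearMap.add_apply, map_add, smul_add]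
  have e2 : ∀ l : ℕ, PowerSeries.coeff l ψ • (B + B') (b + l) (A (a - l) v) =
      PowerSeries.coeff l ψ • B (b + l) (A (a - l) v) +
        PowerSeries.coeff l ψ • B' (b + l) (A (a - l) v) := fun l => by
    rw [Pi.add_apply, LinearMap.add_apply, smul_add]
  simp only [e1, e2]
  refine ⟨(h1.union h1').subset (Function.support_add _ _),
    (h2.union h2').subset (Function.support_add _ _), ?_⟩
  rw [finsum_add_distrib h1 h1', finsum_add_distrib h2 h2', LinearMap.add_apply, ← h3, ← h3']
  module

/-- Multiplication of the second field by `k w ^ t`, needed for the coefficients and the factor `z²`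
in `𝒯`. -/
lemma ExchangeRelation.smul_shift_right (h : ExchangeRelation c φ ψ A B R) (k : ℂ) (t : ℤ) :
    ExchangeRelation c φ ψ A (fun m => k • B (m - t)) (fun a b => k • R a (b - t)) := by
  intro a b v
  obtain ⟨h1, h2, h3⟩ := h a (b - t) v
  have e1 : ∀ l : ℕ, PowerSeries.coeff l φ • A (a + l) ((k • B (b - l - t)) v) =
      k • (PowerSeries.coeff l φ • A (a + l) (B (b - t - l) v)) := fun l => by
    rw [LinearMap.smul_apply, map_smul, smul_comm, sub_right_comm]
  have e2 : ∀ l : ℕ, PowerSeries.coeff l ψ • (k • B (b + l - t)) (A (a - l) v) =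
      k • (PowerSeries.coeff l ψ • B (b - t + l) (A (a - l) v)) := fun l => by
    rw [LinearMap.smul_apply, smul_comm, sub_add_eq_add_sub]
  simp only [e1, e2]
  refine ⟨h1.subset fun l hl h0 => hl ((congrArg (k • ·) h0).trans (smul_zero k)),
    h2.subset fun l hl h0 => hl ((congrArg (k • ·) h0).trans (smul_zero k)), ?_⟩
  rw [← smul_finsum' _ h1, ← smul_finsum' _ h2, LinearMap.smul_apply, ← h3]
  module

lemma ExchangeRelation.congr (h : ExchangeRelation c φ ψ A B R) (hA : A = A') (hB : B = B')
    (hR : ∀ a b, R a b = R' a b) : ExchangeRelation c φ ψ A' B' R' := by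
  obtain rfl : R = R' := funext fun a => funext (hR a)
  rwa [← hA, ← hB]

/-- Truncation of the field that acts first gives the finiteness on every vector. Both sides are
then additive in the vector, so vectors of a single charge suffice. -/
lemma ExchangeRelation.of_single (hA : A.IsTruncated) (hB : B.IsTruncated)
    (h : ∀ (a b : ℤ) (p : Charge) (x : Osc),
      c • (∑ᶠ l : ℕ, PowerSeries.coeff l φ • A (a + l) (B (b - l) (Finsupp.single p x)))
      - ∑ᶠ l : ℕ, PowerSeries.coeff l ψ • B (b + l) (A (a - l) (Finsupp.single p x)) =
        R a b (Finsupp.single p x)) : ExchangeRelation c φ ψ A B R := by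
  intro a b v
  have f1 : ∀ v, (Function.support fun l : ℕ =>
      PowerSeries.coeff l φ • A (a + l) (B (b - l) v)).Finite := fun v =>
    hB.finite b v fun l => PowerSeries.coeff l φ • A (a + l)
  have f2 : ∀ v, (Function.support fun l : ℕ =>
      PowerSeries.coeff l ψ • B (b + l) (A (a - l) v)).Finite := fun v =>
    hA.finite a v fun l => PowerSeries.coeff l ψ • B (b + l)
  refine ⟨f1 v, f2 v, ?_⟩
  induction v using Finsupp.induction_linear with
  | zero => simp
  | add v w hv hw =>
    simp only [map_add, smul_add]
    rw [finsum_add_distrib (f1 v) (f1 w), finsum_add_distrib (f2 v) (f2 w), ← hv, ← hw]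
    module
  | single p x => exact h a b p x

end Bilinear

/-- Associativity: multiplying an operator product by the structure function `φ` multiplies its
contraction by `φ`. Vanishing of `H` for large indices confines everything to the triangle `l + r <
n`. -/
lemma finsum_smul_finsum_smul {M : Type*} [AddCommGroup M] [Module ℂ M] (φ g : ℂ⟦X⟧) (H : ℤ → M)
    (hH : ∃ N : ℤ, ∀ m, N ≤ m → H m = 0) :
    ∑ᶠ l : ℕ, PowerSeries.coeff l φ • ∑ᶠ r : ℤ, intCoeff g r • H (l + r) =
      ∑ᶠ m : ℤ, intCoeff (φ * g) m • H m := by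
  obtain ⟨N, hN⟩ := hH
  obtain ⟨n, hn⟩ : ∃ n : ℕ, N ≤ n := ⟨N.toNat, Int.self_le_toNat N⟩
  have hH' : ∀ m : ℕ, n ≤ m → H m = 0 := fun m hm => hN _ (hn.trans (by exact_mod_cast hm))
  have inner : ∀ l : ℕ, ∑ᶠ r : ℤ, intCoeff g r • H (l + r) =
      ∑ r ∈ Finset.range (n - l), PowerSeries.coeff r g • H ((l + r : ℕ) : ℤ) := fun l => by
    rw [← finsum_natCast]
    · rw [finsum_eq_sum_of_support_subset (s := Finset.range (n - l))]
      · refine Finset.sum_congr rfl fun r _ => ?_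
        rw [intCoeff_natCast, Nat.cast_add]
      · intro r hr
        rw [Finset.coe_range, Set.mem_Iio]
        by_contra hlt
        refine hr ?_
        show intCoeff g r • H (l + r) = 0
        rw [← Nat.cast_add, hH' _ (by omega), smul_zero]
    · intro i hi
      rw [intCoeff_of_neg _ hi, zero_smul]
  have outer : ∑ᶠ m : ℤ, intCoeff (φ * g) m • H m =
      ∑ m ∈ Finset.range n, PowerSeries.coeff m (φ * g) • H m := by
    rw [← finsum_natCast]
    · rw [finsum_eq_sum_of_support_subset (s := Finset.range n)]
      · refine Finset.sum_congr rfl fun r _ => ?_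
        rw [intCoeff_natCast]
      · intro r hr
        rw [Finset.coe_range, Set.mem_Iio]
        by_contra hlt
        refine hr ?_
        show intCoeff (φ * g) r • H r = 0
        rw [hH' _ (by omega), smul_zero]
    · intro i hi
      rw [intCoeff_of_neg _ hi, zero_smul]
  simp only [inner]
  rw [outer, finsum_eq_sum_of_support_subset (s := Finset.range n)]
  · simp only [Finset.smul_sum, smul_smul]
    rw [← Finset.sum_range_diag_flip n fun l r =>
      (PowerSeries.coeff l φ * PowerSeries.coeff r g) • H ((l + r : ℕ) : ℤ)]
    refine Finset.sum_congr rfl fun m _ => ?_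
    rw [PowerSeries.coeff_mul, Finset.Nat.sum_antidiagonal_eq_sum_range_succ
      (fun i j => PowerSeries.coeff i φ * PowerSeries.coeff j g), Finset.sum_smul]
    refine Finset.sum_congr rfl fun k hk => ?_
    rw [Nat.add_sub_cancel' (by simpa [Nat.lt_succ_iff] using hk)]
  · intro l hl
    rw [Finset.coe_range, Set.mem_Iio]
    by_contra hlt
    refine hl ?_
    show _ • _ = _
    rw [show n - l = 0 by omega, Finset.sum_range_zero, smul_zero]

open VertexExponent

/-- The coefficient of `z ^ a w ^ b` of `:A(z) B(w):` on a vector of charge `p`. -/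
def normalOp (q d u₁ u₂ : ℂ) (A B : VertexExponent) (a b : ℤ) (p : Charge) (x : Osc) : Fock :=
  (q1Zeta q d u₁ u₂ ^ (A.zeta + B.zeta) * (A.base * B.base) ^ p.b0) •
    Finsupp.single (p.shift (A.shift + B.shift))
      (normalCoeff q d A B (a - A.pow * p.b0) (b - B.pow * p.b0) x)

variable {q d : ℂ}

lemma normalOp_eq_zero (u₁ u₂ : ℂ) (A B : VertexExponent) (p : Charge) (x : Osc) :
    ∃ N : ℤ, ∀ a b, a ≤ N ∨ b ≤ N → normalOp q d u₁ u₂ A B a b p x = 0 := by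
  obtain ⟨N, hN⟩ := exists_low x
  refine ⟨min (A.pow * p.b0 - N) (B.pow * p.b0 - N), fun a b hab => ?_⟩
  rw [normalOp, normalCoeff_eq_zero A B hN (by omega), Finsupp.single_zero, smul_zero]

lemma normalOp_comm (hq : q ≠ 0) (h : Generic q d) (u₁ u₂ : ℂ) (A B : VertexExponent) (a b : ℤ)
    (p : Charge) (x : Osc) :
    normalOp q d u₁ u₂ A B a b p x = normalOp q d u₁ u₂ B A b a p x := by
  rw [normalOp, normalOp, normalCoeff_comm hq h, add_comm A.zeta, mul_comm A.base,
    add_comm A.shift]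

lemma q1Zeta_ne_zero (hq : q ≠ 0) (hd : d ≠ 0) (u₁ u₂ : ℂ) : q1Zeta q d u₁ u₂ ≠ 0 := by
  rw [q1Zeta, Ne, Complex.cpow_eq_zero_iff, q1]
  simp [hq, hd]

/-- The oscillator expansion combined with the zero modes: `A` acts on the charge already shifted by
`B`, so `b0` grows by `B.shift`. -/
lemma vertexOp_vertexOp (hq : q ≠ 0) (hd : d ≠ 0) (h : Generic q d) (u₁ u₂ : ℂ)
    (A B : VertexExponent) (hA : A.base ≠ 0) (a b : ℤ) (p : Charge) (x : Osc) :
    vertexOp q d u₁ u₂ A a (vertexOp q d u₁ u₂ B b (Finsupp.single p x)) =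
      A.base ^ B.shift • ∑ᶠ r : ℤ, intCoeff (contraction q d A B) r •
        normalOp q d u₁ u₂ A B (a - A.pow * B.shift + r) (b - r) p x := by
  rw [vertexOp_single, map_smul, vertexOp_single, oscCoeff_oscCoeff hq h, Charge.b0_shift,
    Charge.shift_shift, smul_smul, zpow_add₀ hA]
  have hfin : (Function.support fun r : ℤ => intCoeff (contraction q d A B) r •
      normalCoeff q d A B (a - A.pow * (p.b0 + B.shift) + r) (b - B.pow * p.b0 - r) x).Finite := by
    obtain ⟨N, hN⟩ := exists_low x
    refine (Set.finite_Icc (0 : ℤ) (b - B.pow * p.b0 + N)).subset fun r hr => ?_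
    have h1 : ¬ r < 0 := fun h => hr (by simp only [intCoeff_of_neg _ h, zero_smul])
    have h2 : ¬ (b - B.pow * p.b0 - r) + N ≤ 0 := fun h => hr (by
      simp only [normalCoeff_eq_zero A B hN (Or.inr h), smul_zero])
    simp only [Set.mem_Icc]
    omega
  rw [← Finsupp.lsingle_apply (R := ℂ), map_finsum _ hfin, smul_finsum' _, smul_finsum' _]
  · refine finsum_congr fun r => ?_
    rw [map_smul, normalOp, Finsupp.lsingle_apply, zpow_add₀ (q1Zeta_ne_zero hq hd u₁ u₂),
      mul_zpow, smul_smul, smul_smul, smul_smul]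
    rw [show a - A.pow * (p.b0 + B.shift) + r = a - A.pow * B.shift + r - A.pow * p.b0 by ring,
      sub_right_comm b]
    congr 1
    ring
  · obtain ⟨N, hN⟩ := normalOp_eq_zero (q := q) (d := d) u₁ u₂ A B p x
    refine (Set.finite_Icc (0 : ℤ) (b - N)).subset fun r hr => ?_
    have h1 : ¬ r < 0 := fun h => hr (by simp only [intCoeff_of_neg _ h, zero_smul])
    have h2 : ¬ b - r ≤ N := fun h => hr (by
      simp only [hN _ _ (Or.inr h), smul_zero])
    simp only [Set.mem_Icc]
    omega
  · refine hfin.subset fun r hr h0 => hr ?_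
    exact (congrArg (Finsupp.lsingle (R := ℂ) (p.shift (A.shift + B.shift))) h0).trans
      (map_zero _)

lemma finsum_vertexOp_vertexOp (hq : q ≠ 0) (hd : d ≠ 0) (h : Generic q d) (u₁ u₂ : ℂ) (φ : ℂ⟦X⟧)
    (A B : VertexExponent) (hA : A.base ≠ 0) (a b : ℤ) (p : Charge) (x : Osc) :
    ∑ᶠ l : ℕ, PowerSeries.coeff l φ • vertexOp q d u₁ u₂ A (a + l)
        (vertexOp q d u₁ u₂ B (b - l) (Finsupp.single p x)) =
      A.base ^ B.shift • ∑ᶠ m : ℤ, intCoeff (φ * contraction q d A B) m •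
        normalOp q d u₁ u₂ A B (a - A.pow * B.shift + m) (b - m) p x := by
  obtain ⟨N, hN⟩ := normalOp_eq_zero (q := q) (d := d) u₁ u₂ A B p x
  rw [← finsum_smul_finsum_smul φ (contraction q d A B)
    (fun m => normalOp q d u₁ u₂ A B (a - A.pow * B.shift + m) (b - m) p x)
    ⟨b - N, fun m hm => hN _ _ (Or.inr (by omega))⟩]
  rw [smul_finsum']
  · refine finsum_congr fun l => ?_
    rw [vertexOp_vertexOp hq hd h u₁ u₂ A B hA, smul_comm]
    congr 2
    refine finsum_congr fun r => ?_
    rw [show a + l - A.pow * B.shift + r = a - A.pow * B.shift + (l + r) by ring, sub_sub]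
  · refine (Set.finite_le_nat (b - N).toNat).subset fun l hl => ?_
    by_contra hlt
    have hlt : ¬ l ≤ (b - N).toNat := hlt
    refine hl ?_
    show _ • _ = _
    rw [finsum_eq_zero_of_forall_eq_zero, smul_zero]
    intro r
    rcases lt_or_ge r 0 with hr | hr
    · rw [intCoeff_of_neg _ hr, zero_smul]
    · rw [hN _ _ (Or.inr (by omega)), smul_zero]

/-- The delta function substitutes: the left side is the coefficient of `z ^ a w ^ b` in `δ(s w / z)
:A(z) B(w):`, which depends only on the restriction to `z = s w`. -/
lemma finsum_normalOp (hq : q ≠ 0) (h : Generic q d) (u₁ u₂ : ℂ) {s : ℂ} (hs : s ≠ 0)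
    (A B : VertexExponent) (a b : ℤ) (p : Charge) (x : Osc) :
    ∑ᶠ j : ℤ, s ^ j • normalOp q d u₁ u₂ A B (a + j) (b - j) p x =
      s ^ (-a) • vertexOp q d u₁ u₂ (normalProd (A.rescale s) B) (a + b) (Finsupp.single p x) := by
  rw [vertexOp_single]
  have e : a + b - (normalProd (A.rescale s) B).pow * p.b0 =
      (a - A.pow * p.b0) + (b - B.pow * p.b0) := by
    simp only [normalProd, rescale]
    ring
  rw [e, ← finsum_normalCoeff hq h hs, ← Finsupp.lsingle_apply (R := ℂ), map_finsum,
    smul_finsum', smul_finsum']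
  · refine finsum_congr fun j => ?_
    rw [map_smul, normalOp, Finsupp.lsingle_apply, smul_smul, smul_smul, smul_smul]
    rw [show a + j - A.pow * p.b0 = a - A.pow * p.b0 + j by ring, sub_right_comm b]
    simp only [normalProd, rescale]
    congr 1
    rw [mul_zpow, mul_zpow, mul_zpow, ← zpow_mul,
      show s ^ j = s ^ (-a) * (s ^ (A.pow * p.b0) * s ^ (a - A.pow * p.b0 + j)) by
        rw [← zpow_add₀ hs, ← zpow_add₀ hs]; congr 1; ring]
    ring
  all_goals
    obtain ⟨N, hN⟩ := exists_low x
    refine (Set.finite_Icc (A.pow * p.b0 - a - N) (b - B.pow * p.b0 + N)).subset fun j hj => ?_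
    have h1 : ¬ (a - A.pow * p.b0 + j + N ≤ 0 ∨ b - B.pow * p.b0 - j + N ≤ 0) := fun h => hj (by
      simp only [normalCoeff_eq_zero A B hN h, smul_zero, map_zero])
    simp only [Set.mem_Icc]
    omega

/-- Two vertex operators whose two orderings are expansions of a rational function with at most
simple poles at `z = s₁ w` and `z = s₂ w` satisfy an exchange relation with delta functions. -/
lemma exchangeRelation_vertexOp (hq : q ≠ 0) (hd : d ≠ 0) (h : Generic q d) (u₁ u₂ : ℂ)
    {c : ℂ} {φ ψ : ℂ⟦X⟧} (A B : VertexExponent) (hA : A.base ≠ 0) (hB : B.base ≠ 0) {e : ℤ}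
    (he : A.pow * B.shift = e) (he' : B.pow * A.shift = e) {α₁ α₂ s₁ s₂ : ℂ} (hs₁ : s₁ ≠ 0)
    (hs₂ : s₂ ≠ 0)
    (hρ : ∀ j : ℤ, c * A.base ^ B.shift * intCoeff (φ * contraction q d A B) (j + e)
      - B.base ^ A.shift * intCoeff (ψ * contraction q d B A) (-j) =
        α₁ * s₁ ^ j + α₂ * s₂ ^ j) :
    ExchangeRelation c φ ψ (vertexOp q d u₁ u₂ A) (vertexOp q d u₁ u₂ B) (fun a b =>
      α₁ • s₁ ^ (-a) • vertexOp q d u₁ u₂ (normalProd (A.rescale s₁) B) (a + b - e) +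
      α₂ • s₂ ^ (-a) • vertexOp q d u₁ u₂ (normalProd (A.rescale s₂) B) (a + b - e)) := by
  refine ExchangeRelation.of_single (isTruncated_vertexOp _ _ _ _ _)
    (isTruncated_vertexOp _ _ _ _ _) fun a b p x => ?_
  -- Both orders are written over this one family, with `m = j + e` for `A(z)B(w)` and `m = -j` for
  -- `B(w)A(z)`. The equality of the two zero-mode exponents (`he`, `he'`) makes the families agree,
  -- so the identity reduces to `hρ` coefficient by coefficient.
  let H : ℤ → Fock := fun j => normalOp q d u₁ u₂ A B (a + j) (b - e - j) p x
  have hH : ∀ g : ℤ → ℂ, (Function.support fun j => g j • H j).Finite := fun g => by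
    obtain ⟨N, hN⟩ := normalOp_eq_zero (q := q) (d := d) u₁ u₂ A B p x
    refine (Set.finite_Icc (N - a) (b - e - N)).subset fun j hj => ?_
    have h1 : ¬ (a + j ≤ N ∨ b - e - j ≤ N) := fun h => hj (by
      simp only [H, hN _ _ h, smul_zero])
    simp only [Set.mem_Icc]
    omega
  have h1 : ∑ᶠ l : ℕ, PowerSeries.coeff l φ • vertexOp q d u₁ u₂ A (a + l)
        (vertexOp q d u₁ u₂ B (b - l) (Finsupp.single p x)) =
      A.base ^ B.shift • ∑ᶠ j : ℤ, intCoeff (φ * contraction q d A B) (j + e) • H j := by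
    rw [finsum_vertexOp_vertexOp hq hd h u₁ u₂ φ A B hA, ← finsum_comp_equiv (Equiv.addRight e)]
    refine congrArg (A.base ^ B.shift • ·) (finsum_congr fun j => ?_)
    simp only [Equiv.coe_addRight, H]
    rw [he, show a - e + (j + e) = a + j by ring, show b - (j + e) = b - e - j by ring]
  have h2 : ∑ᶠ l : ℕ, PowerSeries.coeff l ψ • vertexOp q d u₁ u₂ B (b + l)
        (vertexOp q d u₁ u₂ A (a - l) (Finsupp.single p x)) =
      B.base ^ A.shift • ∑ᶠ j : ℤ, intCoeff (ψ * contraction q d B A) (-j) • H j := by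
    rw [finsum_vertexOp_vertexOp hq hd h u₁ u₂ ψ B A hB, ← finsum_comp_equiv (Equiv.neg ℤ)]
    refine congrArg (B.base ^ A.shift • ·) (finsum_congr fun j => ?_)
    simp only [Equiv.neg_apply, H]
    rw [he', normalOp_comm hq h, show a - -j = a + j by ring,
      show b - e + -j = b - e - j by ring]
  have h3 : ∀ s : ℂ, s ≠ 0 → ∑ᶠ j : ℤ, s ^ j • H j =
      s ^ (-a) • vertexOp q d u₁ u₂ (normalProd (A.rescale s) B) (a + b - e)
        (Finsupp.single p x) := fun s hs => by
    rw [finsum_normalOp hq h u₁ u₂ hs, add_sub_assoc]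
  rw [h1, h2, LinearMap.add_apply, LinearMap.smul_apply, LinearMap.smul_apply,
    LinearMap.smul_apply, LinearMap.smul_apply, ← h3 s₁ hs₁, ← h3 s₂ hs₂, smul_smul]
  rw [smul_finsum' _ (hH _), smul_finsum' _ (hH _), smul_finsum' _ (hH _), smul_finsum' _ (hH _)]
  simp only [smul_smul]
  rw [← finsum_sub_distrib (hH _) (hH _), ← finsum_add_distrib (hH _) (hH _)]
  refine finsum_congr fun j => ?_
  rw [← sub_smul, ← add_smul, hρ]

/-! ### Scalar exponentials -/

/-- `exp (∑_{n ≥ 1} tₙ Xⁿ / n)`. -/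
def expSer (t : ℕ → ℂ) : ℂ⟦X⟧ := psExp (PowerSeries.mk fun n : ℕ => if n = 0 then 0 else t n / n)

lemma expSer_add (t u : ℕ → ℂ) : expSer (fun n => t n + u n) = expSer t * expSer u := by
  rw [expSer, expSer, expSer, ← psExp_add (by simp) (by simp) (fun _ _ => Commute.all _ _)
    (fun _ _ => Commute.all _ _) (fun _ _ => Commute.all _ _)]
  congr 1
  ext n
  rw [map_add, PowerSeries.coeff_mk, PowerSeries.coeff_mk, PowerSeries.coeff_mk]
  split_ifs
  · simp
  · rw [add_div]

lemma euler_log (t : ℕ → ℂ) :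
    euler (PowerSeries.mk fun n : ℕ => if n = 0 then 0 else t n / (n : ℂ)) =
      PowerSeries.mk fun n : ℕ => if n = 0 then 0 else t n := by
  ext n
  rw [coeff_euler, PowerSeries.coeff_mk, PowerSeries.coeff_mk]
  split_ifs with hn
  · simp
  · have : (n : ℂ) ≠ 0 := by exact_mod_cast hn
    rw [smul_eq_mul, mul_div_cancel₀ _ this]

lemma expSer_zero : expSer (fun _ => 0) = 1 := by
  rw [expSer]
  refine psExp_unique (by simp) (fun _ _ => Commute.all _ _) (by simp) ?_
  rw [euler_log]
  ext n
  simp [PowerSeries.coeff_one]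

/-- The logarithmic series, verified through the differential equation. Together with `expSer_add`
it turns exponents that are signed sums of `n`-th powers into rational functions. -/
lemma expSer_neg_pow (p : ℂ) : expSer (fun n => -p ^ n) = 1 - PowerSeries.C p * PowerSeries.X := by
  rw [expSer]
  refine psExp_unique (by simp) (fun _ _ => Commute.all _ _) (by simp) ?_
  rw [euler_log, mul_sub, mul_one, mul_left_comm]
  ext n
  rw [coeff_euler, map_sub, map_sub, PowerSeries.coeff_C_mul, PowerSeries.coeff_C_mul]
  rcases n with _ | _ | n
  · simp
  · simp [PowerSeries.coeff_succ_mul_X, PowerSeries.coeff_one, PowerSeries.coeff_X]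
  · simp [PowerSeries.coeff_succ_mul_X, PowerSeries.coeff_one, PowerSeries.coeff_X]
    ring

lemma mk_pow_mul (p : ℂ) :
    (PowerSeries.mk fun n => p ^ n) * (1 - PowerSeries.C p * PowerSeries.X) = 1 := by
  rw [mul_sub, mul_one, mul_left_comm]
  ext n
  rw [map_sub, PowerSeries.coeff_C_mul]
  rcases n with _ | n
  · simp
  · simp [PowerSeries.coeff_succ_mul_X, PowerSeries.coeff_one]
    ring

lemma expSer_pow (p : ℂ) : expSer (fun n => p ^ n) = PowerSeries.mk fun n => p ^ n := by
  have h : expSer (fun n => p ^ n) * (1 - PowerSeries.C p * PowerSeries.X) = 1 := by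
    rw [← expSer_neg_pow, ← expSer_add]
    simpa using expSer_zero
  have := mk_pow_mul p
  calc _ = expSer (fun n => p ^ n) * ((PowerSeries.mk fun n => p ^ n) *
        (1 - PowerSeries.C p * PowerSeries.X)) := by rw [this, mul_one]
    _ = _ := by rw [mul_left_comm, h, mul_one]

lemma rescale_expSer (a : ℂ) (t : ℕ → ℂ) :
    PowerSeries.rescale a (expSer t) = expSer fun n => a ^ n * t n := by
  ext n
  rw [PowerSeries.coeff_rescale, ← smul_eq_mul]
  refine (coeff_psExp_scale a (by simp) (fun _ _ => Commute.all _ _) (fun n => ?_) n).symm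
  rw [PowerSeries.coeff_mk, PowerSeries.coeff_mk]
  split_ifs
  · simp
  · rw [smul_eq_mul, mul_div_assoc]

/-- The coefficient of `[w_n]` in the structure function: `(q₁ⁿ + q₃ⁿ) / (1 + q₂⁻ⁿ)`. -/
def structCoeff (q d : ℂ) (n : ℕ) : ℂ := (q1 q d ^ n + q3 q d ^ n) / (1 + (q2 q ^ n)⁻¹)

lemma fSer_eq (q d ξ : ℂ) : fSer q d ξ = expSer fun n => ξ ^ n - structCoeff q d n := rfl

/-! ### Expansions of rational functions at zero and infinity -/

/-- A constant has the same expansion at zero and at infinity. -/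
lemma intCoeff_expansion_one (μ ν : ℂ) (h : μ = ν) (j : ℤ) :
    μ * intCoeff (expSer fun _ => 0) j - ν * intCoeff (expSer fun _ => 0) (-j) = 0 := by
  rw [expSer_zero, h]
  obtain ⟨n, rfl | rfl⟩ := j.eq_nat_or_neg
  · rcases n with _ | n
    · simp
    · rw [intCoeff_natCast, intCoeff_of_neg _ (by omega)]
      simp [PowerSeries.coeff_one]
  · rcases n with _ | n
    · simp
    · rw [neg_neg, intCoeff_natCast, intCoeff_of_neg _ (by omega)]
      simp [PowerSeries.coeff_one]

lemma coeff_expSer_sub (p r : ℂ) (n : ℕ) :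
    PowerSeries.coeff (n + 1) (expSer fun n => p ^ n - r ^ n) = p ^ (n + 1) - r * p ^ n := by
  simp only [sub_eq_add_neg]
  rw [expSer_add (fun n => p ^ n) (fun n => -r ^ n), expSer_pow, expSer_neg_pow, mul_sub, mul_one,
    mul_left_comm, map_sub, PowerSeries.coeff_C_mul, PowerSeries.coeff_succ_mul_X,
    PowerSeries.coeff_mk, PowerSeries.coeff_mk, sub_eq_add_neg]

lemma coeff_zero_expSer (t : ℕ → ℂ) : PowerSeries.coeff 0 (expSer t) = 1 := coeff_zero_psExp _

/-- The function is `μ(1 - r x)/(1 - p x)`. Its value at infinity is `ν = μ r / p`, and the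
difference of the two expansions is `(μ - ν) δ(p x)`. -/
lemma intCoeff_expansion_simple {μ ν p r α : ℂ} (hp : p ≠ 0) (hr : r ≠ 0) (h0 : μ - ν = α)
    (h1 : μ * r = ν * p) (j : ℤ) :
    μ * intCoeff (expSer fun n => p ^ n - r ^ n) j
      - ν * intCoeff (expSer fun n => p⁻¹ ^ n - r⁻¹ ^ n) (-j) = α * p ^ j := by
  obtain ⟨n, rfl | rfl⟩ := j.eq_nat_or_neg
  · rcases n with _ | n
    · have h2 : ((0 : ℕ) : ℤ) = 0 := rfl
      have h3 : (-((0 : ℕ) : ℤ)) = ((0 : ℕ) : ℤ) := rfl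
      rw [h3, intCoeff_natCast, intCoeff_natCast, coeff_zero_expSer, coeff_zero_expSer, h2,
        zpow_zero]
      linear_combination h0
    · rw [intCoeff_natCast, intCoeff_of_neg _ (by omega), coeff_expSer_sub, zpow_natCast]
      linear_combination -p ^ n * h1 + p ^ (n + 1) * h0
  · rcases n with _ | n
    · have h2 : (-((0 : ℕ) : ℤ)) = 0 := rfl
      have h3 : (-(0 : ℤ)) = ((0 : ℕ) : ℤ) := rfl
      have h4 : (0 : ℤ) = ((0 : ℕ) : ℤ) := rfl
      rw [h2, zpow_zero, h3, h4, intCoeff_natCast, intCoeff_natCast, coeff_zero_expSer,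
        coeff_zero_expSer]
      linear_combination h0
    · rw [neg_neg, intCoeff_natCast, intCoeff_of_neg _ (by omega), coeff_expSer_sub, zpow_neg,
        zpow_natCast, ← inv_pow, pow_succ]
      have h5 : ν * r⁻¹ = μ * p⁻¹ := by
        field_simp
        linear_combination -h1
      linear_combination p⁻¹ ^ n * h5 + p⁻¹ ^ n * p⁻¹ * h0

lemma coeff_expSer_add {s₁ s₂ : ℂ} (h : s₁ ≠ s₂) (n : ℕ) :
    PowerSeries.coeff n (expSer fun n => s₁ ^ n + s₂ ^ n) =
      (s₁ ^ (n + 1) - s₂ ^ (n + 1)) / (s₁ - s₂) := by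
  rw [expSer_add, expSer_pow, expSer_pow, PowerSeries.coeff_mul,
    Finset.Nat.sum_antidiagonal_eq_sum_range_succ (fun i j =>
      PowerSeries.coeff i (PowerSeries.mk fun n => s₁ ^ n) *
        PowerSeries.coeff j (PowerSeries.mk fun n => s₂ ^ n)), eq_div_iff (sub_ne_zero.2 h),
    ← (Commute.all s₁ s₂).geom_sum₂_mul]
  simp

/-- The function is `μ x²/((1 - s₁x)(1 - s₂x))`, with value `ν = μ/(s₁s₂)` at infinity; the
coefficients on the right come from partial fractions. -/
lemma intCoeff_expansion_double {μ ν s₁ s₂ : ℂ} (h1 : s₁ ≠ 0) (h2 : s₂ ≠ 0) (h : s₁ ≠ s₂)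
    (hμ : μ = ν * s₁ * s₂) (j : ℤ) :
    μ * intCoeff (expSer fun n => s₁ ^ n + s₂ ^ n) (j + -2)
      - ν * intCoeff (expSer fun n => s₁⁻¹ ^ n + s₂⁻¹ ^ n) (-j) =
        (ν * s₂ / (s₁ - s₂)) * s₁ ^ j + (-(ν * s₁ / (s₁ - s₂))) * s₂ ^ j := by
  have hs : s₁ - s₂ ≠ 0 := sub_ne_zero.2 h
  have hi : s₁⁻¹ ≠ s₂⁻¹ := fun h' => h (inv_injective h')
  have hi' : s₂ - s₁ ≠ 0 := sub_ne_zero.2 h.symm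
  rcases lt_or_ge 0 j with hj | hj
  · rw [intCoeff_of_neg _ (by omega : -j < 0)]
    obtain ⟨n, rfl⟩ : ∃ n : ℕ, j = n + 1 := ⟨(j - 1).toNat, by omega⟩
    rcases n with _ | n
    · rw [intCoeff_of_neg _ (by omega)]
      simp
      field_simp
      ring
    · rw [show ((n + 1 : ℕ) : ℤ) + 1 + -2 = (n : ℤ) by push_cast; ring, intCoeff_natCast,
        coeff_expSer_add h, hμ]
      norm_cast
      rw [pow_succ s₁ (n + 1), pow_succ s₂ (n + 1)]
      field_simp
      ring
  · obtain ⟨n, rfl⟩ : ∃ n : ℕ, j = -(n : ℤ) := ⟨(-j).toNat, by omega⟩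
    rw [intCoeff_of_neg _ (by omega : -(n : ℤ) + -2 < 0), neg_neg, intCoeff_natCast,
      coeff_expSer_add hi, zpow_neg, zpow_neg, zpow_natCast, zpow_natCast, inv_pow, inv_pow]
    have hii : s₁⁻¹ - s₂⁻¹ = -(s₁ - s₂) / (s₁ * s₂) := by
      field_simp
      ring
    rw [hii]
    field_simp
    ring

/-- The function is the Laurent polynomial `μ x⁻²(1 - r₁x)(1 - r₂x)`, which has no pole away from
zero and infinity and so gives no delta function. -/
lemma intCoeff_expansion_poly {μ ν r₁ r₂ : ℂ} (h1 : r₁ ≠ 0) (h2 : r₂ ≠ 0)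
    (hμ : μ * r₁ * r₂ = ν) (j : ℤ) :
    μ * intCoeff (expSer fun n => -r₁ ^ n + -r₂ ^ n) (j + 2)
      - ν * intCoeff (expSer fun n => -r₁⁻¹ ^ n + -r₂⁻¹ ^ n) (-j) = 0 := by
  have hE : ∀ r s : ℂ, (expSer fun n => -r ^ n + -s ^ n) =
      PowerSeries.mk fun n => if n = 0 then 1 else if n = 1 then -(r + s) else
        if n = 2 then r * s else 0 := fun r s => by
    rw [expSer_add, expSer_neg_pow, expSer_neg_pow]
    have : (1 - PowerSeries.C r * PowerSeries.X) * (1 - PowerSeries.C s * PowerSeries.X) =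
        1 - PowerSeries.C (r + s) * PowerSeries.X +
          PowerSeries.C (r * s) * PowerSeries.X ^ 2 := by
      rw [map_add, map_mul]
      ring
    rw [this]
    ext n
    rw [map_add, map_sub, PowerSeries.coeff_C_mul, PowerSeries.coeff_C_mul, PowerSeries.coeff_one,
      PowerSeries.coeff_X, PowerSeries.coeff_X_pow, PowerSeries.coeff_mk]
    rcases n with _ | _ | _ | n <;> simp
  rw [hE, hE]
  have hc : ∀ (r s : ℂ) (i : ℤ), intCoeff (PowerSeries.mk fun n => if n = 0 then 1 else
      if n = 1 then -(r + s) else if n = 2 then r * s else 0) i =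
        if i = 0 then 1 else if i = 1 then -(r + s) else if i = 2 then r * s else 0 :=
      fun r s i => by
    rcases lt_or_ge i 0 with hi | hi
    · rw [intCoeff_of_neg _ hi, if_neg (by omega), if_neg (by omega), if_neg (by omega)]
    · lift i to ℕ using hi
      rw [intCoeff_natCast, PowerSeries.coeff_mk]
      norm_cast
  rw [hc, hc]
  by_cases j0 : j = 0
  · subst j0
    simp
    linear_combination hμ
  by_cases j1 : j = -1
  · subst j1
    simp
    rw [← hμ]
    field_simp
    ring
  by_cases j2 : j = -2
  · subst j2
    simp
    rw [← hμ]
    field_simp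
    ring
  rw [if_neg (by omega), if_neg (by omega), if_neg (by omega), if_neg (by omega),
    if_neg (by omega), if_neg (by omega)]
  ring

/-! ### Contractions of the generators -/

/-- The exponent of `:Λ_1^ε(ξ z) Λ_2^ε'(z):`. -/
def pairExp (q ξ : ℂ) (ε ε' : ℤ) : VertexExponent :=
  normalProd ((lambdaExp q ε 0).rescale ξ) (lambdaExp q ε' 1)

lemma contraction_eq_expSer {q d : ℂ} {A B : VertexExponent} {t : ℕ → ℂ}
    (h : ∀ n : ℕ, n ≠ 0 → n * (∑ i : Fin 2, ∑ j : Fin 2,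
      A.osc i (n : ℤ) * B.osc j (-(n : ℤ)) * bosonComm q d i j n) = t n) :
    contraction q d A B = expSer t := by
  rw [contraction, expSer, contractionLog]
  congr 1
  ext n
  rw [PowerSeries.coeff_mk, PowerSeries.coeff_mk]
  split_ifs with hn
  · rfl
  · have hn' : (n : ℂ) ≠ 0 := by exact_mod_cast hn
    rw [← h n hn, mul_div_cancel_left₀ _ hn']

variable {q d ξ : ℂ}

lemma zpow_sub_pow (hq : q ≠ 0) (a b : ℤ) (n : ℕ) :
    (q ^ (a - b)) ^ n = q ^ (a * (n : ℤ)) * q ^ (b * -(n : ℤ)) := by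
  rw [← zpow_natCast, ← zpow_mul, ← zpow_add₀ hq]
  congr 1
  ring

/-- The factor of the pair with the same index contributes a pure `n`-th power, the factor with the
other index contributes `structCoeff` with the opposite sign. -/
lemma contraction_lambda_pair_zero (hq : q ≠ 0) (η ε ε' : ℤ) :
    contraction q d (lambdaExp q η 0) (pairExp q ξ ε ε') = expSer fun n =>
      -(η * ε) * ((q ^ (η - ε)) ^ n * ξ ^ n) +
        (η * ε') * ((q ^ (η - ε')) ^ n * structCoeff q d n) := by
  refine contraction_eq_expSer fun n hn => ?_
  have hn' : (n : ℂ) ≠ 0 := by exact_mod_cast hn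
  have hb : ∀ i j, bosonComm q d i j n = if i = j then (n : ℂ) else -(n * structCoeff q d n) :=
    fun _ _ => rfl
  simp only [Fin.sum_univ_two, pairExp, normalProd, rescale, lambdaExp, hb, zpow_sub_pow hq]
  simp
  field_simp

lemma contraction_pair_lambda_zero (hq : q ≠ 0) (η ε ε' : ℤ) :
    contraction q d (pairExp q ξ ε ε') (lambdaExp q η 0) = expSer fun n =>
      -(η * ε) * ((q ^ (ε - η)) ^ n * ξ⁻¹ ^ n) +
        (η * ε') * ((q ^ (ε' - η)) ^ n * structCoeff q d n) := by
  refine contraction_eq_expSer fun n hn => ?_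
  have hn' : (n : ℂ) ≠ 0 := by exact_mod_cast hn
  have hb : ∀ i j, bosonComm q d i j n = if i = j then (n : ℂ) else -(n * structCoeff q d n) :=
    fun _ _ => rfl
  simp only [Fin.sum_univ_two, pairExp, normalProd, rescale, lambdaExp, hb, zpow_sub_pow hq]
  simp
  field_simp

lemma contraction_lambda_pair_one (hq : q ≠ 0) (η ε ε' : ℤ) :
    contraction q d (lambdaExp q η 1) (pairExp q ξ ε ε') = expSer fun n =>
      (η * ε) * ((q ^ (η - ε)) ^ n * ξ ^ n * structCoeff q d n) -
        (η * ε') * (q ^ (η - ε')) ^ n := by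
  refine contraction_eq_expSer fun n hn => ?_
  have hn' : (n : ℂ) ≠ 0 := by exact_mod_cast hn
  have hb : ∀ i j, bosonComm q d i j n = if i = j then (n : ℂ) else -(n * structCoeff q d n) :=
    fun _ _ => rfl
  simp only [Fin.sum_univ_two, pairExp, normalProd, rescale, lambdaExp, hb, zpow_sub_pow hq]
  simp
  field_simp
  ring

lemma contraction_pair_lambda_one (hq : q ≠ 0) (η ε ε' : ℤ) :
    contraction q d (pairExp q ξ ε ε') (lambdaExp q η 1) = expSer fun n =>
      (η * ε) * ((q ^ (ε - η)) ^ n * ξ⁻¹ ^ n * structCoeff q d n) -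
        (η * ε') * (q ^ (ε' - η)) ^ n := by
  refine contraction_eq_expSer fun n hn => ?_
  have hn' : (n : ℂ) ≠ 0 := by exact_mod_cast hn
  have hb : ∀ i j, bosonComm q d i j n = if i = j then (n : ℂ) else -(n * structCoeff q d n) :=
    fun _ _ => rfl
  simp only [Fin.sum_univ_two, pairExp, normalProd, rescale, lambdaExp, hb, zpow_sub_pow hq]
  simp
  field_simp
  ring

lemma lambdaExp_base {ε : ℤ} (hε : ε * ε = 1) (q : ℂ) (i : Fin 2) :
    (lambdaExp q ε i).base = q ^ (-chargeSign i) := by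
  have : -ε * (ε * chargeSign i) = -chargeSign i := by linear_combination -chargeSign i * hε
  rw [lambdaExp, ← zpow_mul, this]

/-- The bases `q⁻¹` and `q` of the two factors do not depend on the signs and cancel; only the
rescaling `ξ ^ pow` is left. -/
lemma pairExp_base (hq : q ≠ 0) {ε ε' : ℤ} (hε : ε * ε = 1) (hε' : ε' * ε' = 1) :
    (pairExp q ξ ε ε').base = ξ ^ ε := by
  rw [pairExp, normalProd]
  simp only
  rw [rescale, lambdaExp_base hε']
  simp only
  rw [lambdaExp_base hε]
  simp [chargeSign, lambdaExp]
  field_simp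

lemma oscCoeff_rescale (hq : q ≠ 0) (h : Generic q d) (hξ : ξ ≠ 0) (A : VertexExponent) (j : ℤ)
    (x : Osc) : (A.rescale ξ).oscCoeff q d j x = ξ ^ j • A.oscCoeff q d j x := by
  rw [oscCoeff_apply, oscCoeff_apply, smul_finsum' _ (cre_ann_finite A _ x)]
  refine finsum_congr fun k => ?_
  have h1 : ∀ k, (A.rescale ξ).cre q d k = ξ ^ k • A.cre q d k := fun k => by
    rw [cre, cre, intCoeff, intCoeff]
    split_ifs with hk
    · lift k to ℕ using hk
      rw [coeff_creation_rescale hq h, Int.toNat_natCast, zpow_natCast]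
    · rw [smul_zero]
  have h2 : ∀ k, (A.rescale ξ).ann q d k = ξ ^ (-k) • A.ann q d k := fun k => by
    rw [ann, ann, intCoeff, intCoeff]
    split_ifs with hk
    · lift k to ℕ using hk
      rw [coeff_annihilation_rescale hq h, Int.toNat_natCast, zpow_neg, zpow_natCast, inv_pow]
    · rw [smul_zero]
  rw [h1, h2, LinearMap.smul_apply, LinearMap.smul_apply, map_smul, smul_smul, ← zpow_add₀ hξ,
    add_neg_cancel_right]

/-- The zero mode supplies `ξ ^ (pow * b0)` and the oscillators the remaining power. This identifies
the surviving residue in the second relation with `W₁(ξw)`. -/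
lemma vertexOp_rescale (hq : q ≠ 0) (h : Generic q d) (hξ : ξ ≠ 0) (u₁ u₂ : ℂ)
    (A : VertexExponent) (m : ℤ) :
    vertexOp q d u₁ u₂ (A.rescale ξ) m = ξ ^ m • vertexOp q d u₁ u₂ A m := by
  refine Finsupp.lhom_ext fun p x => ?_
  rw [LinearMap.smul_apply, vertexOp_single, vertexOp_single, oscCoeff_rescale hq h hξ,
    ← Finsupp.smul_single, smul_smul, smul_smul]
  simp only [rescale]
  rw [mul_zpow, ← zpow_mul, show ξ ^ m = ξ ^ (A.pow * p.b0) * ξ ^ (m - A.pow * p.b0) by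
    rw [← zpow_add₀ hξ]; congr 1; ring]
  congr 1
  ring

/-! ### Identities between normal-ordered products -/

namespace VertexExponent

lemma ext_fields {A B : VertexExponent} (h1 : ∀ i n, A.osc i n = B.osc i n)
    (h2 : A.shift = B.shift) (h3 : A.base = B.base) (h4 : A.pow = B.pow) (h5 : A.zeta = B.zeta) :
    A = B := by
  obtain ⟨_, _, _, _, _⟩ := A
  obtain ⟨_, _, _, _, _⟩ := B
  simp only at h1 h2 h3 h4 h5
  obtain rfl := funext fun i => funext (h1 i)
  subst h2 h3 h4 h5
  rfl

lemma normalProd_comm (A B : VertexExponent) : normalProd A B = normalProd B A :=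
  ext_fields (fun _ _ => add_comm _ _) (add_comm _ _) (mul_comm _ _) (add_comm _ _) (add_comm _ _)

lemma normalProd_left_comm (A B C : VertexExponent) :
    normalProd A (normalProd B C) = normalProd B (normalProd A C) :=
  ext_fields (fun _ _ => add_left_comm _ _ _) (add_left_comm _ _ _) (mul_left_comm _ _ _)
    (add_left_comm _ _ _) (add_left_comm _ _ _)

lemma rescale_one (A : VertexExponent) : A.rescale 1 = A :=
  ext_fields (fun _ _ => by simp [rescale]) rfl (by simp [rescale]) rfl rfl

end VertexExponent

variable {q d ξ : ℂ}

/-- `Λ_i^{-η}` at `q^{-2η}ξz` is inverse to `Λ_i^η` at `ξz` under normal ordering: the shift of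
argument turns `q^{-ηn}` into `q^{ηn}`. This collapses a residue to a single vertex operator. -/
lemma normalProd_lambda_cancel (hq : q ≠ 0) (hξ : ξ ≠ 0) {η : ℤ} (hη : η * η = 1) (i : Fin 2)
    {p : ℂ} (hp : p = q ^ (-2 * η) * ξ) (C : VertexExponent) :
    normalProd ((lambdaExp q (-η) i).rescale p)
      (normalProd ((lambdaExp q η i).rescale ξ) C) = C := by
  have hη' : -η * -η = 1 := by rw [neg_mul_neg, hη]
  refine ext_fields (fun j n => ?_) ?_ ?_ ?_ ?_
  · simp only [normalProd, rescale, lambdaExp]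
    rw [← add_assoc, add_eq_right]
    split_ifs
    · have h1 : q ^ (η * n) = q ^ (-η * n) * (q ^ (-2 * η)) ^ (-n) := by
        rw [← zpow_mul, ← zpow_add₀ hq]
        congr 1
        ring
      rw [hp, mul_zpow, h1]
      push_cast
      ring
    · ring
  · simp only [normalProd, rescale, lambdaExp]
    ring
  · have e1 : ∀ (A B : VertexExponent), (normalProd A B).base = A.base * B.base := fun _ _ => rfl
    have e2 : ∀ (A : VertexExponent) (c : ℂ), (A.rescale c).base = A.base * c ^ A.pow :=
      fun _ _ => rfl
    have e3 : ∀ ε : ℤ, (lambdaExp q ε i).pow = ε * chargeSign i := fun _ => rfl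
    rw [e1, e1, e2, e2, lambdaExp_base hη, lambdaExp_base hη', e3, e3, hp, mul_zpow, ← zpow_mul]
    have h1 : -2 * η * (-η * chargeSign i) = chargeSign i + chargeSign i := by
      linear_combination 2 * chargeSign i * hη
    have h2 : -η * chargeSign i = -(η * chargeSign i) := by ring
    have h3 : q ^ chargeSign i ≠ 0 := zpow_ne_zero _ hq
    have h4 : ξ ^ (η * chargeSign i) ≠ 0 := zpow_ne_zero _ hξ
    rw [h1, h2, zpow_add₀ hq, zpow_neg, zpow_neg]
    field_simp
  · simp only [normalProd, rescale, lambdaExp]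
    ring
  · simp only [normalProd, rescale, lambdaExp]
    ring

/-! ### Exchange relations of the generators with normal-ordered pairs -/

/-- All operator content is removed: `ht` and `hu` simplify the exponents of structure function
times contraction in the two orders, and `hρ` compares the resulting expansions. -/
lemma exchangeRelation_lambda_pair_zero (hq : q ≠ 0) (hd : d ≠ 0) (h : Generic q d) (u₁ u₂ : ℂ)
    (hξ : ξ ≠ 0) {η ε ε' e : ℤ} (hη : η * η = 1) (hε : ε * ε = 1) (hε' : ε' * ε' = 1)
    (he : η * (ε - ε') = e) {t u : ℕ → ℂ} {α₁ α₂ s₁ s₂ : ℂ} (hs₁ : s₁ ≠ 0) (hs₂ : s₂ ≠ 0)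
    (ht : ∀ n : ℕ, ξ ^ n - structCoeff q d n + (-(η * ε) * ((q ^ (η - ε)) ^ n * ξ ^ n) +
      (η * ε') * ((q ^ (η - ε')) ^ n * structCoeff q d n)) = t n)
    (hu : ∀ n : ℕ, ξ⁻¹ ^ n - structCoeff q d n + (-(η * ε) * ((q ^ (ε - η)) ^ n * ξ⁻¹ ^ n) +
      (η * ε') * ((q ^ (ε' - η)) ^ n * structCoeff q d n)) = u n)
    (hρ : ∀ j : ℤ, ξ * q ^ (ε' - ε) * intCoeff (expSer t) (j + e)
      - ξ ^ (ε * η) * intCoeff (expSer u) (-j) = α₁ * s₁ ^ j + α₂ * s₂ ^ j) :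
    ExchangeRelation ξ (fSer q d ξ) (fSer q d ξ⁻¹) (vertexOp q d u₁ u₂ (lambdaExp q η 0))
      (vertexOp q d u₁ u₂ (pairExp q ξ ε ε')) (fun a b =>
        α₁ • s₁ ^ (-a) • vertexOp q d u₁ u₂
          (normalProd ((lambdaExp q η 0).rescale s₁) (pairExp q ξ ε ε')) (a + b - e) +
        α₂ • s₂ ^ (-a) • vertexOp q d u₁ u₂
          (normalProd ((lambdaExp q η 0).rescale s₂) (pairExp q ξ ε ε')) (a + b - e)) := by
  have e1 : (pairExp q ξ ε ε').shift = ε - ε' := by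
    simp [pairExp, normalProd, rescale, lambdaExp, chargeSign, sub_eq_add_neg]
  have e2 : (pairExp q ξ ε ε').pow = ε - ε' := by
    simp [pairExp, normalProd, rescale, lambdaExp, chargeSign, sub_eq_add_neg]
  have e3 : (lambdaExp q η 0).shift = η := by simp [lambdaExp, chargeSign]
  have e4 : (lambdaExp q η 0).pow = η := by simp [lambdaExp, chargeSign]
  have e5 : (lambdaExp q η 0).base = q ^ (-1 : ℤ) := by
    rw [lambdaExp_base hη]; simp [chargeSign]
  have e6 := pairExp_base (ξ := ξ) hq hε hε'
  refine exchangeRelation_vertexOp hq hd h u₁ u₂ _ _ (by rw [e5]; exact zpow_ne_zero _ hq)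
    (by rw [e6]; exact zpow_ne_zero _ hξ) (by rw [e1, e4, he])
    (by rw [e2, e3, mul_comm, he]) hs₁ hs₂ fun j => ?_
  rw [← hρ, e1, e3, e5, e6, ← zpow_mul, ← zpow_mul, contraction_lambda_pair_zero hq,
    contraction_pair_lambda_zero hq, fSer_eq, fSer_eq, ← expSer_add, ← expSer_add,
    funext ht, funext hu, show -1 * (ε - ε') = ε' - ε by ring]

lemma exchangeRelation_lambda_pair_one (hq : q ≠ 0) (hd : d ≠ 0) (h : Generic q d) (u₁ u₂ : ℂ)
    (hξ : ξ ≠ 0) {η ε ε' e : ℤ} (hη : η * η = 1) (hε : ε * ε = 1) (hε' : ε' * ε' = 1)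
    (he : -(η * (ε - ε')) = e) {t u : ℕ → ℂ} {α₁ α₂ s₁ s₂ : ℂ} (hs₁ : s₁ ≠ 0) (hs₂ : s₂ ≠ 0)
    (ht : ∀ n : ℕ, ξ ^ n * (ξ⁻¹ ^ n - structCoeff q d n) +
      ((η * ε) * ((q ^ (η - ε)) ^ n * ξ ^ n * structCoeff q d n) -
        (η * ε') * (q ^ (η - ε')) ^ n) = t n)
    (hu : ∀ n : ℕ, ξ⁻¹ ^ n * (ξ ^ n - structCoeff q d n) +
      ((η * ε) * ((q ^ (ε - η)) ^ n * ξ⁻¹ ^ n * structCoeff q d n) -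
        (η * ε') * (q ^ (ε' - η)) ^ n) = u n)
    (hρ : ∀ j : ℤ, ξ⁻¹ * q ^ (ε - ε') * intCoeff (expSer t) (j + e)
      - ξ ^ (-(ε * η)) * intCoeff (expSer u) (-j) = α₁ * s₁ ^ j + α₂ * s₂ ^ j) :
    ExchangeRelation ξ⁻¹ (PowerSeries.rescale ξ (fSer q d ξ⁻¹))
      (PowerSeries.rescale ξ⁻¹ (fSer q d ξ)) (vertexOp q d u₁ u₂ (lambdaExp q η 1))
      (vertexOp q d u₁ u₂ (pairExp q ξ ε ε')) (fun a b =>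
        α₁ • s₁ ^ (-a) • vertexOp q d u₁ u₂
          (normalProd ((lambdaExp q η 1).rescale s₁) (pairExp q ξ ε ε')) (a + b - e) +
        α₂ • s₂ ^ (-a) • vertexOp q d u₁ u₂
          (normalProd ((lambdaExp q η 1).rescale s₂) (pairExp q ξ ε ε')) (a + b - e)) := by
  have e1 : (pairExp q ξ ε ε').shift = ε - ε' := by
    simp [pairExp, normalProd, rescale, lambdaExp, chargeSign, sub_eq_add_neg]
  have e2 : (pairExp q ξ ε ε').pow = ε - ε' := by
    simp [pairExp, normalProd, rescale, lambdaExp, chargeSign, sub_eq_add_neg]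
  have e3 : (lambdaExp q η 1).shift = -η := by simp [lambdaExp, chargeSign]
  have e4 : (lambdaExp q η 1).pow = -η := by simp [lambdaExp, chargeSign]
  have e5 : (lambdaExp q η 1).base = q := by
    rw [lambdaExp_base hη]; simp [chargeSign]
  have e6 := pairExp_base (ξ := ξ) hq hε hε'
  refine exchangeRelation_vertexOp hq hd h u₁ u₂ _ _ (by rw [e5]; exact hq)
    (by rw [e6]; exact zpow_ne_zero _ hξ) (by rw [e1, e4, ← he]; ring)
    (by rw [e2, e3, ← he]; ring) hs₁ hs₂ fun j => ?_
  rw [← hρ, e1, e3, e5, e6, ← zpow_mul, contraction_lambda_pair_one hq,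
    contraction_pair_lambda_one hq, fSer_eq, fSer_eq, rescale_expSer, rescale_expSer, ← expSer_add,
    ← expSer_add, funext ht, funext hu, mul_neg]

/-! ### The exchange relations of the generators -/

/-- The relations between the parameters that the exchange relations use:
`ξ = q_k^s` and `ξ' = q_{4-k}^s` for a sign `s`. -/
structure Specialization (q d Q ξ ξ' : ℂ) (s : ℤ) : Prop where
  q_ne_zero : q ≠ 0
  d_ne_zero : d ≠ 0
  generic : Generic q d
  sign : s * s = 1
  zpow_eq : q ^ s = Q
  mul_eq_one : ξ * ξ' * Q ^ 2 = 1
  struct : ∀ n : ℕ, structCoeff q d n * (1 + Q⁻¹ ^ (2 * n)) = ξ ^ n + ξ' ^ n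

namespace Specialization

variable {q d Q ξ ξ' : ℂ} {s : ℤ}

lemma ne_zero (S : Specialization q d Q ξ ξ' s) : ξ ≠ 0 := fun h0 => by
  have := S.mul_eq_one
  simp [h0] at this

lemma ne_zero' (S : Specialization q d Q ξ ξ' s) : ξ' ≠ 0 := fun h0 => by
  have := S.mul_eq_one
  simp [h0] at this

lemma Q_ne_zero (S : Specialization q d Q ξ ξ' s) : Q ≠ 0 := fun h0 => by
  have := S.mul_eq_one
  simp [h0] at this

lemma Q_sq_ne_zero (S : Specialization q d Q ξ ξ' s) : Q ^ 2 ≠ 0 := pow_ne_zero _ S.Q_ne_zero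

lemma pole_ne_zero (S : Specialization q d Q ξ ξ' s) : (Q ^ 2)⁻¹ * ξ ≠ 0 :=
  mul_ne_zero (inv_ne_zero S.Q_sq_ne_zero) S.ne_zero

lemma sign_neg (S : Specialization q d Q ξ ξ' s) : -s * -s = 1 := by rw [neg_mul_neg, S.sign]

lemma neg_mul_self (S : Specialization q d Q ξ ξ' s) : -s * s = -1 := by rw [neg_mul, S.sign]

lemma mul_neg_self (S : Specialization q d Q ξ ξ' s) : s * -s = -1 := by rw [mul_neg, S.sign]

lemma zpow_sub_neg (S : Specialization q d Q ξ ξ' s) : q ^ (s - -s) = Q ^ 2 := by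
  rw [sub_neg_eq_add, zpow_add₀ S.q_ne_zero, S.zpow_eq, sq]

lemma zpow_neg_sub (S : Specialization q d Q ξ ξ' s) : q ^ (-s - s) = (Q ^ 2)⁻¹ := by
  rw [← S.zpow_sub_neg, ← zpow_neg]
  congr 1
  ring

lemma sq_ne_one (S : Specialization q d Q ξ ξ' s) : Q ^ 2 ≠ 1 := fun h0 => by
  have hs : s ≠ 0 := fun h => by have := S.sign; simp [h] at this
  have := S.generic (s - -s) 0 (Or.inl (by omega))
  rw [S.zpow_sub_neg, zpow_zero, mul_one] at this
  exact this h0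

/-- The `n`-th power identities to which the exponents below reduce linearly. The third follows from
the second on multiplying by `Q^{2n} = (ξξ')⁻ⁿ`. -/
lemma relations (S : Specialization q d Q ξ ξ' s) (n : ℕ) :
    (s : ℂ) * s = 1 ∧
    structCoeff q d n + Q⁻¹ ^ (2 * n) * structCoeff q d n = ξ ^ n + ξ' ^ n ∧
    structCoeff q d n + Q ^ (2 * n) * structCoeff q d n = ξ⁻¹ ^ n + ξ'⁻¹ ^ n ∧
    Q⁻¹ ^ (2 * n) = ξ ^ n * ξ' ^ n ∧ Q ^ (2 * n) = ξ⁻¹ ^ n * ξ'⁻¹ ^ n ∧ ξ ^ n * ξ⁻¹ ^ n = 1 := by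
  have hX : ξ ^ n ≠ 0 := pow_ne_zero _ S.ne_zero
  have hX' : ξ' ^ n ≠ 0 := pow_ne_zero _ S.ne_zero'
  have hK : ξ ^ n * ξ' ^ n * Q ^ (2 * n) = 1 := by
    rw [pow_mul, ← mul_pow, ← mul_pow, S.mul_eq_one, one_pow]
  have hQ : Q ^ (2 * n) ≠ 0 := pow_ne_zero _ S.Q_ne_zero
  have h1 := S.struct n
  simp only [inv_pow] at h1 ⊢
  generalize Q ^ (2 * n) = K at *
  refine ⟨by exact_mod_cast S.sign, by linear_combination h1, ?_, ?_, ?_, mul_inv_cancel₀ hX⟩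
  · field_simp at h1 ⊢
    linear_combination (ξ ^ n * ξ' ^ n) * h1 + (ξ ^ n + ξ' ^ n) * hK
  · field_simp
    linear_combination -hK
  · field_simp
    linear_combination hK

/-! ### The twelve elementary exchange relations -/

lemma exchange_zero_same_pos (S : Specialization q d Q ξ ξ' s) (u₁ u₂ : ℂ) :
    ExchangeRelation ξ (fSer q d ξ) (fSer q d ξ⁻¹)
      (vertexOp q d u₁ u₂ (lambdaExp q s 0)) (vertexOp q d u₁ u₂ (pairExp q ξ s s))
      (fun _ _ => 0) := by
  -- The contraction is inverse to `f` in either order. There is no pole, so `s₁ = s₂ = 1` with zero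
  -- coefficients are placeholders, as in the later cases with fewer than two poles.
  refine (exchangeRelation_lambda_pair_zero S.q_ne_zero S.d_ne_zero S.generic u₁ u₂ S.ne_zero
    (e := 0) (t := fun n => 0) (u := fun n => 0)
    (α₁ := 0) (α₂ := 0) (s₁ := 1) (s₂ := 1) S.sign S.sign S.sign (by rw [sub_self, mul_zero])
    one_ne_zero one_ne_zero (fun n => ?_) (fun n => ?_) fun j => ?_).congr rfl rfl fun a b => ?_
  · rw [sub_self, zpow_zero]
    obtain ⟨hs, g1, g2, g7, g8, hX⟩ := S.relations n
    linear_combination (structCoeff q d n - ξ ^ n) * hs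
  · rw [sub_self, zpow_zero]
    obtain ⟨hs, g1, g2, g7, g8, hX⟩ := S.relations n
    linear_combination (structCoeff q d n - ξ⁻¹ ^ n) * hs
  · rw [sub_self, zpow_zero, S.sign]
    rw [add_zero, zero_mul, add_zero]
    exact intCoeff_expansion_one _ _ (by simp) j
  · simp only [zero_smul, add_zero]

lemma exchange_one_same_pos (S : Specialization q d Q ξ ξ' s) (u₁ u₂ : ℂ) :
    ExchangeRelation ξ⁻¹ (PowerSeries.rescale ξ (fSer q d ξ⁻¹)) (PowerSeries.rescale ξ⁻¹
      (fSer q d ξ))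
      (vertexOp q d u₁ u₂ (lambdaExp q s 1)) (vertexOp q d u₁ u₂ (pairExp q ξ s s))
      (fun _ _ => 0) := by
  refine (exchangeRelation_lambda_pair_one S.q_ne_zero S.d_ne_zero S.generic u₁ u₂ S.ne_zero
    (e := 0) (t := fun n => 0) (u := fun n => 0)
    (α₁ := 0) (α₂ := 0) (s₁ := 1) (s₂ := 1) S.sign S.sign S.sign
      (by rw [sub_self, mul_zero, neg_zero])
    one_ne_zero one_ne_zero (fun n => ?_) (fun n => ?_) fun j => ?_).congr rfl rfl fun a b => ?_
  · rw [sub_self, zpow_zero]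
    obtain ⟨hs, g1, g2, g7, g8, hX⟩ := S.relations n
    linear_combination hX + (ξ ^ n * structCoeff q d n - 1) * hs
  · rw [sub_self, zpow_zero]
    obtain ⟨hs, g1, g2, g7, g8, hX⟩ := S.relations n
    linear_combination hX + (ξ⁻¹ ^ n * structCoeff q d n - 1) * hs
  · rw [sub_self, zpow_zero, S.sign]
    rw [add_zero, zero_mul, add_zero]
    exact intCoeff_expansion_one _ _ (by simp) j
  · simp only [zero_smul, add_zero]

lemma exchange_zero_same_neg (S : Specialization q d Q ξ ξ' s) (u₁ u₂ : ℂ) :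
    ExchangeRelation ξ (fSer q d ξ) (fSer q d ξ⁻¹)
      (vertexOp q d u₁ u₂ (lambdaExp q (-s) 0)) (vertexOp q d u₁ u₂ (pairExp q ξ (-s) (-s)))
      (fun _ _ => 0) := by
  refine (exchangeRelation_lambda_pair_zero S.q_ne_zero S.d_ne_zero S.generic u₁ u₂ S.ne_zero
    (e := 0) (t := fun n => 0) (u := fun n => 0)
    (α₁ := 0) (α₂ := 0) (s₁ := 1) (s₂ := 1) S.sign_neg S.sign_neg S.sign_neg
      (by rw [sub_self, mul_zero])
    one_ne_zero one_ne_zero (fun n => ?_) (fun n => ?_) fun j => ?_).congr rfl rfl fun a b => ?_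
  · rw [sub_self, zpow_zero]
    obtain ⟨hs, g1, g2, g7, g8, hX⟩ := S.relations n
    push_cast
    linear_combination (structCoeff q d n - ξ ^ n) * hs
  · rw [sub_self, zpow_zero]
    obtain ⟨hs, g1, g2, g7, g8, hX⟩ := S.relations n
    push_cast
    linear_combination (structCoeff q d n - ξ⁻¹ ^ n) * hs
  · rw [sub_self, zpow_zero, S.sign_neg]
    rw [add_zero, zero_mul, add_zero]
    exact intCoeff_expansion_one _ _ (by simp) j
  · simp only [zero_smul, add_zero]

lemma exchange_one_same_neg (S : Specialization q d Q ξ ξ' s) (u₁ u₂ : ℂ) :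
    ExchangeRelation ξ⁻¹ (PowerSeries.rescale ξ (fSer q d ξ⁻¹)) (PowerSeries.rescale ξ⁻¹
      (fSer q d ξ))
      (vertexOp q d u₁ u₂ (lambdaExp q (-s) 1)) (vertexOp q d u₁ u₂ (pairExp q ξ (-s) (-s)))
      (fun _ _ => 0) := by
  refine (exchangeRelation_lambda_pair_one S.q_ne_zero S.d_ne_zero S.generic u₁ u₂ S.ne_zero
    (e := 0) (t := fun n => 0) (u := fun n => 0)
    (α₁ := 0) (α₂ := 0) (s₁ := 1) (s₂ := 1) S.sign_neg S.sign_neg S.sign_neg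
      (by rw [sub_self, mul_zero, neg_zero])
    one_ne_zero one_ne_zero (fun n => ?_) (fun n => ?_) fun j => ?_).congr rfl rfl fun a b => ?_
  · rw [sub_self, zpow_zero]
    obtain ⟨hs, g1, g2, g7, g8, hX⟩ := S.relations n
    push_cast
    linear_combination hX + (ξ ^ n * structCoeff q d n - 1) * hs
  · rw [sub_self, zpow_zero]
    obtain ⟨hs, g1, g2, g7, g8, hX⟩ := S.relations n
    push_cast
    linear_combination hX + (ξ⁻¹ ^ n * structCoeff q d n - 1) * hs
  · rw [sub_self, zpow_zero, S.sign_neg]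
    rw [add_zero, zero_mul, add_zero]
    exact intCoeff_expansion_one _ _ (by simp) j
  · simp only [zero_smul, add_zero]

/-- The function is a multiple of `(1 - ξ⁻¹x)/(1 - ξx)`: since `Q²ξ = ξ'⁻¹`, one of the two zeros
produced by `c_n(1 + Q^{2n})` cancels a pole. -/
lemma exchange_zero_opp_pos (S : Specialization q d Q ξ ξ' s) (u₁ u₂ : ℂ) :
    ExchangeRelation ξ (fSer q d ξ) (fSer q d ξ⁻¹)
      (vertexOp q d u₁ u₂ (lambdaExp q s 0)) (vertexOp q d u₁ u₂ (pairExp q ξ (-s) (-s)))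
      (fun a b => (ξ - ξ⁻¹) • ξ ^ (-a) • vertexOp q d u₁ u₂ (normalProd
        ((lambdaExp q s 0).rescale ξ) (pairExp q ξ (-s) (-s))) (a + b)) := by
  refine (exchangeRelation_lambda_pair_zero S.q_ne_zero S.d_ne_zero S.generic u₁ u₂ S.ne_zero
    (e := 0) (t := fun n => ξ ^ n - ξ⁻¹ ^ n) (u := fun n => ξ⁻¹ ^ n - ξ⁻¹⁻¹ ^ n)
    (α₁ := ξ - ξ⁻¹) (α₂ := 0) (s₁ := ξ) (s₂ := 1) S.sign S.sign_neg S.sign_neg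
      (by rw [sub_self, mul_zero])
    S.ne_zero one_ne_zero (fun n => ?_) (fun n => ?_) fun j => ?_).congr rfl rfl fun a b => ?_
  · rw [S.zpow_sub_neg]
    obtain ⟨hs, g1, g2, g7, g8, hX⟩ := S.relations n
    push_cast
    linear_combination (Q ^ (2 * n) * ξ ^ n - Q ^ (2 * n) * structCoeff q d n) * hs - g2 +
      ξ ^ n * g8 + ξ'⁻¹ ^ n * hX
  · rw [S.zpow_neg_sub]
    obtain ⟨hs, g1, g2, g7, g8, hX⟩ := S.relations n
    push_cast
    simp only [inv_inv]
    linear_combination (Q⁻¹ ^ (2 * n) * ξ⁻¹ ^ n - Q⁻¹ ^ (2 * n) * structCoeff q d n) * hs - g1 +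
      ξ⁻¹ ^ n * g7 + ξ' ^ n * hX
  · rw [sub_self, zpow_zero, S.neg_mul_self]
    rw [add_zero, zero_mul, add_zero]
    refine intCoeff_expansion_simple S.ne_zero (inv_ne_zero S.ne_zero) ?_ ?_ j
    · rw [zpow_neg_one, mul_one]
    · have hx := S.ne_zero
      have hx' := S.ne_zero'
      have hQ := S.Q_ne_zero
      have hm := S.mul_eq_one
      field_simp
  · simp only [zero_smul, add_zero, sub_zero]

/-- Here `c_n(1 + Q^{-2n})` cancels the pole coming from `ξⁿ` in `f`, leaving a multiple of `(1 -
ξ'x)/(1 - Q⁻²ξx)`. -/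
lemma exchange_zero_opp_neg (S : Specialization q d Q ξ ξ' s) (u₁ u₂ : ℂ) :
    ExchangeRelation ξ (fSer q d ξ) (fSer q d ξ⁻¹)
      (vertexOp q d u₁ u₂ (lambdaExp q (-s) 0)) (vertexOp q d u₁ u₂ (pairExp q ξ s s))
      (fun a b => (ξ - ξ⁻¹) • ((Q ^ 2)⁻¹ * ξ) ^ (-a) • vertexOp q d u₁ u₂ (normalProd
        ((lambdaExp q (-s) 0).rescale ((Q ^ 2)⁻¹ * ξ)) (pairExp q ξ s s)) (a + b)) := by
  refine (exchangeRelation_lambda_pair_zero S.q_ne_zero S.d_ne_zero S.generic u₁ u₂ S.ne_zero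
    (e := 0) (t := fun n => ((Q ^ 2)⁻¹ * ξ) ^ n - ξ' ^ n) (u := fun n =>
      ((Q ^ 2)⁻¹ * ξ)⁻¹ ^ n - ξ'⁻¹ ^ n)
    (α₁ := ξ - ξ⁻¹) (α₂ := 0) (s₁ := ((Q ^ 2)⁻¹ * ξ)) (s₂ := 1) S.sign_neg S.sign S.sign
      (by rw [sub_self, mul_zero])
    S.pole_ne_zero one_ne_zero (fun n => ?_) (fun n => ?_) fun j => ?_).congr rfl rfl fun a b => ?_
  · rw [S.zpow_neg_sub]
    obtain ⟨hs, g1, g2, g7, g8, hX⟩ := S.relations n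
    push_cast
    linear_combination (Q⁻¹ ^ (2 * n) * ξ ^ n - Q⁻¹ ^ (2 * n) * structCoeff q d n) * hs - g1
  · rw [S.zpow_sub_neg]
    obtain ⟨hs, g1, g2, g7, g8, hX⟩ := S.relations n
    push_cast
    simp only [mul_inv, inv_inv]
    linear_combination (Q ^ (2 * n) * ξ⁻¹ ^ n - Q ^ (2 * n) * structCoeff q d n) * hs - g2
  · rw [sub_self, zpow_zero, S.mul_neg_self]
    rw [add_zero, zero_mul, add_zero]
    refine intCoeff_expansion_simple S.pole_ne_zero S.ne_zero' ?_ ?_ j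
    · rw [zpow_neg_one, mul_one]
    · have hx := S.ne_zero
      have hx' := S.ne_zero'
      have hQ := S.Q_ne_zero
      have hm := S.mul_eq_one
      rw [zpow_neg_one, mul_one]
      field_simp
      linear_combination hm
  · simp only [zero_smul, add_zero, sub_zero]

lemma exchange_one_opp_pos (S : Specialization q d Q ξ ξ' s) (u₁ u₂ : ℂ) :
    ExchangeRelation ξ⁻¹ (PowerSeries.rescale ξ (fSer q d ξ⁻¹)) (PowerSeries.rescale ξ⁻¹
      (fSer q d ξ))
      (vertexOp q d u₁ u₂ (lambdaExp q s 1)) (vertexOp q d u₁ u₂ (pairExp q ξ (-s) (-s)))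
      (fun a b => (ξ⁻¹ - ξ) • (Q ^ 2) ^ (-a) • vertexOp q d u₁ u₂ (normalProd
        ((lambdaExp q s 1).rescale (Q ^ 2)) (pairExp q ξ (-s) (-s))) (a + b)) := by
  refine (exchangeRelation_lambda_pair_one S.q_ne_zero S.d_ne_zero S.generic u₁ u₂ S.ne_zero
    (e := 0) (t := fun n => (Q ^ 2) ^ n - (ξ * ξ'⁻¹) ^ n) (u := fun n => (Q ^ 2)⁻¹ ^ n -
      (ξ * ξ'⁻¹)⁻¹ ^ n)
    (α₁ := ξ⁻¹ - ξ) (α₂ := 0) (s₁ := (Q ^ 2)) (s₂ := 1) S.sign S.sign_neg S.sign_neg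
      (by rw [sub_self, mul_zero, neg_zero])
    S.Q_sq_ne_zero one_ne_zero (fun n => ?_) (fun n => ?_) fun j => ?_).congr rfl rfl fun a b => ?_
  · rw [S.zpow_sub_neg]
    obtain ⟨hs, g1, g2, g7, g8, hX⟩ := S.relations n
    push_cast
    linear_combination (Q ^ (2 * n) - Q ^ (2 * n) * ξ ^ n * structCoeff q d n) * hs - ξ ^ n * g2
  · rw [S.zpow_neg_sub]
    obtain ⟨hs, g1, g2, g7, g8, hX⟩ := S.relations n
    push_cast
    simp only [mul_inv, inv_inv]
    linear_combination (Q⁻¹ ^ (2 * n) - Q⁻¹ ^ (2 * n) * ξ⁻¹ ^ n * structCoeff q d n) * hs -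
      ξ⁻¹ ^ n * g1
  · rw [sub_self, zpow_zero, S.neg_mul_self]
    rw [add_zero, zero_mul, add_zero]
    refine intCoeff_expansion_simple S.Q_sq_ne_zero (mul_ne_zero S.ne_zero
      (inv_ne_zero S.ne_zero')) ?_ ?_ j
    · rw [neg_neg, zpow_one, mul_one]
    · have hx := S.ne_zero
      have hx' := S.ne_zero'
      have hQ := S.Q_ne_zero
      have hm := S.mul_eq_one
      rw [neg_neg, zpow_one]
      field_simp
      linear_combination -hm
  · simp only [zero_smul, add_zero, sub_zero]

lemma exchange_one_opp_neg (S : Specialization q d Q ξ ξ' s) (u₁ u₂ : ℂ) :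
    ExchangeRelation ξ⁻¹ (PowerSeries.rescale ξ (fSer q d ξ⁻¹)) (PowerSeries.rescale ξ⁻¹
      (fSer q d ξ))
      (vertexOp q d u₁ u₂ (lambdaExp q (-s) 1)) (vertexOp q d u₁ u₂ (pairExp q ξ s s))
      (fun a b => (ξ⁻¹ - ξ) • (1 : ℂ) ^ (-a) • vertexOp q d u₁ u₂ (normalProd ((lambdaExp q
        (-s) 1).rescale 1) (pairExp q ξ s s)) (a + b)) := by
  refine (exchangeRelation_lambda_pair_one S.q_ne_zero S.d_ne_zero S.generic u₁ u₂ S.ne_zero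
    (e := 0) (t := fun n => 1 ^ n - (ξ * ξ) ^ n) (u := fun n => 1⁻¹ ^ n - (ξ * ξ)⁻¹ ^ n)
    (α₁ := ξ⁻¹ - ξ) (α₂ := 0) (s₁ := 1) (s₂ := 1) S.sign_neg S.sign S.sign
      (by rw [sub_self, mul_zero, neg_zero])
    one_ne_zero one_ne_zero (fun n => ?_) (fun n => ?_) fun j => ?_).congr rfl rfl fun a b => ?_
  · rw [S.zpow_neg_sub]
    obtain ⟨hs, g1, g2, g7, g8, hX⟩ := S.relations n
    push_cast
    linear_combination (Q⁻¹ ^ (2 * n) - Q⁻¹ ^ (2 * n) * ξ ^ n * structCoeff q d n) * hs -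
      ξ ^ n * g1 + hX + g7
  · rw [S.zpow_sub_neg]
    obtain ⟨hs, g1, g2, g7, g8, hX⟩ := S.relations n
    push_cast
    linear_combination (Q ^ (2 * n) - Q ^ (2 * n) * ξ⁻¹ ^ n * structCoeff q d n) * hs -
      ξ⁻¹ ^ n * g2 + hX + g8
  · rw [sub_self, zpow_zero, S.mul_neg_self]
    rw [add_zero, zero_mul, add_zero]
    refine intCoeff_expansion_simple one_ne_zero (mul_ne_zero S.ne_zero S.ne_zero) ?_ ?_ j
    · rw [neg_neg, zpow_one, mul_one]
    · have hx := S.ne_zero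
      have hx' := S.ne_zero'
      have hQ := S.Q_ne_zero
      have hm := S.mul_eq_one
      rw [neg_neg, zpow_one]
      field_simp
  · simp only [zero_smul, add_zero, sub_zero]

/-- The powers `ξⁿ` cancel and only `-c_n(1 + Q^{2n})` remains, so the function is a Laurent
polynomial. -/
lemma exchange_zero_mixed_pos (S : Specialization q d Q ξ ξ' s) (u₁ u₂ : ℂ) :
    ExchangeRelation ξ (fSer q d ξ) (fSer q d ξ⁻¹)
      (vertexOp q d u₁ u₂ (lambdaExp q s 0)) (vertexOp q d u₁ u₂ (pairExp q ξ s (-s)))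
      (fun _ _ => 0) := by
  refine (exchangeRelation_lambda_pair_zero S.q_ne_zero S.d_ne_zero S.generic u₁ u₂ S.ne_zero
    (e := 2) (t := fun n => -ξ⁻¹ ^ n + -ξ'⁻¹ ^ n) (u := fun n => -ξ⁻¹⁻¹ ^ n + -ξ'⁻¹⁻¹ ^ n)
    (α₁ := 0) (α₂ := 0) (s₁ := 1) (s₂ := 1) S.sign S.sign S.sign_neg (by linear_combination 2 *
      S.sign)
    one_ne_zero one_ne_zero (fun n => ?_) (fun n => ?_) fun j => ?_).congr rfl rfl fun a b => ?_
  · rw [sub_self, zpow_zero, S.zpow_sub_neg]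
    obtain ⟨hs, g1, g2, g7, g8, hX⟩ := S.relations n
    push_cast
    linear_combination (-ξ ^ n - Q ^ (2 * n) * structCoeff q d n) * hs - g2
  · rw [sub_self, zpow_zero, S.zpow_neg_sub]
    obtain ⟨hs, g1, g2, g7, g8, hX⟩ := S.relations n
    push_cast
    simp only [inv_inv]
    linear_combination (-ξ⁻¹ ^ n - Q⁻¹ ^ (2 * n) * structCoeff q d n) * hs - g1
  · rw [S.zpow_neg_sub, S.sign]
    rw [zero_mul, add_zero]
    refine intCoeff_expansion_poly (inv_ne_zero S.ne_zero) (inv_ne_zero S.ne_zero') ?_ j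
    have hx := S.ne_zero
    have hx' := S.ne_zero'
    have hQ := S.Q_ne_zero
    have hm := S.mul_eq_one
    rw [zpow_one]
    field_simp
    linear_combination -hm
  · simp only [zero_smul, add_zero]

lemma exchange_one_mixed_neg (S : Specialization q d Q ξ ξ' s) (u₁ u₂ : ℂ) :
    ExchangeRelation ξ⁻¹ (PowerSeries.rescale ξ (fSer q d ξ⁻¹)) (PowerSeries.rescale ξ⁻¹
      (fSer q d ξ))
      (vertexOp q d u₁ u₂ (lambdaExp q (-s) 1)) (vertexOp q d u₁ u₂ (pairExp q ξ s (-s)))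
      (fun _ _ => 0) := by
  refine (exchangeRelation_lambda_pair_one S.q_ne_zero S.d_ne_zero S.generic u₁ u₂ S.ne_zero
    (e := 2) (t := fun n => -(ξ * ξ) ^ n + -(Q ^ 2)⁻¹ ^ n)
      (u := fun n => -(ξ * ξ)⁻¹ ^ n + -(Q ^ 2)⁻¹⁻¹ ^ n)
    (α₁ := 0) (α₂ := 0) (s₁ := 1) (s₂ := 1) S.sign_neg S.sign S.sign_neg (by linear_combination 2 *
      S.sign)
    one_ne_zero one_ne_zero (fun n => ?_) (fun n => ?_) fun j => ?_).congr rfl rfl fun a b => ?_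
  · rw [S.zpow_neg_sub, sub_self, zpow_zero]
    obtain ⟨hs, g1, g2, g7, g8, hX⟩ := S.relations n
    push_cast
    linear_combination (-Q⁻¹ ^ (2 * n) * ξ ^ n * structCoeff q d n - 1) * hs - ξ ^ n * g1 + hX + g7
  · rw [S.zpow_sub_neg, sub_self, zpow_zero]
    obtain ⟨hs, g1, g2, g7, g8, hX⟩ := S.relations n
    push_cast
    simp only [mul_inv, inv_inv]
    linear_combination (-Q ^ (2 * n) * ξ⁻¹ ^ n * structCoeff q d n - 1) * hs - ξ⁻¹ ^ n * g2 +
      hX + g8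
  · rw [S.zpow_sub_neg, S.mul_neg_self]
    rw [zero_mul, add_zero]
    refine intCoeff_expansion_poly (mul_ne_zero S.ne_zero S.ne_zero)
      (inv_ne_zero S.Q_sq_ne_zero) ?_ j
    have hx := S.ne_zero
    have hx' := S.ne_zero'
    have hQ := S.Q_ne_zero
    have hm := S.mul_eq_one
    rw [neg_neg, zpow_one]
    field_simp
  · simp only [zero_smul, add_zero]

/-- The `c_n` cancel and two poles remain, at `z = ξw` and `z = Q⁻²ξw`; they are distinct because
`Q² ≠ 1`. -/
lemma exchange_zero_mixed_neg (S : Specialization q d Q ξ ξ' s) (u₁ u₂ : ℂ) :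
    ExchangeRelation ξ (fSer q d ξ) (fSer q d ξ⁻¹)
      (vertexOp q d u₁ u₂ (lambdaExp q (-s) 0)) (vertexOp q d u₁ u₂ (pairExp q ξ s (-s)))
      (fun a b => (ξ⁻¹ * ((Q ^ 2)⁻¹ * ξ) / (ξ - ((Q ^ 2)⁻¹ * ξ))) • ξ ^ (-a) • vertexOp q d u₁ u₂
        (normalProd ((lambdaExp q (-s) 0).rescale ξ) (pairExp q ξ s (-s))) (a + b + 2) +
        (-(ξ⁻¹ * ξ / (ξ - ((Q ^ 2)⁻¹ * ξ)))) • ((Q ^ 2)⁻¹ * ξ) ^ (-a) • vertexOp q d u₁ u₂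
          (normalProd ((lambdaExp q (-s) 0).rescale ((Q ^ 2)⁻¹ * ξ)) (pairExp q ξ s (-s)))
            (a + b + 2)) := by
  refine (exchangeRelation_lambda_pair_zero S.q_ne_zero S.d_ne_zero S.generic u₁ u₂ S.ne_zero
    (e := -2) (t := fun n => ξ ^ n + ((Q ^ 2)⁻¹ * ξ) ^ n) (u := fun n => ξ⁻¹ ^ n +
      ((Q ^ 2)⁻¹ * ξ)⁻¹ ^ n)
    (α₁ := ξ⁻¹ * ((Q ^ 2)⁻¹ * ξ) / (ξ - ((Q ^ 2)⁻¹ * ξ))) (α₂ := -(ξ⁻¹ * ξ / (ξ -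
      ((Q ^ 2)⁻¹ * ξ)))) (s₁ := ξ) (s₂ := ((Q ^ 2)⁻¹ * ξ)) S.sign_neg S.sign S.sign_neg (by
        linear_combination (-2) * S.sign)
    S.ne_zero S.pole_ne_zero (fun n => ?_) (fun n => ?_) fun j => ?_).congr rfl rfl fun a b => ?_
  · rw [S.zpow_neg_sub, sub_self, zpow_zero]
    obtain ⟨hs, g1, g2, g7, g8, hX⟩ := S.relations n
    push_cast
    linear_combination (Q⁻¹ ^ (2 * n) * ξ ^ n + structCoeff q d n) * hs
  · rw [S.zpow_sub_neg, sub_self, zpow_zero]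
    obtain ⟨hs, g1, g2, g7, g8, hX⟩ := S.relations n
    push_cast
    simp only [mul_inv, inv_inv]
    linear_combination (Q ^ (2 * n) * ξ⁻¹ ^ n + structCoeff q d n) * hs
  · rw [S.zpow_neg_sub, S.mul_neg_self]
    rw [zpow_neg_one]
    refine intCoeff_expansion_double S.ne_zero S.pole_ne_zero ?_ ?_ j
    · have hx := S.ne_zero
      have hx' := S.ne_zero'
      have hQ := S.Q_ne_zero
      have hm := S.mul_eq_one
      intro h0
      apply S.sq_ne_one
      field_simp at h0
      exact h0
    · have hx := S.ne_zero
      have hx' := S.ne_zero'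
      have hQ := S.Q_ne_zero
      have hm := S.mul_eq_one
      field_simp
  · simp only [sub_neg_eq_add]

/-- The `c_n` cancel again; the poles are at `z = w` and `z = Q²w`. -/
lemma exchange_one_mixed_pos (S : Specialization q d Q ξ ξ' s) (u₁ u₂ : ℂ) :
    ExchangeRelation ξ⁻¹ (PowerSeries.rescale ξ (fSer q d ξ⁻¹)) (PowerSeries.rescale ξ⁻¹
      (fSer q d ξ))
      (vertexOp q d u₁ u₂ (lambdaExp q s 1)) (vertexOp q d u₁ u₂ (pairExp q ξ s (-s)))
      (fun a b => (ξ⁻¹ * (Q ^ 2) / (1 - (Q ^ 2))) • (1 : ℂ) ^ (-a) • vertexOp q d u₁ u₂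
        (normalProd ((lambdaExp q s 1).rescale 1) (pairExp q ξ s (-s))) (a + b + 2) +
        (-(ξ⁻¹ * 1 / (1 - (Q ^ 2)))) • (Q ^ 2) ^ (-a) • vertexOp q d u₁ u₂ (normalProd
          ((lambdaExp q s 1).rescale (Q ^ 2)) (pairExp q ξ s (-s))) (a + b + 2)) := by
  refine (exchangeRelation_lambda_pair_one S.q_ne_zero S.d_ne_zero S.generic u₁ u₂ S.ne_zero
    (e := -2) (t := fun n => 1 ^ n + (Q ^ 2) ^ n) (u := fun n => 1⁻¹ ^ n + (Q ^ 2)⁻¹ ^ n)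
    (α₁ := ξ⁻¹ * (Q ^ 2) / (1 - (Q ^ 2))) (α₂ := -(ξ⁻¹ * 1 / (1 -
      (Q ^ 2)))) (s₁ := 1) (s₂ := (Q ^ 2)) S.sign S.sign S.sign_neg (by linear_combination (-2) *
        S.sign)
    one_ne_zero S.Q_sq_ne_zero (fun n => ?_) (fun n => ?_) fun j => ?_).congr rfl rfl fun a b => ?_
  · rw [sub_self, zpow_zero, S.zpow_sub_neg]
    obtain ⟨hs, g1, g2, g7, g8, hX⟩ := S.relations n
    push_cast
    linear_combination (ξ ^ n * structCoeff q d n + Q ^ (2 * n)) * hs + hX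
  · rw [sub_self, zpow_zero, S.zpow_neg_sub]
    obtain ⟨hs, g1, g2, g7, g8, hX⟩ := S.relations n
    push_cast
    linear_combination (ξ⁻¹ ^ n * structCoeff q d n + Q⁻¹ ^ (2 * n)) * hs + hX
  · rw [S.zpow_sub_neg, S.sign]
    rw [zpow_neg_one]
    refine intCoeff_expansion_double one_ne_zero S.Q_sq_ne_zero ?_ ?_ j
    · exact S.sq_ne_one.symm
    · rw [mul_one]
  · simp only [sub_neg_eq_add]

end Specialization

/-! ### Cancellation and collapse of residues -/

namespace Specialization

variable {q d Q ξ ξ' : ℂ} {s : ℤ}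

/-- The current `𝒯(ξ; z)`, without the term whose coefficient vanishes. -/
def current (q d u₁ u₂ Q ξ ξ' : ℂ) (s : ℤ) : FormalField :=
  (fun m => Q • vertexOp q d u₁ u₂ (pairExp q ξ s s) (m - 0)) +
  (fun m => Q⁻¹ • vertexOp q d u₁ u₂ (pairExp q ξ (-s) (-s)) (m - 0)) +
  fun m => (Q * (1 - ξ * ξ) * (1 - ξ * ξ')) • vertexOp q d u₁ u₂ (pairExp q ξ s (-s)) (m - 2)

lemma mul_eq (S : Specialization q d Q ξ ξ' s) : ξ * ξ' = (Q ^ 2)⁻¹ :=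
  eq_inv_of_mul_eq_one_left S.mul_eq_one

lemma zpow_two_mul (S : Specialization q d Q ξ ξ' s) : q ^ (-2 * s) = (Q ^ 2)⁻¹ := by
  rw [← S.zpow_neg_sub]
  congr 1
  ring

lemma zpow_two_mul_neg (S : Specialization q d Q ξ ξ' s) : q ^ (-2 * -s) = Q ^ 2 := by
  rw [← S.zpow_sub_neg]
  congr 1
  ring

lemma exchange_zero (S : Specialization q d Q ξ ξ' s) (u₁ u₂ : ℂ) :
    ExchangeRelation ξ (fSer q d ξ) (fSer q d ξ⁻¹)
      (vertexOp q d u₁ u₂ (lambdaExp q s 0) + vertexOp q d u₁ u₂ (lambdaExp q (-s) 0))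
      (current q d u₁ u₂ Q ξ ξ' s) (fun a b => (Q * (ξ - ξ⁻¹)) • deltaMul ((Q ^ 2)⁻¹ * ξ)
        (vertexOp q d u₁ u₂ (lambdaExp q s 1) + vertexOp q d u₁ u₂ (lambdaExp q (-s) 1)) a b) := by
  refine ((((S.exchange_zero_same_pos u₁ u₂).smul_shift_right Q 0).add_right
    ((S.exchange_zero_opp_pos u₁ u₂).smul_shift_right Q⁻¹ 0)).add_right
    ((S.exchange_zero_mixed_pos u₁ u₂).smul_shift_right _ 2) |>.add_left
    ((((S.exchange_zero_opp_neg u₁ u₂).smul_shift_right Q 0).add_right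
    ((S.exchange_zero_same_neg u₁ u₂).smul_shift_right Q⁻¹ 0)).add_right
    ((S.exchange_zero_mixed_neg u₁ u₂).smul_shift_right _ 2))).congr rfl rfl fun a b => ?_
  -- At `z = ξw` both residues carry `:Λ₁^s(ξw) Λ₁^{-s}(ξw) Λ₂^{-s}(w):`.
  have hV : normalProd ((lambdaExp q s 0).rescale ξ) (pairExp q ξ (-s) (-s)) =
      normalProd ((lambdaExp q (-s) 0).rescale ξ) (pairExp q ξ s (-s)) :=
    normalProd_left_comm _ _ _
  have hc : ∀ t, normalProd ((lambdaExp q (-s) 0).rescale ((Q ^ 2)⁻¹ * ξ)) (pairExp q ξ s t) =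
      lambdaExp q t 1 := fun t =>
    normalProd_lambda_cancel S.q_ne_zero S.ne_zero S.sign 0 (by rw [S.zpow_two_mul]) _
  have hx := S.ne_zero
  have hQ := S.Q_ne_zero
  have hp : Q ^ 2 - 1 ≠ 0 := sub_ne_zero.2 S.sq_ne_one
  have hp' : ξ - (Q ^ 2)⁻¹ * ξ = ξ * (Q ^ 2 - 1) / Q ^ 2 := by field_simp
  -- `k1` cancels the residue of `exchange_zero_opp_pos`, weighted by `Q⁻¹`. `k2` equals the weight
  -- of `exchange_zero_opp_neg`, so that `Λ₂^s` and `Λ₂^{-s}` enter with equal coefficients.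
  have k1 : Q * (1 - ξ * ξ) * (1 - ξ * ξ') *
      (ξ⁻¹ * ((Q ^ 2)⁻¹ * ξ) / (ξ - (Q ^ 2)⁻¹ * ξ)) = -(Q⁻¹ * (ξ - ξ⁻¹)) := by
    rw [S.mul_eq, hp']
    field_simp
    ring
  have k2 : Q * (1 - ξ * ξ) * (1 - ξ * ξ') *
      -(ξ⁻¹ * ξ / (ξ - (Q ^ 2)⁻¹ * ξ)) = Q * (ξ - ξ⁻¹) := by
    rw [S.mul_eq, hp']
    field_simp
    ring
  simp only [hV, hc, deltaMul, Pi.add_apply, smul_add, sub_zero, smul_zero, smul_smul]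
  -- The factor `z²` in `𝒯` compensates the zero-mode exponent `e = -2` of the mixed product.
  rw [show a + (b - 2) + 2 = a + b by ring, ← mul_assoc (Q * (1 - ξ * ξ) * (1 - ξ * ξ')), k1,
    ← mul_assoc (Q * (1 - ξ * ξ) * (1 - ξ * ξ')), k2]
  module

lemma exchange_one (S : Specialization q d Q ξ ξ' s) (u₁ u₂ : ℂ) :
    ExchangeRelation ξ⁻¹ (PowerSeries.rescale ξ (fSer q d ξ⁻¹))
      (PowerSeries.rescale ξ⁻¹ (fSer q d ξ))
      (vertexOp q d u₁ u₂ (lambdaExp q s 1) + vertexOp q d u₁ u₂ (lambdaExp q (-s) 1))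
      (current q d u₁ u₂ Q ξ ξ' s) (fun a b => (-(Q⁻¹ * (ξ - ξ⁻¹))) • deltaMul (Q ^ 2)
        (FormalField.rescale ξ
          (vertexOp q d u₁ u₂ (lambdaExp q s 0) + vertexOp q d u₁ u₂ (lambdaExp q (-s) 0)))
            a b) := by
  refine ((((S.exchange_one_same_pos u₁ u₂).smul_shift_right Q 0).add_right
    ((S.exchange_one_opp_pos u₁ u₂).smul_shift_right Q⁻¹ 0)).add_right
    ((S.exchange_one_mixed_pos u₁ u₂).smul_shift_right _ 2) |>.add_left
    ((((S.exchange_one_opp_neg u₁ u₂).smul_shift_right Q 0).add_right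
    ((S.exchange_one_same_neg u₁ u₂).smul_shift_right Q⁻¹ 0)).add_right
    ((S.exchange_one_mixed_neg u₁ u₂).smul_shift_right _ 2))).congr rfl rfl fun a b => ?_
  -- At `z = w` both residues carry `:Λ₁^s(ξw) Λ₂^s(w) Λ₂^{-s}(w):`. At `z = Q²w` the two factors of
  -- type `Λ₂` cancel and `Λ₁^t(ξw)` survives.
  have hV : normalProd ((lambdaExp q s 1).rescale 1) (pairExp q ξ s (-s)) =
      normalProd ((lambdaExp q (-s) 1).rescale 1) (pairExp q ξ s s) := by
    rw [rescale_one, rescale_one, pairExp, pairExp, normalProd_comm _ (lambdaExp q (-s) 1),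
      normalProd_left_comm, normalProd_comm _ (lambdaExp q s 1)]
  have hc : ∀ t, normalProd ((lambdaExp q s 1).rescale (Q ^ 2)) (pairExp q ξ t (-s)) =
      (lambdaExp q t 0).rescale ξ := fun t => by
    have := normalProd_lambda_cancel S.q_ne_zero one_ne_zero S.sign_neg 1
      (show Q ^ 2 = q ^ (-2 * -s) * 1 by rw [S.zpow_two_mul_neg, mul_one])
      ((lambdaExp q t 0).rescale ξ)
    rwa [neg_neg, rescale_one, normalProd_comm (lambdaExp q (-s) 1)] at this
  have hr : ∀ t m, vertexOp q d u₁ u₂ ((lambdaExp q t 0).rescale ξ) m =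
      ξ ^ m • vertexOp q d u₁ u₂ (lambdaExp q t 0) m := fun t m =>
    vertexOp_rescale S.q_ne_zero S.generic S.ne_zero u₁ u₂ _ m
  have hx := S.ne_zero
  have hQ := S.Q_ne_zero
  have hp : 1 - Q ^ 2 ≠ 0 := sub_ne_zero.2 S.sq_ne_one.symm
  have k1 : Q * (1 - ξ * ξ) * (1 - ξ * ξ') * (ξ⁻¹ * Q ^ 2 / (1 - Q ^ 2)) =
      -(Q * (ξ⁻¹ - ξ)) := by
    rw [S.mul_eq]
    field_simp
    ring
  have k2 : Q * (1 - ξ * ξ) * (1 - ξ * ξ') * -(ξ⁻¹ * 1 / (1 - Q ^ 2)) =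
      -(Q⁻¹ * (ξ - ξ⁻¹)) := by
    rw [S.mul_eq]
    field_simp
    ring
  simp only [hV, hc, hr, deltaMul, FormalField.rescale, Pi.add_apply, smul_add, sub_zero,
    smul_zero, smul_smul]
  rw [show a + (b - 2) + 2 = a + b by ring, ← mul_assoc (Q * (1 - ξ * ξ) * (1 - ξ * ξ')), k1,
    ← mul_assoc (Q * (1 - ξ * ξ) * (1 - ξ * ξ')), k2]
  module

end Specialization

/-! ### The four specializations and the theorem -/

variable {q d : ℂ}

lemma structCoeff_mul (h : Generic q d) (n : ℕ) :
    structCoeff q d n * (1 + q⁻¹ ^ (2 * n)) = q1 q d ^ n + q3 q d ^ n := by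
  have h1 : (q2 q ^ n)⁻¹ = q⁻¹ ^ (2 * n) := by rw [q2, ← pow_mul, inv_pow]
  rw [structCoeff, h1]
  refine div_mul_cancel₀ _ fun h0 => ?_
  rcases Nat.eq_zero_or_pos n with rfl | hn
  · norm_num at h0
  · have h2 : q⁻¹ ^ (2 * n) = -1 := by linear_combination h0
    have h3 : q ^ (2 * n) = -1 := by
      rw [inv_pow, inv_eq_iff_eq_inv] at h2
      rw [h2]
      norm_num
    exact h.one_add_pow_ne_zero (n := 2 * n) (by omega) (by rw [h3]; ring)

lemma specialization_one (hq : q ≠ 0) (hd : d ≠ 0) (h : Generic q d) {x y : ℂ}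
    (hxy : x * y * q ^ 2 = 1) (hs : ∀ n : ℕ, q1 q d ^ n + q3 q d ^ n = x ^ n + y ^ n) :
    Specialization q d q x y 1 :=
  ⟨hq, hd, h, one_mul 1, zpow_one q, hxy, fun n => by rw [structCoeff_mul h, hs]⟩

/-- Multiplying `c_n(1 + q^{-2n}) = xⁿ + yⁿ` by `q^{2n} = (xy)⁻ⁿ` gives the same relation with all
parameters inverted. -/
lemma specialization_neg_one (hq : q ≠ 0) (hd : d ≠ 0) (h : Generic q d) {x y : ℂ}
    (hxy : x * y * q ^ 2 = 1) (hs : ∀ n : ℕ, q1 q d ^ n + q3 q d ^ n = x ^ n + y ^ n) :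
    Specialization q d q⁻¹ x⁻¹ y⁻¹ (-1) := by
  refine ⟨hq, hd, h, by norm_num, zpow_neg_one q, ?_, fun n => ?_⟩
  · rw [inv_pow, ← mul_inv, ← mul_inv, hxy, inv_one]
  · have h1 : x ^ n * y ^ n * q ^ (2 * n) = 1 := by
      rw [pow_mul, ← mul_pow, ← mul_pow, hxy, one_pow]
    have h2 := structCoeff_mul h n
    rw [hs] at h2
    have hx : x ^ n ≠ 0 := fun h0 => by simp [h0] at h1
    have hy : y ^ n ≠ 0 := fun h0 => by simp [h0] at h1
    have hz : q ^ (2 * n) ≠ 0 := pow_ne_zero _ hq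
    simp only [inv_inv, inv_pow] at h2 ⊢
    generalize q ^ (2 * n) = K at *
    field_simp at h2 ⊢
    linear_combination (x ^ n * y ^ n) * h2 + (x ^ n + y ^ n) * h1

lemma q1_mul_q3 (hq : q ≠ 0) (hd : d ≠ 0) : q1 q d * q3 q d * q ^ 2 = 1 := by
  rw [q1, q3]
  field_simp

/-- The two fusion points `q_k`, `k = 1, 3`, and the two signs. -/
lemma exists_specialization (hq : q ≠ 0) (hd : d ≠ 0) (h : Generic q d) (u₁ u₂ : ℂ) {qk : ℂ}
    (hk : qk = q1 q d ∨ qk = q3 q d) {ε : ℤ} (hε : ε = 1 ∨ ε = -1) :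
    ∃ ξ', Specialization q d (q ^ ε) (qk ^ ε) ξ' ε ∧
      T q d u₁ u₂ (qk ^ ε) = Specialization.current q d u₁ u₂ (q ^ ε) (qk ^ ε) ξ' ε := by
  have h13 := q1_mul_q3 hq hd
  have h31 : q3 q d * q1 q d * q ^ 2 = 1 := by rw [mul_comm (q3 q d), h13]
  have hq1 : q1 q d ≠ 0 := fun h0 => by simp [h0] at h13
  have hq3 : q3 q d ≠ 0 := fun h0 => by simp [h0] at h13
  have hT : ∀ (x : ℂ) ε ε' m, lambdaPair q d u₁ u₂ x ε 0 ε' 1 m =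
      vertexOp q d u₁ u₂ (pairExp q x ε ε') m := fun _ _ _ _ => rfl
  rcases hε with rfl | rfl
  · simp only [zpow_one]
    rcases hk with rfl | rfl
    · refine ⟨q3 q d, specialization_one hq hd h h13 fun _ => rfl, funext fun m => ?_⟩
      simp only [T, Tij, hT, Specialization.current, Pi.add_apply, sub_zero]
      -- The coefficient of `Λ₁⁻Λ₂⁺` contains `1 - q₁⁻¹q₁ = 0`. For the lower sign it is the
      -- coefficient of `Λ₁⁺Λ₂⁻` that vanishes.
      rw [inv_mul_cancel₀ hq1, mul_comm (q3 q d)]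
      module
    · refine ⟨q1 q d, specialization_one hq hd h h31 fun _ => add_comm _ _, funext fun m => ?_⟩
      simp only [T, Tij, hT, Specialization.current, Pi.add_apply, sub_zero]
      rw [inv_mul_cancel₀ hq3, mul_comm (q3 q d)]
      module
  · simp only [zpow_neg_one]
    rcases hk with rfl | rfl
    · refine ⟨(q3 q d)⁻¹, specialization_neg_one hq hd h h13 fun _ => rfl, funext fun m => ?_⟩
      simp only [T, Tij, hT, Specialization.current, Pi.add_apply, sub_zero, neg_neg, inv_inv]
      rw [mul_inv_cancel₀ hq1, mul_comm (q3 q d)⁻¹]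
      module
    · refine ⟨(q1 q d)⁻¹, specialization_neg_one hq hd h h31 fun _ => add_comm _ _,
        funext fun m => ?_⟩
      simp only [T, Tij, hT, Specialization.current, Pi.add_apply, sub_zero, neg_neg, inv_inv]
      rw [mul_inv_cancel₀ hq3, mul_comm (q3 q d)⁻¹]
      module

lemma W_eq (u₁ u₂ : ℂ) (i : Fin 2) {ε : ℤ} (hε : ε = 1 ∨ ε = -1) :
    vertexOp q d u₁ u₂ (lambdaExp q ε i) + vertexOp q d u₁ u₂ (lambdaExp q (-ε) i) =
      W q d u₁ u₂ i := by
  rcases hε with rfl | rfl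
  · rfl
  · rw [neg_neg, add_comm]
    rfl

end QSVir

end

theorem mainTheorem4 (q d u₁ u₂ : ℂ) (hq : q ≠ 0) (hd : d ≠ 0)
    (hgen : ∀ n m : ℤ, (n ≠ 0 ∨ m ≠ 0) → q ^ n * d ^ m ≠ 1)
    (qk : ℂ) (hk : qk = QSVir.q1 q d ∨ qk = QSVir.q3 q d)
    (ε : ℤ) (hε : ε = 1 ∨ ε = -1) :
    QSVir.ExchangeRelation (qk ^ ε)
      (QSVir.fSer q d (qk ^ ε)) (QSVir.fSer q d (qk ^ (-ε)))
      (QSVir.W q d u₁ u₂ 0) (QSVir.T q d u₁ u₂ (qk ^ ε))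
      (fun a b => (ε * q ^ ε * (qk - qk⁻¹)) •
        QSVir.deltaMul (qk ^ ε / QSVir.q2 q ^ ε) (QSVir.W q d u₁ u₂ 1) a b) ∧
    QSVir.ExchangeRelation (qk ^ (-ε))
      (PowerSeries.rescale (qk ^ ε) (QSVir.fSer q d (qk ^ (-ε))))
      (PowerSeries.rescale ((qk ^ ε)⁻¹) (QSVir.fSer q d (qk ^ ε)))
      (QSVir.W q d u₁ u₂ 1) (QSVir.T q d u₁ u₂ (qk ^ ε))
      (fun a b => (-(ε * q ^ (-ε) * (qk - qk⁻¹))) •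
        QSVir.deltaMul (QSVir.q2 q ^ ε)
          (QSVir.FormalField.rescale (qk ^ ε) (QSVir.W q d u₁ u₂ 0)) a b) := by
  obtain ⟨ξ', S, hT⟩ := QSVir.exists_specialization hq hd hgen u₁ u₂ hk hε
  have h0 := S.exchange_zero u₁ u₂
  have h1 := S.exchange_one u₁ u₂
  rw [QSVir.W_eq u₁ u₂ 0 hε, QSVir.W_eq u₁ u₂ 1 hε, ← hT] at h0 h1
  have hq2 : QSVir.q2 q ^ ε = (q ^ ε) ^ 2 := by
    rw [QSVir.q2, ← zpow_natCast, ← zpow_natCast, ← zpow_mul, ← zpow_mul, mul_comm]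
  -- The sign in front of the right-hand sides is absorbed by the oddness of `qk - qk⁻¹` under
  -- inversion.
  have hsub : (ε : ℂ) * (qk - qk⁻¹) = qk ^ ε - (qk ^ ε)⁻¹ := by
    rcases hε with rfl | rfl
    · simp
    · simp
  rw [zpow_neg qk, zpow_neg q, hq2, div_eq_inv_mul, mul_right_comm, hsub, mul_comm _ (q ^ ε),
    mul_right_comm (ε : ℂ), hsub, mul_comm _ (q ^ ε)⁻¹]
  exact ⟨h0, h1⟩
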